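/- Let $\alpha,\beta\in\mathbb{C}$ and consider the complex mKdV equation $$u_t+\alpha\bar u u u_x+\beta u^2\bar u_x+u_{xxx}=0$$ for a complex-valued function $u(t,x)$. A smooth real-valued function $T(t,x,u,\bar u,u_x,\bar u_x)$ is a \emph{conserved density} if there is a smooth real-valued function $X$ of $t,x,u,\bar u$ and finitely many $x$-derivatives of $u,\bar u$ such that $D_tT+D_xX=0$ holds identically in $t,x,u,\bar u$ and the $x$-derivatives of $u,\bar u$, after all $t$-derivatives of $u,\bar u$ have been eliminated through the equation. Two densities are \emph{equivalent} if they differ by a total $x$-derivative $D_x\Upsilon$, where $\Upsilon$ is a smooth real-valued function of $t,x,u,\bar u$ and finitely many $x$-derivatives of $u,\bar u$. Then the following functions $T$ are conserved densities in the stated cases: (i) if $\operatorname{Im}\alpha=\operatorname{Im}\beta$: $\;T=u\bar u$; (ii) if $\operatorname{Im}\alpha=\operatorname{Im}\beta=0$: $\;T=-3u_x\bar u_x+\tfrac12(\alpha+\beta)u^2\bar u^2$ and $T=-3t\,u_x\bar u_x+\tfrac12(\alpha+\beta)t\,u^2\bar u^2-x\,u\bar u$; (iii) if $\alpha=2\beta$: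 $\;T=u+\bar u$ and $T=i(\bar u-u)$; (iv) if $\alpha=3\beta$: $\;T=\tfrac12(u^2+\bar u^2)$ and $T=\tfrac{i}{2}(\bar u^2-u^2)$; (v) if $\operatorname{Im}\alpha=0$ and $\beta=0$: $\;T=i(u_x\bar u-\bar u_xu)$. For given $\alpha,\beta$, those of these densities whose condition on $\alpha,\beta$ holds are linearly independent over $\mathbb{R}$ modulo total $x$-derivatives. If moreover $(\alpha,\beta)\neq(0,0)$, there are no others: every conserved density $T(t,x,u,\bar u,u_x,\bar u_x)$ is equivalent to a linear combination, with real constant coefficients, of those densities whose condition on $\alpha,\beta$ holds. -/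

import Mathlib

open scoped ContDiff ComplexConjugate

noncomputable section

namespace ComplexMKdV

/-- The space with coordinates `(t, x, (u, u_x, …, ∂_xⁿ u))`. The coordinates `ū, ū_x, …` are the
complex conjugates, so that a function of `t, x, u, ū, u_x, ū_x, …` is a function on this space,
and its smoothness is smoothness over `ℝ`. -/
abbrev JetSpace (n : ℕ) : Type := ℝ × ℝ × (Fin (n + 1) → ℂ)

/-- The point of `JetSpace n` given by `t`, `x` and a sequence `w = (u, u_x, u_xx, …)` of values of
all the `x`-derivatives. -/
def jet (n : ℕ) (t x : ℝ) (w : ℕ → ℂ) : JetSpace n := (t, x, fun k => w k)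

/-- The total `x`-derivative `D_x f = f_x + u_x f_u + ū_x f_ū + u_xx f_{u_x} + ū_xx f_{ū_x} + …`
of a function of order `n`, a function of order `n + 1`. -/
def totalDx {E : Type*} [NormedAddCommGroup E] [NormedSpace ℝ E] {n : ℕ} (f : JetSpace n → E) :
    JetSpace (n + 1) → E :=
  fun j => fderiv ℝ f (j.1, j.2.1, fun k => j.2.2 k.castSucc) (0, 1, fun k => j.2.2 k.succ)

/-- The iterated total `x`-derivative `D_x^k f`. -/
def iterDx {E : Type*} [NormedAddCommGroup E] [NormedSpace ℝ E] {n : ℕ} (f : JetSpace n → E) :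
    (k : ℕ) → JetSpace (n + k) → E
  | 0 => f
  | k + 1 => totalDx (iterDx f k)

/-- The value `-(α ū u u_x + β u² ū_x + u_xxx)` of `u_t` under the complex mKdV equation. -/
def evolution (α β : ℂ) : JetSpace 3 → ℂ :=
  fun j => -(α * conj (j.2.2 0) * j.2.2 0 * j.2.2 1 + β * j.2.2 0 ^ 2 * conj (j.2.2 1) + j.2.2 3)

/-- The total `t`-derivative `D_t f = f_t + u_t f_u + ū_t f_ū + u_tx f_{u_x} + …`, at the point with
coordinates `t, x, w = (u, u_x, u_xx, …)`, after the elimination of the `t`-derivatives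
`u_t, u_tx, …` by the complex mKdV equation and its total `x`-derivatives. -/
def totalDt (α β : ℂ) {n : ℕ} (f : JetSpace n → ℝ) (t x : ℝ) (w : ℕ → ℂ) : ℝ :=
  fderiv ℝ f (jet n t x w) (1, 0, fun k => iterDx (evolution α β) k (jet (3 + k) t x w))

/-- `T` is a real conserved density of the complex mKdV equation: it is smooth, and there is a
smooth real flux `X`, depending on `t, x, u, ū` and `x`-derivatives of `u, ū` up to some finite
order, for which `D_t T + D_x X = 0` holds as a consequence of the equation. -/
def IsConservedDensity (α β : ℂ) {n : ℕ} (T : JetSpace n → ℝ) : Prop :=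
  ContDiff ℝ ∞ T ∧ ∃ (m : ℕ) (X : JetSpace m → ℝ), ContDiff ℝ ∞ X ∧
    ∀ (t x : ℝ) (w : ℕ → ℂ), totalDt α β T t x w + totalDx X (jet (m + 1) t x w) = 0

/-- `T` and `T'` are equivalent: they differ by a total `x`-derivative `D_x Υ`, where `Υ` is a
smooth function of `t, x, u, ū` and `x`-derivatives of `u, ū` up to some finite order. -/
def EquivModDx {n : ℕ} (T T' : JetSpace n → ℝ) : Prop :=
  ∃ (m : ℕ) (Υ : JetSpace m → ℝ), ContDiff ℝ ∞ Υ ∧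
    ∀ (t x : ℝ) (w : ℕ → ℂ),
      T (jet n t x w) - T' (jet n t x w) = totalDx Υ (jet (m + 1) t x w)

/-- The eight densities of the classification, as expressions in `t`, `x`, `u` and `v = u_x`:
momentum, energy, Galilean energy, the two mass densities, the two momentum densities without
phase invariance, and the angular twist. -/
def complexDensity (α β : ℂ) (t x : ℝ) (u v : ℂ) : Fin 8 → ℂ :=
  ![u * conj u,
    -3 * v * conj v + 1 / 2 * (α + β) * u ^ 2 * conj u ^ 2,
    -3 * t * v * conj v + 1 / 2 * (α + β) * t * u ^ 2 * conj u ^ 2 - x * u * conj u,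
    u + conj u,
    Complex.I * (conj u - u),
    1 / 2 * (u ^ 2 + conj u ^ 2),
    Complex.I * (1 / 2) * (conj u ^ 2 - u ^ 2),
    Complex.I * (v * conj u - conj v * u)]

/-- The condition on the coefficients under which each of the eight densities is admitted. -/
def Admitted (α β : ℂ) : Fin 8 → Prop :=
  ![α.im = β.im,
    α.im = 0 ∧ β.im = 0,
    α.im = 0 ∧ β.im = 0,
    α = 2 * β,
    α = 2 * β,
    α = 3 * β,
    α = 3 * β,
    α.im = 0 ∧ β = 0]

/-- The eight densities as real functions of order one (where a density is admitted, the complex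
expression is real, so that taking the real part does not change it). -/
def density (α β : ℂ) (k : Fin 8) : JetSpace 1 → ℝ :=
  fun j => (complexDensity α β j.1 j.2.1 (j.2.2 0) (j.2.2 1) k).re

theorem density_eq_complexDensity (α β : ℂ) (k : Fin 8) (h : Admitted α β k) (j : JetSpace 1) :
    (density α β k j : ℂ) = complexDensity α β j.1 j.2.1 (j.2.2 0) (j.2.2 1) k := by
  apply Complex.ext
  · simp [density]
  · rw [Complex.ofReal_im]
    fin_cases k <;> simp [Admitted] at h <;>
      simp [complexDensity, pow_two, h] <;> ring

end ComplexMKdV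

end

open ComplexMKdV

/-! Completeness is proved by unwinding `D_t T + D_x X = 0` from the highest derivative down. `D_t
T` involves derivatives up to `u_xxxx`, so the flux may be taken of order three (`exists_order_eq`).
The coefficients of `u_xxxx` and `u_xxx` determine `X` up to a function `Z` of order one, and what
remains is a cubic polynomial in `u_xx` (`IsFlux.exists_remainder`). Two of its coefficients force
`T` to be quadratic in `u_x`, with leading coefficients depending on `t` alone
(`exists_quadratic_in_ux`).

Subtracting `D_x Υ` with `Υ(t, x, u)` normalizes the lower terms (`exists_gauge`). Symmetry of the
second derivatives of `Z` in `u_x` then reduces the linear part to `b(t) Re u Im u_x`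
(`linear_part_of_isFlux`). Integrating `Z` in `u_x` leaves a function `K(t, x, u)` and a cubic
identity in `u_x`, which is a system for `K` and the part `C` of `T` free of `u_x`
(`constant_part_of_isFlux`). Its top coefficient prescribes the third derivative of `C` in `u`, so
`C` is a quartic polynomial. Consistency makes the quadratic part `a(t) |u_x|²`, with `a = 0` unless
`α` and `β` are real (`quadratic_part_algebra`).

The symmetry of the mixed derivatives of `K`, sorted by degree in `u`, settles the rest
(`linear_coeff_algebra`, `conditions_algebra`). The coefficients of `C` of degree one and two in `u`
are constant, except that `a'` is matched by `a' x |u|² / 3`: this is the Galilean energy.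
Contracted with a term of `C`, the nonlinearity must be an exact form in `u`. For terms linear in
`u` this means `α = 2β`, because `d(u² ū) = 2|u|² du + u² dū`; for `u²` it means `α = 3β`, because
`d(u³ ū) = 3u|u|² du + u³ dū`; for `|u|²` it means `Im α = Im β`. A nonzero `b` requires `Im(α |u|²
|v|² + β u² v̄²) = 0` for all `u, v`, hence real `α` and `β = 0` (`twist_algebra`).

That the listed densities are conserved is shown by explicit fluxes. For independence, a total
derivative `D_x Υ` of order one has `Υ` of order zero; it is then affine in `u_x`, and the symmetry
of the second derivatives of `Υ` eliminates every coefficient. -/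

namespace ComplexMKdV

/-! ### Smooth primitives depending on parameters -/

section Primitive

variable {P : Type*} [NormedAddCommGroup P] [NormedSpace ℝ P] [FiniteDimensional ℝ P]

/-- Differentiation under the integral sign. Finite dimension of `P` makes a closed ball around `p`
compact, and this supplies the constant dominating the derivative. -/
theorem hasFDerivAt_integral_unitInterval {f : P × ℝ → ℝ} (hf : ContDiff ℝ 1 f) (p : P) :
    HasFDerivAt (fun p => ∫ s in (0:ℝ)..1, f (p, s))
      (∫ s in (0:ℝ)..1, (fderiv ℝ f (p, s)).comp (ContinuousLinearMap.inl ℝ P ℝ)) p := by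
  have hcont : Continuous fun z : P × ℝ =>
      (fderiv ℝ f z).comp (ContinuousLinearMap.inl ℝ P ℝ) :=
    (hf.continuous_fderiv one_ne_zero).clm_comp continuous_const
  have hK : IsCompact (Metric.closedBall p 1 ×ˢ Set.Icc (0:ℝ) 1) :=
    (isCompact_closedBall p 1).prod isCompact_Icc
  obtain ⟨M, hM⟩ := hK.exists_bound_of_continuousOn hcont.continuousOn
  refine intervalIntegral.hasFDerivAt_integral_of_dominated_of_fderiv_le
    (F := fun p s => f (p, s)) (bound := fun _ => M)
    (F' := fun p s => (fderiv ℝ f (p, s)).comp (ContinuousLinearMap.inl ℝ P ℝ))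
    (Metric.closedBall_mem_nhds p one_pos) ?_ ?_ ?_ ?_ ?_ ?_
  · refine Filter.Eventually.of_forall fun x => ?_
    have : Continuous fun s : ℝ => f (x, s) := hf.continuous.comp (by fun_prop)
    exact this.aestronglyMeasurable
  · have : Continuous fun s : ℝ => f (p, s) := hf.continuous.comp (by fun_prop)
    exact this.intervalIntegrable _ _
  · have : Continuous fun s : ℝ =>
        (fderiv ℝ f (p, s)).comp (ContinuousLinearMap.inl ℝ P ℝ) := hcont.comp (by fun_prop)
    exact this.aestronglyMeasurable
  · refine Filter.Eventually.of_forall fun s hs x hx => hM (x, s) ⟨hx, ?_⟩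
    rw [Set.uIoc_of_le zero_le_one] at hs
    exact ⟨hs.1.le, hs.2⟩
  · exact intervalIntegrable_const
  · refine Filter.Eventually.of_forall fun s _ x _ => ?_
    have h1 : HasFDerivAt f (fderiv ℝ f (x, s)) (x, s) :=
      (hf.differentiable one_ne_zero _).hasFDerivAt
    exact h1.comp x (hasFDerivAt_prodMk_left x s)

/-- By induction on the order: each directional derivative in the parameter is again such an
integral, with another smooth integrand. The induction therefore has to quantify over `f`. -/
theorem contDiff_integral_unitInterval (n : ℕ) : ∀ {f : P × ℝ → ℝ}, ContDiff ℝ ∞ f →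
    ContDiff ℝ n fun p => ∫ s in (0:ℝ)..1, f (p, s) := by
  induction n with
  | zero =>
    intro f hf
    have h : Differentiable ℝ fun p => ∫ s in (0:ℝ)..1, f (p, s) := fun p =>
      (hasFDerivAt_integral_unitInterval (hf.of_le (by exact_mod_cast le_top)) p).differentiableAt
    exact_mod_cast (contDiff_zero (𝕜 := ℝ)).2 h.continuous
  | succ n ih =>
    intro f hf
    have h1 := hasFDerivAt_integral_unitInterval (P := P) (f := f)
      (hf.of_le (by exact_mod_cast le_top))
    push_cast
    rw [contDiff_succ_iff_fderiv_apply]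
    refine ⟨fun p => (h1 p).differentiableAt, by simp, fun y => ?_⟩
    have hg : ContDiff ℝ ∞ fun z : P × ℝ => fderiv ℝ f z (y, 0) :=
      (contDiff_infty_iff_fderiv.1 hf).2.clm_apply contDiff_const
    convert ih hg using 2 with p
    rw [(h1 p).fderiv, ContinuousLinearMap.intervalIntegral_apply]
    · simp
    · have : Continuous fun s : ℝ =>
          (fderiv ℝ f (p, s)).comp (ContinuousLinearMap.inl ℝ P ℝ) :=
        ((contDiff_infty_iff_fderiv.1 hf).2.continuous.clm_comp continuous_const).comp
          (by fun_prop : Continuous fun s : ℝ => (p, s))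
      exact this.intervalIntegrable _ _

/-- The primitive `∫₀^y f(p, r) dr` is written as `∫₀¹ y f(p, s y) ds`. The interval is then fixed
and `y` is one more parameter, so joint smoothness follows from the preceding lemma. -/
theorem exists_smooth_primitive {f : P × ℝ → ℝ} (hf : ContDiff ℝ ∞ f) :
    ∃ F : P × ℝ → ℝ, ContDiff ℝ ∞ F ∧ (∀ p, F (p, 0) = 0) ∧
      ∀ z, fderiv ℝ F z (0, 1) = f z := by
  have hg : ContDiff ℝ ∞ fun z : (P × ℝ) × ℝ => z.1.2 * f (z.1.1, z.2 * z.1.2) :=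
    (contDiff_snd.comp contDiff_fst).mul (hf.comp (by fun_prop))
  have hF : ContDiff ℝ ∞ fun z : P × ℝ => ∫ s in (0:ℝ)..1, z.2 * f (z.1, s * z.2) :=
    contDiff_infty.2 fun n => contDiff_integral_unitInterval n hg
  refine ⟨_, hF, fun p => by simp, fun z => ?_⟩
  have h1 : HasDerivAt (fun y : ℝ => ∫ s in (0:ℝ)..1, y * f (z.1, s * y))
      (fderiv ℝ (fun z : P × ℝ => ∫ s in (0:ℝ)..1, z.2 * f (z.1, s * z.2)) z (0, 1)) z.2 := by
    have := ((hF.differentiable (by simp)) z).hasFDerivAt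
    exact this.comp_hasDerivAt z.2 ((hasDerivAt_const z.2 z.1).prodMk (hasDerivAt_id z.2))
  have hc : Continuous fun y : ℝ => f (z.1, y) := hf.continuous.comp (by fun_prop)
  have h2 : HasDerivAt (fun y : ℝ => ∫ s in (0:ℝ)..1, y * f (z.1, s * y)) (f z) z.2 := by
    have : (fun y : ℝ => ∫ s in (0:ℝ)..1, y * f (z.1, s * y)) =
        fun y : ℝ => ∫ r in (0:ℝ)..y, f (z.1, r) := by
      funext y
      rw [intervalIntegral.integral_const_mul,
        intervalIntegral.mul_integral_comp_mul_right (f := fun r => f (z.1, r))]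
      simp
    rw [this]
    exact intervalIntegral.integral_hasDerivAt_right (hc.intervalIntegrable _ _)
      (hc.stronglyMeasurableAtFilter _ _) hc.continuousAt
  exact h1.unique h2

end Primitive

/-! ### Calculus along lines -/

theorem eq_quartic_of_hasDerivAt {f : ℝ → ℝ} {c₀ c₁ c₂ c₃ : ℝ}
    (h : ∀ r, HasDerivAt f (c₀ + c₁ * r + c₂ * r ^ 2 + c₃ * r ^ 3) r) (r : ℝ) :
    f r = f 0 + c₀ * r + c₁ / 2 * r ^ 2 + c₂ / 3 * r ^ 3 + c₃ / 4 * r ^ 4 := by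
  have hg : ∀ r, HasDerivAt
      (fun r => f r - (c₀ * r + c₁ / 2 * r ^ 2 + c₂ / 3 * r ^ 3 + c₃ / 4 * r ^ 4)) 0 r := by
    intro r
    have h1 := ((((hasDerivAt_id r).const_mul c₀).add
      (((hasDerivAt_id r).pow 2).const_mul (c₁ / 2))).add
      (((hasDerivAt_id r).pow 3).const_mul (c₂ / 3))).add
      (((hasDerivAt_id r).pow 4).const_mul (c₃ / 4))
    refine ((h r).sub h1).congr_deriv ?_
    simp
    ring
  have := is_const_of_deriv_eq_zero (fun r => (hg r).differentiableAt)
    (fun r => (hg r).deriv) r 0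
  simp at this
  linarith

theorem eq_cubic_of_hasDerivAt {f : ℝ → ℝ} {c₀ c₁ c₂ : ℝ}
    (h : ∀ r, HasDerivAt f (c₀ + c₁ * r + c₂ * r ^ 2) r) (r : ℝ) :
    f r = f 0 + c₀ * r + c₁ / 2 * r ^ 2 + c₂ / 3 * r ^ 3 := by
  have := eq_quartic_of_hasDerivAt (c₀ := c₀) (c₁ := c₁) (c₂ := c₂) (c₃ := 0) (fun r =>
    (h r).congr_deriv (by ring)) r
  linarith

/-- Four nodes determine a cubic. This is how identities are separated by homogeneity, first in
`u_xx` and later in `u_x`. -/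
theorem cubic_coeff_eq_zero {c₀ c₁ c₂ c₃ : ℝ}
    (h : ∀ r : ℝ, c₀ + c₁ * r + c₂ * r ^ 2 + c₃ * r ^ 3 = 0) :
    c₀ = 0 ∧ c₁ = 0 ∧ c₂ = 0 ∧ c₃ = 0 := by
  have h0 := h 0
  have h1 := h 1
  have h2 := h (-1)
  have h3 := h 2
  norm_num at h0 h1 h2 h3
  refine ⟨?_, ?_, ?_, ?_⟩ <;> linarith

section Line

variable {V W : Type*} [NormedAddCommGroup V] [NormedSpace ℝ V]
  [NormedAddCommGroup W] [NormedSpace ℝ W]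

theorem hasDerivAt_line {f : V → W} (hf : Differentiable ℝ f) (p h : V) (r : ℝ) :
    HasDerivAt (fun r : ℝ => f (p + r • h)) (fderiv ℝ f (p + r • h) h) r := by
  have h1 : HasDerivAt (fun r : ℝ => p + r • h) h r := by
    simpa using ((hasDerivAt_id r).smul_const h).const_add p
  exact (hf _).hasFDerivAt.comp_hasDerivAt r h1

theorem fderiv_eq_of_hasDerivAt_line {f : V → W} (hf : Differentiable ℝ f) {p h : V} {c : W}
    (hc : HasDerivAt (fun r : ℝ => f (p + r • h)) c 0) : fderiv ℝ f p h = c := by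
  simpa using (hasDerivAt_line hf p h 0).unique hc

theorem eq_of_fderiv_line_eq_zero {f : V → W} (hf : Differentiable ℝ f) (p h : V)
    (h0 : ∀ r : ℝ, fderiv ℝ f (p + r • h) h = 0) : f (p + h) = f p := by
  have := is_const_of_deriv_eq_zero (fun r => (hasDerivAt_line hf p h r).differentiableAt)
    (fun r => by rw [(hasDerivAt_line hf p h r).deriv, h0]) 1 0
  simpa using this

theorem ContDiff.smooth_fderiv {f : V → W} (hf : ContDiff ℝ ∞ f) : ContDiff ℝ ∞ (fderiv ℝ f) :=
  (contDiff_infty_iff_fderiv.1 hf).2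

theorem ContDiff.smooth_differentiable {f : V → W} (hf : ContDiff ℝ ∞ f) : Differentiable ℝ f :=
  (contDiff_infty_iff_fderiv.1 hf).1

theorem fderiv_fderiv_comm {f : V → W} (hf : ContDiff ℝ ∞ f) (p h k : V) :
    fderiv ℝ (fderiv ℝ f) p h k = fderiv ℝ (fderiv ℝ f) p k h :=
  (hf.contDiffAt (x := p)).isSymmSndFDerivAt
    (by rw [minSmoothness_of_isRCLikeNormedField]; exact WithTop.coe_le_coe.2 le_top) h k

theorem fderiv_fderiv_apply {f : V → W} (hf : ContDiff ℝ ∞ f) (p h k : V) :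
    fderiv ℝ (fun p => fderiv ℝ f p k) p h = fderiv ℝ (fderiv ℝ f) p h k := by
  have := ((hf.smooth_fderiv.smooth_differentiable p).hasFDerivAt.clm_apply
    (hasFDerivAt_const k p)).fderiv
  rw [this]
  simp

end Line

/-! ### The equation in the variables `(t, x, u)`, `u_x`, `u_xx`, `u_xxx` -/

/-- The space with coordinates `(t, x, u)`. -/
abbrev Base : Type := ℝ × ℝ × ℂ

/-- The `ℝ`-linear map `M_u k = α |u|² k + β u² k̄`, for which `M_u u_x` is the nonlinearity. -/
def nonlin (α β u k : ℂ) : ℂ := α * (u * conj u) * k + β * u ^ 2 * conj k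

/-- The derivative of `nonlin α β u k` in `u` in the direction `k`. -/
def nonlinDiff (α β u k : ℂ) : ℂ :=
  α * (k * conj u + u * conj k) * k + 2 * β * u * k * conj k

/-- `X` is a flux of the density `T`. -/
def IsFlux (α β : ℂ) (T : Base × ℂ → ℝ) (X : ((Base × ℂ) × ℂ) × ℂ → ℝ) : Prop :=
  -- Here `q = (t, x, u)`, and `v, k, l, m` stand for `u_x, u_xx, u_xxx, u_xxxx`.
  ∀ (q : Base) (v k l m : ℂ),
    fderiv ℝ T (q, v) ((1, 0, -(nonlin α β q.2.2 v + l)),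
        -(nonlinDiff α β q.2.2 v + nonlin α β q.2.2 k + m)) +
      fderiv ℝ X (((q, v), k), l) ((((0, 1, v), k), l), m) = 0

theorem nonlin_smul (α β u k : ℂ) (r : ℝ) : nonlin α β u (r • k) = r • nonlin α β u k := by
  simp [nonlin]; ring

/-- The flux is determined by the density up to a function `Z` of order one, which satisfies
a system of differential equations. -/
theorem IsFlux.exists_remainder {α β : ℂ} {T : Base × ℂ → ℝ} {X : ((Base × ℂ) × ℂ) × ℂ → ℝ}
    (hT : ContDiff ℝ ∞ T) (hX : ContDiff ℝ ∞ X) (h : IsFlux α β T X) :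
    ∃ Z : Base × ℂ → ℝ, ContDiff ℝ ∞ Z ∧ ∀ (q : Base) (v k : ℂ),
      (fderiv ℝ T (q, v) ((1, 0, -nonlin α β q.2.2 v), -nonlinDiff α β q.2.2 v) +
        fderiv ℝ Z (q, v) ((0, 1, v), 0) = 0) ∧
      (fderiv ℝ Z (q, v) (0, k) = fderiv ℝ T (q, v) (0, nonlin α β q.2.2 k) -
        fderiv ℝ (fderiv ℝ T) (q, v) ((0, 1, v), 0) ((0, 0, k), 0) +
        fderiv ℝ (fderiv ℝ (fderiv ℝ T)) (q, v) ((0, 1, v), 0) ((0, 1, v), 0) (0, k)) ∧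
      (fderiv ℝ (fderiv ℝ (fderiv ℝ T)) (q, v) ((0, 1, v), 0) (0, k) (0, k) = 0) ∧
      (fderiv ℝ (fderiv ℝ (fderiv ℝ T)) (q, v) (0, k) (0, k) (0, k) = 0) := by
  have hT1 := hT.smooth_fderiv
  have hT2 := hT1.smooth_fderiv
  -- the coefficient of `u_xxxx`
  have e4 : ∀ (p : Base × ℂ) (k l m : ℂ),
      fderiv ℝ X ((p, k), l) (0, m) = fderiv ℝ T p (0, m) := by
    intro ⟨q, v⟩ k l m
    have h1 := h q v k l m
    have h0 := h q v k l 0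
    have s1 : ((((((0:ℝ), (1:ℝ), v), k), l), m) : ((Base × ℂ) × ℂ) × ℂ) =
        ((((0, 1, v), k), l), 0) + (0, m) := by simp
    have s2 : (((1, 0, -(nonlin α β q.2.2 v + l)),
        -(nonlinDiff α β q.2.2 v + nonlin α β q.2.2 k + m)) : Base × ℂ) =
        ((1, 0, -(nonlin α β q.2.2 v + l)),
        -(nonlinDiff α β q.2.2 v + nonlin α β q.2.2 k + 0)) - (0, m) := by
      simp; ring
    rw [s1, s2, map_add, map_sub] at h1
    linarith
  -- The derivative of `X` in `u_xxx` does not depend on `u_xxx`, so `X` is affine in it.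
  have eX : ∀ z : ((Base × ℂ) × ℂ) × ℂ, X z = X (z.1, 0) + fderiv ℝ T z.1.1 (0, z.2) := by
    intro ⟨⟨p, k⟩, l⟩
    have hd : ∀ r : ℝ, HasDerivAt (fun r : ℝ => X (((p, k), (0:ℂ)) + r • (0, l)))
        (fderiv ℝ T p (0, l) + 0 * r + 0 * r ^ 2) r := fun r => by
      refine (hasDerivAt_line hX.smooth_differentiable ((p, k), (0:ℂ)) (0, l) r).congr_deriv ?_
      simp [e4]
    have := eq_cubic_of_hasDerivAt hd 1
    simpa using this
  obtain ⟨Y, hY, hYdef⟩ : ∃ Y : (Base × ℂ) × ℂ → ℝ, ContDiff ℝ ∞ Y ∧ ∀ z, Y z = X (z, 0) :=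
    ⟨fun z => X (z, 0), hX.comp (by fun_prop), fun _ => rfl⟩
  have dX : ∀ (p : Base × ℂ) (k l : ℂ) (d : Base × ℂ) (k' l' : ℂ),
      fderiv ℝ X ((p, k), l) ((d, k'), l') = fderiv ℝ Y (p, k) (d, k') +
        (fderiv ℝ (fderiv ℝ T) p d (0, l) + fderiv ℝ T p (0, l')) := by
    intro p k l d k' l'
    have hXe : X = fun z => Y z.1 + fderiv ℝ T z.1.1 (0, z.2) := by
      funext z; rw [eX, hYdef]
    have h1 : HasFDerivAt (fun z : ((Base × ℂ) × ℂ) × ℂ => ((0 : Base), z.2))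
        ((ContinuousLinearMap.inr ℝ Base ℂ).comp
          (ContinuousLinearMap.snd ℝ ((Base × ℂ) × ℂ) ℂ)) ((p, k), l) :=
      ((ContinuousLinearMap.inr ℝ Base ℂ).comp
          (ContinuousLinearMap.snd ℝ ((Base × ℂ) × ℂ) ℂ)).hasFDerivAt
    have h2 : HasFDerivAt (fun z : ((Base × ℂ) × ℂ) × ℂ => z.1.1)
        ((ContinuousLinearMap.fst ℝ (Base × ℂ) ℂ).comp
          (ContinuousLinearMap.fst ℝ ((Base × ℂ) × ℂ) ℂ)) ((p, k), l) :=
      ((ContinuousLinearMap.fst ℝ (Base × ℂ) ℂ).comp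
          (ContinuousLinearMap.fst ℝ ((Base × ℂ) × ℂ) ℂ)).hasFDerivAt
    have h3 := ((hT1.smooth_differentiable p).hasFDerivAt.comp ((p, k), l) h2).clm_apply h1
    have h4 := ((hY.smooth_differentiable (p, k)).hasFDerivAt.comp ((p, k), l) hasFDerivAt_fst).add
      h3
    rw [(congrArg (fun f => fderiv ℝ f ((p, k), l)) hXe).trans h4.fderiv]
    simp
    ring
  -- the coefficient of `u_xxx`
  have e3 : ∀ (q : Base) (v k l : ℂ), fderiv ℝ Y ((q, v), k) (0, l) =
      fderiv ℝ T (q, v) ((0, 0, l), 0) -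
        fderiv ℝ (fderiv ℝ T) (q, v) ((0, 1, v), k) (0, l) := by
    intro q v k l
    have h1 := h q v k l 0
    have h0 := h q v k 0 0
    rw [dX] at h0 h1
    have s1 : (((((0:ℝ), (1:ℝ), v), k), l) : (Base × ℂ) × ℂ) =
        (((0, 1, v), k), 0) + (0, l) := by simp
    have s2 : (((1, 0, -(nonlin α β q.2.2 v + l)),
        -(nonlinDiff α β q.2.2 v + nonlin α β q.2.2 k + 0)) : Base × ℂ) =
        ((1, 0, -(nonlin α β q.2.2 v + 0)),
        -(nonlinDiff α β q.2.2 v + nonlin α β q.2.2 k + 0)) - ((0, 0, l), 0) := by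
      simp; ring
    rw [s1, s2, map_add, map_sub] at h1
    have z : ((0, 0) : Base × ℂ) = 0 := rfl
    simp only [z, map_zero] at h0 h1
    linarith
  obtain ⟨Z, hZ, hZdef⟩ : ∃ Z : Base × ℂ → ℝ, ContDiff ℝ ∞ Z ∧ ∀ z, Z z = Y (z, 0) :=
    ⟨fun z => Y (z, 0), hY.comp (by fun_prop), fun _ => rfl⟩
  -- The derivative of `Y` in `u_xx` is affine in `u_xx`; integrating it from zero gives a
  -- quadratic, and the constant of integration is `Z`.
  have eY : ∀ (q : Base) (v k : ℂ), Y ((q, v), k) = Z (q, v) + (fderiv ℝ T (q, v) ((0, 0, k), 0) -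
        fderiv ℝ (fderiv ℝ T) (q, v) ((0, 1, v), 0) (0, k) -
        1 / 2 * fderiv ℝ (fderiv ℝ T) (q, v) (0, k) (0, k)) := by
    intro q v k
    have hd : ∀ r : ℝ, HasDerivAt (fun r : ℝ => Y (((q, v), (0:ℂ)) + r • (0, k)))
        ((fderiv ℝ T (q, v) ((0, 0, k), 0) -
          fderiv ℝ (fderiv ℝ T) (q, v) ((0, 1, v), 0) (0, k)) +
          (-fderiv ℝ (fderiv ℝ T) (q, v) (0, k) (0, k)) * r + 0 * r ^ 2) r := fun r => by
      refine (hasDerivAt_line hY.smooth_differentiable ((q, v), (0:ℂ)) (0, k) r).congr_deriv ?_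
      have s : ((((0:ℝ), (1:ℝ), v), r • k) : Base × ℂ) = ((0, 1, v), 0) + r • (0, k) := by simp
      simp only [Prod.smul_mk, Prod.mk_add_mk, smul_zero, add_zero, zero_add]
      rw [e3, s, map_add, map_smul]
      simp
      ring
    have := eq_cubic_of_hasDerivAt hd 1
    simp only [Prod.mk_add_mk, add_zero, zero_add, one_smul,
      zero_smul] at this
    rw [this, hZdef]
    simp
    ring
  have dY : ∀ (q : Base) (v k : ℂ), fderiv ℝ Y ((q, v), k) (((0, 1, v), k), 0) =
      fderiv ℝ Z (q, v) ((0, 1, v), k) +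
      (fderiv ℝ (fderiv ℝ T) (q, v) ((0, 1, v), k) ((0, 0, k), 0) -
        (fderiv ℝ (fderiv ℝ (fderiv ℝ T)) (q, v) ((0, 1, v), k) ((0, 1, v), 0) (0, k) +
          fderiv ℝ (fderiv ℝ T) (q, v) ((0, 0, k), 0) (0, k)) -
        1 / 2 * fderiv ℝ (fderiv ℝ (fderiv ℝ T)) (q, v) ((0, 1, v), k) (0, k) (0, k)) := by
    intro q v k
    apply fderiv_eq_of_hasDerivAt_line hY.smooth_differentiable
    have l1 := hasDerivAt_line hZ.smooth_differentiable (q, v) ((0, 1, v), k) 0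
    have l2 := (hasDerivAt_line hT1.smooth_differentiable (q, v) ((0, 1, v), k) 0)
    have l3 := (hasDerivAt_line hT2.smooth_differentiable (q, v) ((0, 1, v), k) 0)
    have l4 : HasDerivAt (fun r : ℝ => (((0, 1, v + r • k), 0) : Base × ℂ)) ((0, 0, k), 0) 0 := by
      have : HasDerivAt (fun r : ℝ => v + r • k) k 0 := by
        simpa using ((hasDerivAt_id (0:ℝ)).smul_const k).const_add v
      exact (((hasDerivAt_const 0 0).prodMk ((hasDerivAt_const 0 1).prodMk this)).prodMk
        (hasDerivAt_const 0 0))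
    have l5 := l1.add (((l2.clm_apply (hasDerivAt_const 0 (((0, 0, k), 0) : Base × ℂ))).sub
      ((l3.clm_apply l4).clm_apply (hasDerivAt_const 0 ((0, k) : Base × ℂ)))).sub
      (((l3.clm_apply (hasDerivAt_const 0 ((0, k) : Base × ℂ))).clm_apply
        (hasDerivAt_const 0 ((0, k) : Base × ℂ))).const_mul (1 / 2)))
    convert l5 using 1
    · funext r
      simp only [Prod.smul_mk, Prod.mk_add_mk, smul_zero, add_zero, Pi.add_apply, Pi.sub_apply]
      rw [← Prod.mk_add_mk, eY]
      rfl
    · simp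
  refine ⟨Z, hZ, fun q v k => ?_⟩
  -- With `u_xxx = u_xxxx = 0` and `u_xx = r k`, the remaining identity is a cubic in `r`.
  have key := cubic_coeff_eq_zero
    (c₀ := fderiv ℝ T (q, v) ((1, 0, -nonlin α β q.2.2 v), -nonlinDiff α β q.2.2 v) +
        fderiv ℝ Z (q, v) ((0, 1, v), 0))
    (c₁ := fderiv ℝ Z (q, v) (0, k) - (fderiv ℝ T (q, v) (0, nonlin α β q.2.2 k) -
        fderiv ℝ (fderiv ℝ T) (q, v) ((0, 1, v), 0) ((0, 0, k), 0) +
        fderiv ℝ (fderiv ℝ (fderiv ℝ T)) (q, v) ((0, 1, v), 0) ((0, 1, v), 0) (0, k)))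
    (c₂ := -(3 / 2) * fderiv ℝ (fderiv ℝ (fderiv ℝ T)) (q, v) ((0, 1, v), 0) (0, k) (0, k))
    (c₃ := -(1 / 2) * fderiv ℝ (fderiv ℝ (fderiv ℝ T)) (q, v) (0, k) (0, k) (0, k)) (fun r => by
      have h1 := h q v (r • k) 0 0
      rw [dX, dY, nonlin_smul] at h1
      have s1 : ((((0:ℝ), (1:ℝ), v), r • k) : Base × ℂ) = ((0, 1, v), 0) + r • (0, k) := by simp
      have s2 : (((1, 0, -(nonlin α β q.2.2 v + 0)),
        -(nonlinDiff α β q.2.2 v + r • nonlin α β q.2.2 k + 0)) : Base × ℂ) =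
        ((1, 0, -nonlin α β q.2.2 v), -nonlinDiff α β q.2.2 v) -
          r • (0, nonlin α β q.2.2 k) := by
        simp; ring
      have s3 : ((0, r • k) : Base × ℂ) = r • (0, k) := by simp
      have s4 : (((0, 0, r • k), 0) : Base × ℂ) = r • ((0, 0, k), 0) := by simp
      have z : ((0, 0) : Base × ℂ) = 0 := rfl
      have y1 := fderiv_fderiv_comm hT (q, v) ((0, 0, k), 0) (0, k)
      have y2 := fderiv_fderiv_comm hT1 (q, v) ((0, 1, v), 0) (0, k)
      rw [s1, s2, s3, s4, z] at h1
      simp only [map_add, map_sub, map_smul, map_zero, add_apply,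
        smul_apply, smul_eq_mul, y1] at h1
      have y3 := congrArg (fun L : Base × ℂ →L[ℝ] ℝ => L (0, k)) y2
      linear_combination h1 - r ^ 2 * y3)
  obtain ⟨k0, k1, k2, k3⟩ := key
  exact ⟨k0, by linarith, by linarith, by linarith⟩

/-! ### The dependence of a density on `u_x` -/

/-- The third derivative may vary affinely along the line: `c = d = 0` serves for `T` in `u_x`,
while the linear term is needed for `C` in `u`. -/
theorem taylor_of_third_fderiv_eq {V : Type*} [NormedAddCommGroup V] [NormedSpace ℝ V]
    {f : V → ℝ} (hf : ContDiff ℝ ∞ f) (p h : V) {c d : ℝ}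
    (h3 : ∀ r : ℝ, fderiv ℝ (fderiv ℝ (fderiv ℝ f)) (p + r • h) h h h = c + d * r) :
    f (p + h) = f p + fderiv ℝ f p h + 1 / 2 * fderiv ℝ (fderiv ℝ f) p h h +
      c / 6 + d / 24 := by
  have hf1 := hf.smooth_fderiv
  have hf2 := hf1.smooth_fderiv
  have d2 : ∀ r : ℝ, fderiv ℝ (fderiv ℝ f) (p + r • h) h h =
      fderiv ℝ (fderiv ℝ f) p h h + c * r + d / 2 * r ^ 2 := by
    intro r
    have hd : ∀ r : ℝ, HasDerivAt (fun r : ℝ => fderiv ℝ (fderiv ℝ f) (p + r • h) h h)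
        (c + d * r + 0 * r ^ 2) r := fun r => by
      refine (((hasDerivAt_line hf2.smooth_differentiable p h r).clm_apply
        (hasDerivAt_const r h)).clm_apply (hasDerivAt_const r h)).congr_deriv ?_
      simp [h3]
    simpa using eq_cubic_of_hasDerivAt hd r
  have d1 : ∀ r : ℝ, fderiv ℝ f (p + r • h) h =
      fderiv ℝ f p h + fderiv ℝ (fderiv ℝ f) p h h * r + c / 2 * r ^ 2 + d / 2 / 3 * r ^ 3 := by
    intro r
    have hd : ∀ r : ℝ, HasDerivAt (fun r : ℝ => fderiv ℝ f (p + r • h) h)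
        (fderiv ℝ (fderiv ℝ f) p h h + c * r + d / 2 * r ^ 2) r := fun r => by
      refine ((hasDerivAt_line hf1.smooth_differentiable p h r).clm_apply
        (hasDerivAt_const r h)).congr_deriv ?_
      simp [d2]
    simpa using eq_cubic_of_hasDerivAt hd r
  have hd : ∀ r : ℝ, HasDerivAt (fun r : ℝ => f (p + r • h))
      (fderiv ℝ f p h + fderiv ℝ (fderiv ℝ f) p h h * r + c / 2 * r ^ 2 + d / 2 / 3 * r ^ 3) r :=
    fun r => by
    refine (hasDerivAt_line hf.smooth_differentiable p h r).congr_deriv ?_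
    simp [d1]
  have := eq_quartic_of_hasDerivAt hd 1
  simp at this
  linarith

theorem exists_quadratic_in_ux {T : Base × ℂ → ℝ} (hT : ContDiff ℝ ∞ T)
    (k2 : ∀ q v k, fderiv ℝ (fderiv ℝ (fderiv ℝ T)) (q, v) ((0, 1, v), 0) (0, k) (0, k) = 0)
    (k3 : ∀ q v k, fderiv ℝ (fderiv ℝ (fderiv ℝ T)) (q, v) (0, k) (0, k) (0, k) = 0) :
    ∃ (a₁ a₂ a₃ : ℝ → ℝ) (B₁ B₂ C : Base → ℝ), ContDiff ℝ ∞ a₁ ∧ ContDiff ℝ ∞ a₂ ∧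
      ContDiff ℝ ∞ a₃ ∧ ContDiff ℝ ∞ B₁ ∧ ContDiff ℝ ∞ B₂ ∧ ContDiff ℝ ∞ C ∧
      ∀ (q : Base) (v : ℂ), T (q, v) = a₁ q.1 * v.re ^ 2 + a₂ q.1 * (v.re * v.im) +
        a₃ q.1 * v.im ^ 2 + B₁ q * v.re + B₂ q * v.im + C q := by
  have hT1 := hT.smooth_fderiv
  have hT2 := hT1.smooth_fderiv
  have taylor : ∀ (q : Base) (v k : ℂ), T (q, v + k) = T (q, v) + fderiv ℝ T (q, v) (0, k) +
      1 / 2 * fderiv ℝ (fderiv ℝ T) (q, v) (0, k) (0, k) := by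
    intro q v k
    have := taylor_of_third_fderiv_eq hT (q, v) (0, k) (c := 0) (d := 0) (fun r => by
      have := k3 q (v + r • k) k
      simpa using this)
    simpa using this
  have hsplit : ∀ v : ℂ, ((0, v) : Base × ℂ) =
      v.re • ((0, 1) : Base × ℂ) + v.im • ((0, Complex.I) : Base × ℂ) := by
    intro v
    ext1
    · simp
    · simp [Complex.re_add_im]
  -- The sum of the expansions at `v` in the directions `k` and `-k` isolates the second derivative
  -- at `v`; the expansions at `0` give the same sum through the second derivative at `0`.
  have indep : ∀ (q : Base) (v k : ℂ), fderiv ℝ (fderiv ℝ T) (q, v) (0, k) (0, k) =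
      fderiv ℝ (fderiv ℝ T) (q, 0) (0, k) (0, k) := by
    intro q v k
    have e1 := taylor q v k
    have e2 := taylor q v (-k)
    have f0 := taylor q 0 v
    have f1 := taylor q 0 (v + k)
    have f2 := taylor q 0 (v + -k)
    have s1 : ((0, -k) : Base × ℂ) = -(0, k) := by simp
    have s2 : ((0, v + k) : Base × ℂ) = (0, v) + (0, k) := by simp
    have s3 : ((0, v + -k) : Base × ℂ) = (0, v) - (0, k) := by simp [sub_eq_add_neg]
    rw [s1] at e2
    rw [s2, zero_add] at f1
    rw [s3, zero_add] at f2
    rw [zero_add] at f0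
    simp only [map_neg, map_add, map_sub, neg_apply, add_apply, sub_apply] at e1 e2 f0 f1 f2
    linarith
  -- The second derivative `G` in `u_x` is free of `v`, so `G_x + G_u v = 0` for all `v` splits into
  -- `G_x = 0` and `G_u = 0`; only `t` is left.
  have const : ∀ (q : Base) (k : ℂ), fderiv ℝ (fderiv ℝ T) (q, 0) (0, k) (0, k) =
      fderiv ℝ (fderiv ℝ T) ((q.1, 0, 0), 0) (0, k) (0, k) := by
    intro q k
    obtain ⟨G, hG, hGdef⟩ : ∃ G : Base → ℝ, ContDiff ℝ ∞ G ∧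
        ∀ q v, G q = fderiv ℝ (fderiv ℝ T) (q, v) (0, k) (0, k) := by
      refine ⟨fun q => fderiv ℝ (fderiv ℝ T) (q, 0) (0, k) (0, k), ?_, fun q v => ?_⟩
      · exact ((hT2.comp (by fun_prop : ContDiff ℝ ∞ fun q : Base => (q, (0:ℂ)))).clm_apply
          contDiff_const).clm_apply contDiff_const
      · rw [indep q v]
    have dG : ∀ q v, fderiv ℝ G q (0, 1, v) = 0 := by
      intro q v
      apply fderiv_eq_of_hasDerivAt_line hG.smooth_differentiable
      have := ((hasDerivAt_line hT2.smooth_differentiable (q, v) ((0, 1, v), 0) 0).clm_apply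
        (hasDerivAt_const 0 ((0, k) : Base × ℂ))).clm_apply
        (hasDerivAt_const 0 ((0, k) : Base × ℂ))
      have e := k2 q v k
      convert this using 1
      · funext r
        rw [hGdef _ v]
        simp
      · simp [e]
    have dG' : ∀ (q : Base) (x : ℝ) (u : ℂ), fderiv ℝ G q (0, x, u) = 0 := by
      intro q x u
      have : ((0, x, u) : Base) = x • (0, 1, 0) + ((0, 1, u) - (0, 1, 0)) := by simp
      rw [this, map_add, map_sub, map_smul, dG, dG]
      simp
    have := eq_of_fderiv_line_eq_zero hG.smooth_differentiable (q.1, 0, 0) (0, q.2.1, q.2.2)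
      (fun r => dG' _ _ _)
    rw [← hGdef, ← hGdef, ← this]
    change G q = G (q.1 + 0, 0 + q.2.1, 0 + q.2.2)
    simp
  have smooth2 : ∀ h k : Base × ℂ,
      ContDiff ℝ ∞ fun t : ℝ => fderiv ℝ (fderiv ℝ T) ((t, 0, 0), 0) h k := fun h k =>
    ((hT2.comp (by fun_prop : ContDiff ℝ ∞ fun t : ℝ => (((t, 0, 0), 0) : Base × ℂ))).clm_apply
      contDiff_const).clm_apply contDiff_const
  have smooth1 : ∀ h : Base × ℂ, ContDiff ℝ ∞ fun q : Base => fderiv ℝ T (q, 0) h := fun h =>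
    (hT1.comp (by fun_prop : ContDiff ℝ ∞ fun q : Base => (q, (0:ℂ)))).clm_apply contDiff_const
  refine ⟨fun t => 1 / 2 * fderiv ℝ (fderiv ℝ T) ((t, 0, 0), 0) (0, 1) (0, 1),
    fun t => fderiv ℝ (fderiv ℝ T) ((t, 0, 0), 0) (0, 1) (0, Complex.I),
    fun t => 1 / 2 * fderiv ℝ (fderiv ℝ T) ((t, 0, 0), 0) (0, Complex.I) (0, Complex.I),
    fun q => fderiv ℝ T (q, 0) (0, 1), fun q => fderiv ℝ T (q, 0) (0, Complex.I),
    fun q => T (q, 0), contDiff_const.mul (smooth2 _ _), smooth2 _ _,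
    contDiff_const.mul (smooth2 _ _), smooth1 _, smooth1 _, hT.comp (by fun_prop), ?_⟩
  intro q v
  have e := taylor q 0 v
  rw [zero_add, const, hsplit v] at e
  have c := fderiv_fderiv_comm hT ((q.1, 0, 0), 0) (0, Complex.I) (0, 1)
  simp only [map_add, map_smul, add_apply, smul_apply, smul_eq_mul, c] at e
  rw [e]
  ring

/-! ### Adding a total `x`-derivative -/

/-- The total `x`-derivative of a function of `t, x, u`. -/
noncomputable def baseDx (Υ : Base → ℝ) : Base × ℂ → ℝ := fun p => fderiv ℝ Υ p.1 (0, 1, p.2)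

theorem contDiff_baseDx {Υ : Base → ℝ} (hΥ : ContDiff ℝ ∞ Υ) : ContDiff ℝ ∞ (baseDx Υ) :=
  (hΥ.smooth_fderiv.comp contDiff_fst).clm_apply
    (contDiff_const.prodMk (contDiff_const.prodMk contDiff_snd))

theorem contDiff_nonlin (α β : ℂ) {V : Type*} [NormedAddCommGroup V] [NormedSpace ℝ V]
    {f g : V → ℂ} (hf : ContDiff ℝ ∞ f) (hg : ContDiff ℝ ∞ g) :
    ContDiff ℝ ∞ fun p => nonlin α β (f p) (g p) := by
  have hc : ∀ {f : V → ℂ}, ContDiff ℝ ∞ f → ContDiff ℝ ∞ fun p => conj (f p) := fun hf =>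
    Complex.conjCLE.contDiff.comp hf
  unfold nonlin
  exact ((contDiff_const.mul (hf.mul (hc hf))).mul hg).add
    ((contDiff_const.mul (hf.pow 2)).mul (hc hg))

theorem hasDerivAt_nonlin (α β u v k : ℂ) :
    HasDerivAt (fun r : ℝ => nonlin α β (u + r • v) (v + r • k))
      (nonlinDiff α β u v + nonlin α β u k) 0 := by
  have hu : ∀ u v : ℂ, HasDerivAt (fun r : ℝ => u + r • v) v 0 := fun u v => by
    simpa using ((hasDerivAt_id (0:ℝ)).smul_const v).const_add u
  have hc : ∀ u v : ℂ, HasDerivAt (fun r : ℝ => conj (u + r • v)) (conj v) 0 := fun u v => by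
    simpa using hu (conj u) (conj v)
  refine (((((hu u v).mul (hc u v)).const_mul α).mul (hu v k)).add
    ((((hu u v).pow 2).const_mul β).mul (hc v k))).congr_deriv ?_
  simp [nonlin, nonlinDiff]
  ring

/-- The total derivatives commute on `Υ`, so the density `-D_x Υ` has flux `D_t Υ`, which is the
function `Ψ` below. -/
theorem IsFlux.add_baseDx {α β : ℂ} {T : Base × ℂ → ℝ} {X : ((Base × ℂ) × ℂ) × ℂ → ℝ}
    (hT : ContDiff ℝ ∞ T) (hX : ContDiff ℝ ∞ X) (h : IsFlux α β T X) {Υ : Base → ℝ}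
    (hΥ : ContDiff ℝ ∞ Υ) : ∃ X' : ((Base × ℂ) × ℂ) × ℂ → ℝ, ContDiff ℝ ∞ X' ∧
      IsFlux α β (fun p => T p - baseDx Υ p) X' := by
  let Ψ : ((Base × ℂ) × ℂ) × ℂ → ℝ := fun z => fderiv ℝ Υ z.1.1.1
    (1, 0, -(nonlin α β z.1.1.1.2.2 z.1.1.2 + z.2))
  have hΨ : ContDiff ℝ ∞ Ψ := by
    refine (hΥ.smooth_fderiv.comp (by fun_prop)).clm_apply
      (contDiff_const.prodMk (contDiff_const.prodMk (ContDiff.neg (ContDiff.add ?_ (by fun_prop)))))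
    exact contDiff_nonlin α β (by fun_prop) (by fun_prop)
  refine ⟨fun z => X z + Ψ z, hX.add hΨ, fun q v k l m => ?_⟩
  have d1 : fderiv ℝ (baseDx Υ) (q, v) ((1, 0, -(nonlin α β q.2.2 v + l)),
        -(nonlinDiff α β q.2.2 v + nonlin α β q.2.2 k + m)) =
      fderiv ℝ (fderiv ℝ Υ) q (1, 0, -(nonlin α β q.2.2 v + l)) (0, 1, v) +
        fderiv ℝ Υ q (0, 0, -(nonlinDiff α β q.2.2 v + nonlin α β q.2.2 k + m)) := by
    apply fderiv_eq_of_hasDerivAt_line (contDiff_baseDx hΥ).smooth_differentiable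
    have l1 := hasDerivAt_line hΥ.smooth_fderiv.smooth_differentiable q
      (1, 0, -(nonlin α β q.2.2 v + l)) 0
    have l2 : HasDerivAt (fun r : ℝ => ((0, 1, v + r •
        (-(nonlinDiff α β q.2.2 v + nonlin α β q.2.2 k + m))) : Base))
        (0, 0, -(nonlinDiff α β q.2.2 v + nonlin α β q.2.2 k + m)) 0 := by
      have : HasDerivAt (fun r : ℝ => v + r •
        (-(nonlinDiff α β q.2.2 v + nonlin α β q.2.2 k + m)))
        (-(nonlinDiff α β q.2.2 v + nonlin α β q.2.2 k + m)) 0 := by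
        simpa using ((hasDerivAt_id (0:ℝ)).smul_const
          (-(nonlinDiff α β q.2.2 v + nonlin α β q.2.2 k + m))).const_add v
      exact (hasDerivAt_const 0 0).prodMk ((hasDerivAt_const 0 1).prodMk this)
    refine (l1.clm_apply l2).congr_deriv ?_
    simp
  have d2 : fderiv ℝ Ψ (((q, v), k), l) ((((0, 1, v), k), l), m) =
      fderiv ℝ (fderiv ℝ Υ) q (0, 1, v) (1, 0, -(nonlin α β q.2.2 v + l)) +
        fderiv ℝ Υ q (0, 0, -(nonlinDiff α β q.2.2 v + nonlin α β q.2.2 k + m)) := by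
    apply fderiv_eq_of_hasDerivAt_line hΨ.smooth_differentiable
    have l1 := hasDerivAt_line hΥ.smooth_fderiv.smooth_differentiable q (0, 1, v) 0
    have l3 : HasDerivAt (fun r : ℝ => l + r • m) m 0 := by
      simpa using ((hasDerivAt_id (0:ℝ)).smul_const m).const_add l
    have l2 : HasDerivAt (fun r : ℝ => ((1, 0, -(nonlin α β (q.2.2 + r • v) (v + r • k) +
        (l + r • m))) : Base))
        (0, 0, -(nonlinDiff α β q.2.2 v + nonlin α β q.2.2 k + m)) 0 :=
      (hasDerivAt_const 0 1).prodMk ((hasDerivAt_const 0 0).prodMk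
        ((hasDerivAt_nonlin α β q.2.2 v k).add l3).neg)
    refine (l1.clm_apply l2).congr_deriv ?_
    simp
  have d3 := fderiv_fderiv_comm hΥ q (0, 1, v) (1, 0, -(nonlin α β q.2.2 v + l))
  have e := h q v k l m
  have s1 : fderiv ℝ (fun p => T p - baseDx Υ p) (q, v) =
      fderiv ℝ T (q, v) - fderiv ℝ (baseDx Υ) (q, v) :=
    fderiv_sub (hT.smooth_differentiable _) ((contDiff_baseDx hΥ).smooth_differentiable _)
  have s2 : fderiv ℝ (fun z => X z + Ψ z) (((q, v), k), l) =
      fderiv ℝ X (((q, v), k), l) + fderiv ℝ Ψ (((q, v), k), l) :=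
    fderiv_add (hX.smooth_differentiable _) (hΨ.smooth_differentiable _)
  rw [s1, s2, sub_apply, add_apply, d1, d2, d3]
  linarith

/-! ### Normalization of the density by a total `x`-derivative -/

theorem fderiv_comp_clm {V W : Type*} [NormedAddCommGroup V] [NormedSpace ℝ V]
    [NormedAddCommGroup W] [NormedSpace ℝ W] {F : W → ℝ} (hF : Differentiable ℝ F)
    (L : V →L[ℝ] W) (p h : V) : fderiv ℝ (fun p => F (L p)) p h = fderiv ℝ F (L p) (L h) := by
  have : HasFDerivAt (fun p => F (L p)) _ p := (hF (L p)).hasFDerivAt.comp p L.hasFDerivAt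
  rw [this.fderiv]
  rfl

theorem fderiv_eq_zero_of_forall_prod {P : Type*} [NormedAddCommGroup P] [NormedSpace ℝ P]
    {F : P × ℝ → ℝ} (hF : Differentiable ℝ F) (h0 : ∀ p, F (p, 0) = 0) (p d : P) :
    fderiv ℝ F (p, 0) (d, 0) = 0 := by
  apply fderiv_eq_of_hasDerivAt_line hF
  simpa [h0] using hasDerivAt_const (0:ℝ) (0:ℝ)

/-- `Υ` is a sum of three primitives: in `Re u` from the imaginary axis, along that axis from `u =
0`, and in `x` at `u = 0`. Each vanishes where its integration starts, so its tangential derivatives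
there do not disturb the later conditions. `B₂` and `C` can be matched only on these subspaces
because `Υ` is already fixed up to them. -/
theorem exists_gauge {B₁ B₂ C : Base → ℝ} (h₁ : ContDiff ℝ ∞ B₁) (h₂ : ContDiff ℝ ∞ B₂)
    (hC : ContDiff ℝ ∞ C) : ∃ Υ : Base → ℝ, ContDiff ℝ ∞ Υ ∧
      (∀ q, fderiv ℝ Υ q (0, 0, 1) = B₁ q) ∧
      (∀ t x y : ℝ, fderiv ℝ Υ (t, x, y * Complex.I) (0, 0, Complex.I) =
        B₂ (t, x, y * Complex.I)) ∧
      ∀ t x : ℝ, fderiv ℝ Υ (t, x, 0) (0, 1, 0) = C (t, x, 0) := by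
  have hr : ContDiff ℝ ∞ fun r : ℝ => (r : ℂ) := Complex.ofRealCLM.contDiff
  obtain ⟨F₁, s₁, z₁, d₁⟩ := exists_smooth_primitive
    (f := fun z : (ℝ × ℝ × ℝ) × ℝ => B₁ (z.1.1, z.1.2.1, (z.2 : ℂ) + z.1.2.2 * Complex.I))
    (h₁.comp (contDiff_fst.fst.prodMk (contDiff_fst.snd.fst.prodMk
      ((hr.comp contDiff_snd).add ((hr.comp contDiff_fst.snd.snd).mul contDiff_const)))))
  obtain ⟨F₂, s₂, z₂, d₂⟩ := exists_smooth_primitive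
    (f := fun z : (ℝ × ℝ) × ℝ => B₂ (z.1.1, z.1.2, z.2 * Complex.I))
    (h₂.comp (contDiff_fst.fst.prodMk (contDiff_fst.snd.prodMk
      ((hr.comp contDiff_snd).mul contDiff_const))))
  obtain ⟨F₃, s₃, z₃, d₃⟩ := exists_smooth_primitive
    (f := fun z : ℝ × ℝ => C (z.1, z.2, 0)) (hC.comp (by fun_prop))
  let t' : Base →L[ℝ] ℝ := ContinuousLinearMap.fst ℝ ℝ (ℝ × ℂ)
  let x' : Base →L[ℝ] ℝ :=
    (ContinuousLinearMap.fst ℝ ℝ ℂ).comp (ContinuousLinearMap.snd ℝ ℝ (ℝ × ℂ))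
  let u' : Base →L[ℝ] ℂ :=
    (ContinuousLinearMap.snd ℝ ℝ ℂ).comp (ContinuousLinearMap.snd ℝ ℝ (ℝ × ℂ))
  let L₁ : Base →L[ℝ] (ℝ × ℝ × ℝ) × ℝ :=
    (t'.prod (x'.prod (Complex.imCLM.comp u'))).prod (Complex.reCLM.comp u')
  let L₂ : Base →L[ℝ] (ℝ × ℝ) × ℝ := (t'.prod x').prod (Complex.imCLM.comp u')
  let L₃ : Base →L[ℝ] ℝ × ℝ := t'.prod x'
  have c₁ : ContDiff ℝ ∞ fun q => F₁ (L₁ q) := s₁.comp L₁.contDiff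
  have c₂ : ContDiff ℝ ∞ fun q => F₂ (L₂ q) := s₂.comp L₂.contDiff
  have c₃ : ContDiff ℝ ∞ fun q => F₃ (L₃ q) := s₃.comp L₃.contDiff
  have hd : ∀ q h, fderiv ℝ (fun q => F₁ (L₁ q) + F₂ (L₂ q) + F₃ (L₃ q)) q h =
      fderiv ℝ F₁ (L₁ q) (L₁ h) + fderiv ℝ F₂ (L₂ q) (L₂ h) + fderiv ℝ F₃ (L₃ q) (L₃ h) := by
    intro q h
    rw [← fderiv_comp_clm s₁.smooth_differentiable, ← fderiv_comp_clm s₂.smooth_differentiable,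
      ← fderiv_comp_clm s₃.smooth_differentiable]
    have := (((c₁.smooth_differentiable q).hasFDerivAt.add
      (c₂.smooth_differentiable q).hasFDerivAt).add (c₃.smooth_differentiable q).hasFDerivAt).fderiv
    exact congrArg (fun A : Base →L[ℝ] ℝ => A h) this
  have zz₁ := fderiv_eq_zero_of_forall_prod s₁.smooth_differentiable z₁
  have zz₂ := fderiv_eq_zero_of_forall_prod s₂.smooth_differentiable z₂
  refine ⟨fun q => F₁ (L₁ q) + F₂ (L₂ q) + F₃ (L₃ q), (c₁.add c₂).add c₃,
    fun q => ?_, fun t x y => ?_, fun t x => ?_⟩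
  · rw [hd]
    have e1 : L₁ (0, 0, 1) = (0, 1) := by simp [L₁, t', x', u']
    have e2 : L₂ (0, 0, 1) = 0 := by simp [L₂, t', x', u']
    have e3 : L₃ (0, 0, 1) = 0 := by simp [L₃, t', x']
    rw [e1, e2, e3, d₁]
    simp [L₁, t', x', u', Complex.re_add_im]
  · rw [hd]
    have e1 : L₁ (0, 0, Complex.I) = ((0, 0, 1), 0) := by simp [L₁, t', x', u']
    have e2 : L₂ (0, 0, Complex.I) = (0, 1) := by simp [L₂, t', x', u']
    have e3 : L₃ (0, 0, Complex.I) = 0 := by simp [L₃, t', x']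
    have e4 : L₁ (t, x, y * Complex.I) = ((t, x, y), 0) := by simp [L₁, t', x', u']
    rw [e1, e2, e3, e4, zz₁, d₂]
    simp [L₂, t', x', u']
  · rw [hd]
    have e1 : L₁ (0, 1, 0) = ((0, 1, 0), 0) := by simp [L₁, t', x', u']
    have e2 : L₂ (0, 1, 0) = ((0, 1), 0) := by simp [L₂, t', x', u']
    have e3 : L₃ (0, 1, 0) = (0, 1) := by simp [L₃, t', x']
    have e4 : L₁ (t, x, 0) = ((t, x, 0), 0) := by simp [L₁, t', x', u']
    have e5 : L₂ (t, x, 0) = ((t, x), 0) := by simp [L₂, t', x', u']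
    rw [e1, e2, e3, e4, e5, zz₁, zz₂, d₃]
    simp [L₃, t', x']

/-- The densities that are quadratic in `u_x`, with coefficients of the quadratic part that
depend only on `t`, and without a term linear in the real part of `u_x`. -/
def quadDensity (a₁ a₂ a₃ : ℝ → ℝ) (B C : Base → ℝ) : Base × ℂ → ℝ := fun p =>
  a₁ p.1.1 * p.2.re ^ 2 + a₂ p.1.1 * (p.2.re * p.2.im) + a₃ p.1.1 * p.2.im ^ 2 +
    B p.1 * p.2.im + C p.1

theorem base_split (v : ℂ) : ((0, 1, v) : Base) =
    (0, 1, 0) + v.re • (0, 0, 1) + v.im • (0, 0, Complex.I) := by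
  simp [Complex.re_add_im]

theorem base_split_u (v : ℂ) : ((0, 0, v) : Base) =
    v.re • (0, 0, 1) + v.im • (0, 0, Complex.I) := by
  simp [Complex.re_add_im]

theorem IsFlux.exists_normal_form {α β : ℂ} {T : Base × ℂ → ℝ} {X : ((Base × ℂ) × ℂ) × ℂ → ℝ}
    (hT : ContDiff ℝ ∞ T) (hX : ContDiff ℝ ∞ X) (h : IsFlux α β T X) :
    ∃ (Υ : Base → ℝ) (a₁ a₂ a₃ : ℝ → ℝ) (B C : Base → ℝ) (X' : ((Base × ℂ) × ℂ) × ℂ → ℝ),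
      ContDiff ℝ ∞ Υ ∧ ContDiff ℝ ∞ a₁ ∧ ContDiff ℝ ∞ a₂ ∧ ContDiff ℝ ∞ a₃ ∧ ContDiff ℝ ∞ B ∧
      ContDiff ℝ ∞ C ∧ ContDiff ℝ ∞ X' ∧ (∀ p, T p - baseDx Υ p = quadDensity a₁ a₂ a₃ B C p) ∧
      IsFlux α β (quadDensity a₁ a₂ a₃ B C) X' ∧ (∀ t x y : ℝ, B (t, x, y * Complex.I) = 0) ∧
      ∀ t x : ℝ, C (t, x, 0) = 0 := by
  obtain ⟨Z, -, hZ⟩ := h.exists_remainder hT hX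
  obtain ⟨a₁, a₂, a₃, B₁, B₂, C, h₁, h₂, h₃, hB₁, hB₂, hC, e⟩ := exists_quadratic_in_ux hT
    (fun q v k => (hZ q v k).2.2.1) (fun q v k => (hZ q v k).2.2.2)
  obtain ⟨Υ, hΥ, g₁, g₂, g₃⟩ := exists_gauge hB₁ hB₂ hC
  obtain ⟨X', hX', hf⟩ := h.add_baseDx hT hX hΥ
  have e' : (fun p => T p - baseDx Υ p) = quadDensity a₁ a₂ a₃
      (fun q => B₂ q - fderiv ℝ Υ q (0, 0, Complex.I))
      (fun q => C q - fderiv ℝ Υ q (0, 1, 0)) := by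
    funext ⟨q, v⟩
    rw [e, baseDx, quadDensity]
    simp only [base_split v, map_add, map_smul, g₁, smul_eq_mul]
    ring
  refine ⟨Υ, a₁, a₂, a₃, _, _, X', hΥ, h₁, h₂, h₃,
    hB₂.sub (hΥ.smooth_fderiv.clm_apply contDiff_const),
    hC.sub (hΥ.smooth_fderiv.clm_apply contDiff_const), hX', fun p => congrFun e' p, e' ▸ hf,
    fun t x y => ?_, fun t x => ?_⟩
  · simp [g₂]
  · simp [g₃]

section QuadDensity

variable {a₁ a₂ a₃ : ℝ → ℝ} {B C : Base → ℝ}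

theorem contDiff_quadDensity (h₁ : ContDiff ℝ ∞ a₁) (h₂ : ContDiff ℝ ∞ a₂)
    (h₃ : ContDiff ℝ ∞ a₃) (hB : ContDiff ℝ ∞ B) (hC : ContDiff ℝ ∞ C) :
    ContDiff ℝ ∞ (quadDensity a₁ a₂ a₃ B C) := by
  have ht : ContDiff ℝ ∞ fun p : Base × ℂ => p.1.1 := by fun_prop
  have hre : ContDiff ℝ ∞ fun p : Base × ℂ => p.2.re := Complex.reCLM.contDiff.comp contDiff_snd
  have him : ContDiff ℝ ∞ fun p : Base × ℂ => p.2.im := Complex.imCLM.contDiff.comp contDiff_snd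
  exact ((((((h₁.comp ht).mul (hre.pow 2)).add ((h₂.comp ht).mul (hre.mul him))).add
    ((h₃.comp ht).mul (him.pow 2))).add ((hB.comp contDiff_fst).mul him)).add
    (hC.comp contDiff_fst))

variable (h₁ : ContDiff ℝ ∞ a₁) (h₂ : ContDiff ℝ ∞ a₂)
    (h₃ : ContDiff ℝ ∞ a₃) (hB : ContDiff ℝ ∞ B) (hC : ContDiff ℝ ∞ C)
include h₁ h₂ h₃ hB hC

theorem fderiv_quadDensity (q d : Base) (v w : ℂ) :
    fderiv ℝ (quadDensity a₁ a₂ a₃ B C) (q, v) (d, w) =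
      d.1 * (deriv a₁ q.1 * v.re ^ 2 + deriv a₂ q.1 * (v.re * v.im) + deriv a₃ q.1 * v.im ^ 2) +
      fderiv ℝ B q d * v.im + fderiv ℝ C q d + (2 * a₁ q.1 * v.re * w.re +
      a₂ q.1 * (v.re * w.im + v.im * w.re) + 2 * a₃ q.1 * v.im * w.im + B q * w.im) := by
  apply fderiv_eq_of_hasDerivAt_line
    (contDiff_quadDensity h₁ h₂ h₃ hB hC).smooth_differentiable
  have la : ∀ {a : ℝ → ℝ}, ContDiff ℝ ∞ a →
      HasDerivAt (fun r : ℝ => a (q.1 + r * d.1)) (deriv a q.1 * d.1) 0 := by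
    intro a ha
    have h1 : HasDerivAt (fun r : ℝ => q.1 + r * d.1) d.1 0 := by
      simpa using ((hasDerivAt_id (0:ℝ)).mul_const d.1).const_add q.1
    have h2 : HasDerivAt a (deriv a q.1) (q.1 + 0 * d.1) := by
      simpa using (ha.smooth_differentiable q.1).hasDerivAt
    exact h2.comp (0:ℝ) h1
  have lre : HasDerivAt (fun r : ℝ => v.re + r * w.re) w.re 0 := by
    simpa using ((hasDerivAt_id (0:ℝ)).mul_const w.re).const_add v.re
  have lim : HasDerivAt (fun r : ℝ => v.im + r * w.im) w.im 0 := by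
    simpa using ((hasDerivAt_id (0:ℝ)).mul_const w.im).const_add v.im
  have lB := hasDerivAt_line hB.smooth_differentiable q d 0
  have lC := hasDerivAt_line hC.smooth_differentiable q d 0
  have := ((((((la h₁).mul (lre.pow 2)).add ((la h₂).mul (lre.mul lim))).add
    ((la h₃).mul (lim.pow 2))).add (lB.mul lim)).add lC)
  refine (this.congr_deriv ?_).congr_of_eventuallyEq (Filter.Eventually.of_forall fun r => ?_)
  · simp
    ring
  · simp [quadDensity]

theorem IsFlux.exists_remainder_quadDensity {α β : ℂ} {X : ((Base × ℂ) × ℂ) × ℂ → ℝ}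
    (hX : ContDiff ℝ ∞ X) (h : IsFlux α β (quadDensity a₁ a₂ a₃ B C) X) :
    ∃ Z : Base × ℂ → ℝ, ContDiff ℝ ∞ Z ∧ ∀ (q : Base) (v : ℂ),
      (deriv a₁ q.1 * v.re ^ 2 + deriv a₂ q.1 * (v.re * v.im) + deriv a₃ q.1 * v.im ^ 2 +
        fderiv ℝ B q (1, 0, -nonlin α β q.2.2 v) * v.im +
        fderiv ℝ C q (1, 0, -nonlin α β q.2.2 v) -
        (2 * a₁ q.1 * v.re * (nonlinDiff α β q.2.2 v).re +
          a₂ q.1 * (v.re * (nonlinDiff α β q.2.2 v).im + v.im * (nonlinDiff α β q.2.2 v).re) +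
          2 * a₃ q.1 * v.im * (nonlinDiff α β q.2.2 v).im + B q * (nonlinDiff α β q.2.2 v).im) +
        fderiv ℝ Z (q, v) ((0, 1, v), 0) = 0) ∧
      ∀ k : ℂ, fderiv ℝ Z (q, v) (0, k) =
        2 * a₁ q.1 * v.re * (nonlin α β q.2.2 k).re +
          a₂ q.1 * (v.re * (nonlin α β q.2.2 k).im + v.im * (nonlin α β q.2.2 k).re) +
          2 * a₃ q.1 * v.im * (nonlin α β q.2.2 k).im + B q * (nonlin α β q.2.2 k).im -
        (fderiv ℝ (fderiv ℝ B) q (0, 1, v) (0, 0, k) * v.im +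
          fderiv ℝ (fderiv ℝ C) q (0, 1, v) (0, 0, k)) +
        fderiv ℝ (fderiv ℝ B) q (0, 1, v) (0, 1, v) * k.im := by
  have hT := contDiff_quadDensity h₁ h₂ h₃ hB hC
  have hd := fderiv_quadDensity h₁ h₂ h₃ hB hC
  obtain ⟨Z, hZ, e⟩ := h.exists_remainder hT hX
  refine ⟨Z, hZ, fun q v => ⟨?_, fun k => ?_⟩⟩
  · have e0 := (e q v 0).1
    rw [hd] at e0
    simp only [Complex.neg_re, Complex.neg_im] at e0
    linarith
  · have e1 := (e q v k).2.1
    have s2 : ∀ (d : Base × ℂ) (v : ℂ),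
        fderiv ℝ (fderiv ℝ (quadDensity a₁ a₂ a₃ B C)) (q, v) (d.1, 0) ((0, 0, k), 0) =
        fderiv ℝ (fderiv ℝ B) q d.1 (0, 0, k) * v.im + fderiv ℝ (fderiv ℝ C) q d.1 (0, 0, k) := by
      intro d v
      rw [← fderiv_fderiv_apply hT]
      apply fderiv_eq_of_hasDerivAt_line
        (hT.smooth_fderiv.clm_apply contDiff_const).smooth_differentiable
      have lB := (hasDerivAt_line hB.smooth_fderiv.smooth_differentiable q d.1 0).clm_apply
        (hasDerivAt_const 0 ((0, 0, k) : Base))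
      have lC := (hasDerivAt_line hC.smooth_fderiv.smooth_differentiable q d.1 0).clm_apply
        (hasDerivAt_const 0 ((0, 0, k) : Base))
      refine (((lB.mul_const v.im).add lC).congr_deriv ?_).congr_of_eventuallyEq
        (Filter.Eventually.of_forall fun r => ?_)
      · simp
      · simp [hd]
    have s3 : ∀ (q : Base) (d : Base) (v : ℂ), d.1 = 0 →
        fderiv ℝ (fderiv ℝ (quadDensity a₁ a₂ a₃ B C)) (q, v) (d, 0) (0, k) =
        fderiv ℝ B q d * k.im := by
      intro q d v hd0
      rw [← fderiv_fderiv_apply hT]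
      apply fderiv_eq_of_hasDerivAt_line
        (hT.smooth_fderiv.clm_apply contDiff_const).smooth_differentiable
      have lB := (hasDerivAt_line hB.smooth_differentiable q d 0)
      refine (((lB.mul_const k.im).const_add (2 * a₁ q.1 * v.re * k.re +
        a₂ q.1 * (v.re * k.im + v.im * k.re) + 2 * a₃ q.1 * v.im * k.im)).congr_deriv
        ?_).congr_of_eventuallyEq (Filter.Eventually.of_forall fun r => ?_)
      · simp
      · simp [hd, hd0]
    have s4 : ∀ (d : Base), d.1 = 0 → fderiv ℝ (fderiv ℝ (fderiv ℝ
        (quadDensity a₁ a₂ a₃ B C))) (q, v) (d, 0) (d, 0) (0, k) =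
        fderiv ℝ (fderiv ℝ B) q d d * k.im := by
      intro d hd0
      have l1 := ((hasDerivAt_line hT.smooth_fderiv.smooth_fderiv.smooth_differentiable
        (q, v) (d, 0) 0).clm_apply (hasDerivAt_const 0 ((d, 0) : Base × ℂ))).clm_apply
        (hasDerivAt_const 0 ((0, k) : Base × ℂ))
      have l2 := ((hasDerivAt_line hB.smooth_fderiv.smooth_differentiable q d 0).clm_apply
        (hasDerivAt_const 0 d)).mul_const k.im
      have := l1.unique (l2.congr_of_eventuallyEq (Filter.Eventually.of_forall fun r => ?_))
      · simpa using this
      · simp [s3 _ d _ hd0]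
    have s2' := s2 ((0, 1, v), 0) v
    dsimp only at s2'
    rw [s2', s4 _ rfl, hd] at e1
    have z : ((0, 0, 0) : Base) = 0 := rfl
    rw [e1]
    simp

end QuadDensity

/-! ### The linear and constant parts of a normalized density -/

/-- Equality of mixed partial derivatives. -/
theorem mixed_fderiv_eq {V : Type*} [NormedAddCommGroup V] [NormedSpace ℝ V] {f : V → ℝ}
    (hf : ContDiff ℝ ∞ f) (p h k : V) {P R : ℝ → ℝ} {c d : ℝ}
    (hP : ∀ r : ℝ, fderiv ℝ f (p + r • k) h = P r) (hR : ∀ r : ℝ, fderiv ℝ f (p + r • h) k = R r)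
    (hc : HasDerivAt P c 0) (hd : HasDerivAt R d 0) : c = d := by
  have l : ∀ h k : V, HasDerivAt (fun r : ℝ => fderiv ℝ f (p + r • k) h)
      (fderiv ℝ (fderiv ℝ f) p k h) 0 := fun h k => by
    simpa using (hasDerivAt_line hf.smooth_fderiv.smooth_differentiable p k 0).clm_apply
      (hasDerivAt_const 0 h)
  rw [← funext hP] at hc
  rw [← funext hR] at hd
  rw [hc.unique (l h k), hd.unique (l k h)]
  exact fderiv_fderiv_comm hf p k h

theorem hasDerivAt_quadratic (c₀ c₁ c₂ : ℝ) :
    HasDerivAt (fun r : ℝ => c₀ + c₁ * r + c₂ * r ^ 2) c₁ 0 := by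
  have := (((hasDerivAt_id (0:ℝ)).const_mul c₁).const_add c₀).add
    (((hasDerivAt_id (0:ℝ)).pow 2).const_mul c₂)
  refine this.congr_deriv ?_
  simp

theorem nonlin_zero (α β k : ℂ) : nonlin α β 0 k = 0 := by simp [nonlin]

/-- The equation for the derivative of `Z` in `u_x` is integrable only if `Z_{v₁v₂} = Z_{v₂v₁}`.
This is the identity `key`, whose left side does not depend on `v`. -/
theorem linear_part_of_isFlux {a₁ a₂ a₃ : ℝ → ℝ} {B C : Base → ℝ} (h₁ : ContDiff ℝ ∞ a₁)
    (h₂ : ContDiff ℝ ∞ a₂) (h₃ : ContDiff ℝ ∞ a₃) (hB : ContDiff ℝ ∞ B) (hC : ContDiff ℝ ∞ C)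
    {α β : ℂ} {X : ((Base × ℂ) × ℂ) × ℂ → ℝ}
    (hX : ContDiff ℝ ∞ X) (h : IsFlux α β (quadDensity a₁ a₂ a₃ B C) X)
    (hB0 : ∀ t x y : ℝ, B (t, x, y * Complex.I) = 0) :
    ∃ b : ℝ → ℝ, ContDiff ℝ ∞ b ∧ (∀ q, B q = b q.1 * q.2.2.re) ∧ ∀ (t : ℝ) (u : ℂ),
      a₂ t * (nonlin α β u 1).re + 2 * a₃ t * (nonlin α β u 1).im -
        2 * a₁ t * (nonlin α β u Complex.I).re - a₂ t * (nonlin α β u Complex.I).im = 0 := by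
  obtain ⟨Z, hZ, e⟩ := h.exists_remainder_quadDensity h₁ h₂ h₃ hB hC hX
  have key : ∀ (q : Base) (v : ℂ),
      a₂ q.1 * (nonlin α β q.2.2 1).re + 2 * a₃ q.1 * (nonlin α β q.2.2 1).im -
        2 * a₁ q.1 * (nonlin α β q.2.2 Complex.I).re -
        a₂ q.1 * (nonlin α β q.2.2 Complex.I).im =
      3 * (fderiv ℝ (fderiv ℝ B) q (0, 1, 0) (0, 0, 1) +
        v.re * fderiv ℝ (fderiv ℝ B) q (0, 0, 1) (0, 0, 1) +
        v.im * fderiv ℝ (fderiv ℝ B) q (0, 0, 1) (0, 0, Complex.I)) := by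
    intro q v
    have c1 := fderiv_fderiv_comm hB q (0, 0, 1) (0, 0, Complex.I)
    have c2 := fderiv_fderiv_comm hB q (0, 1, 0) (0, 0, 1)
    have c3 := fderiv_fderiv_comm hB q (0, 1, 0) (0, 0, Complex.I)
    have c4 := fderiv_fderiv_comm hC q (0, 0, 1) (0, 0, Complex.I)
    set B11 := fderiv ℝ (fderiv ℝ B) q (0, 0, 1) (0, 0, 1) with hB11
    set B12 := fderiv ℝ (fderiv ℝ B) q (0, 0, 1) (0, 0, Complex.I) with hB12
    set B22 := fderiv ℝ (fderiv ℝ B) q (0, 0, Complex.I) (0, 0, Complex.I) with hB22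
    set Bx1 := fderiv ℝ (fderiv ℝ B) q (0, 1, 0) (0, 0, 1) with hBx1
    set Bx2 := fderiv ℝ (fderiv ℝ B) q (0, 1, 0) (0, 0, Complex.I) with hBx2
    set Bxx := fderiv ℝ (fderiv ℝ B) q (0, 1, 0) (0, 1, 0) with hBxx
    set C11 := fderiv ℝ (fderiv ℝ C) q (0, 0, 1) (0, 0, 1) with hC11
    set C12 := fderiv ℝ (fderiv ℝ C) q (0, 0, 1) (0, 0, Complex.I) with hC12
    set C22 := fderiv ℝ (fderiv ℝ C) q (0, 0, Complex.I) (0, 0, Complex.I) with hC22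
    set Cx1 := fderiv ℝ (fderiv ℝ C) q (0, 1, 0) (0, 0, 1) with hCx1
    set Cx2 := fderiv ℝ (fderiv ℝ C) q (0, 1, 0) (0, 0, Complex.I) with hCx2
    have z1 : ∀ v : ℂ, fderiv ℝ Z (q, v) (0, 1) =
        2 * a₁ q.1 * v.re * (nonlin α β q.2.2 1).re +
          a₂ q.1 * (v.re * (nonlin α β q.2.2 1).im + v.im * (nonlin α β q.2.2 1).re) +
          2 * a₃ q.1 * v.im * (nonlin α β q.2.2 1).im + B q * (nonlin α β q.2.2 1).im -
        ((Bx1 + v.re * B11 + v.im * B12) * v.im + Cx1 + v.re * C11 + v.im * C12) := by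
      intro v
      rw [(e q v).2 1, base_split v]
      simp only [map_add, map_smul, add_apply, smul_apply, smul_eq_mul, Complex.one_im]
      rw [← c1, ← c4]
      ring
    have z2 : ∀ v : ℂ, fderiv ℝ Z (q, v) (0, Complex.I) =
        2 * a₁ q.1 * v.re * (nonlin α β q.2.2 Complex.I).re +
          a₂ q.1 * (v.re * (nonlin α β q.2.2 Complex.I).im +
            v.im * (nonlin α β q.2.2 Complex.I).re) +
          2 * a₃ q.1 * v.im * (nonlin α β q.2.2 Complex.I).im +
          B q * (nonlin α β q.2.2 Complex.I).im -
        ((Bx2 + v.re * B12 + v.im * B22) * v.im + Cx2 + v.re * C12 + v.im * C22) +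
        (Bxx + 2 * v.re * Bx1 + 2 * v.im * Bx2 + v.re ^ 2 * B11 + 2 * v.re * v.im * B12 +
          v.im ^ 2 * B22) := by
      intro v
      rw [(e q v).2 Complex.I, base_split v]
      simp only [map_add, map_smul, add_apply, smul_apply, smul_eq_mul, Complex.I_im]
      rw [← c1, ← c2, ← c3]
      ring
    have m := mixed_fderiv_eq hZ (q, v) (0, 1) (0, Complex.I)
      (fun r => by
        have := z1 (v + r • Complex.I)
        simp at this
        simp [this]
        rfl)
      (fun r => by
        have := z2 (v + r • 1)
        simp at this
        simp [this]
        rfl)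
      ((hasDerivAt_quadratic (2 * a₁ q.1 * v.re * (nonlin α β q.2.2 1).re +
          a₂ q.1 * (v.re * (nonlin α β q.2.2 1).im + v.im * (nonlin α β q.2.2 1).re) +
          2 * a₃ q.1 * v.im * (nonlin α β q.2.2 1).im + B q * (nonlin α β q.2.2 1).im -
        ((Bx1 + v.re * B11 + v.im * B12) * v.im + Cx1 + v.re * C11 + v.im * C12))
        (a₂ q.1 * (nonlin α β q.2.2 1).re + 2 * a₃ q.1 * (nonlin α β q.2.2 1).im -
        (Bx1 + v.re * B11 + 2 * v.im * B12 + C12)) (-B12)).congr_of_eventuallyEq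
          (Filter.Eventually.of_forall fun r => by ring))
      ((hasDerivAt_quadratic (2 * a₁ q.1 * v.re * (nonlin α β q.2.2 Complex.I).re +
          a₂ q.1 * (v.re * (nonlin α β q.2.2 Complex.I).im +
            v.im * (nonlin α β q.2.2 Complex.I).re) +
          2 * a₃ q.1 * v.im * (nonlin α β q.2.2 Complex.I).im +
          B q * (nonlin α β q.2.2 Complex.I).im -
        ((Bx2 + v.re * B12 + v.im * B22) * v.im + Cx2 + v.re * C12 + v.im * C22) +
        (Bxx + 2 * v.re * Bx1 + 2 * v.im * Bx2 + v.re ^ 2 * B11 + 2 * v.re * v.im * B12 +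
          v.im ^ 2 * B22))
        (2 * a₁ q.1 * (nonlin α β q.2.2 Complex.I).re +
        a₂ q.1 * (nonlin α β q.2.2 Complex.I).im - (v.im * B12 + C12) +
        (2 * Bx1 + 2 * v.re * B11 + 2 * v.im * B12)) B11).congr_of_eventuallyEq
          (Filter.Eventually.of_forall fun r => by ring))
    linarith
  obtain ⟨G, hG, hGdef⟩ : ∃ G : Base → ℝ, ContDiff ℝ ∞ G ∧ ∀ q, G q = fderiv ℝ B q (0, 0, 1) :=
    ⟨fun q => fderiv ℝ B q (0, 0, 1), hB.smooth_fderiv.clm_apply contDiff_const, fun _ => rfl⟩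
  have dG : ∀ q d, fderiv ℝ G q d = fderiv ℝ (fderiv ℝ B) q d (0, 0, 1) := by
    intro q d
    rw [← fderiv_fderiv_apply hB]
    exact congrArg (fun f => fderiv ℝ f q d) (funext hGdef)
  -- Comparing `v = 1` (and then `v = i`) with `v = 0` extracts the coefficients of `v` on the right
  -- of `key`.
  have hB11 : ∀ q, fderiv ℝ (fderiv ℝ B) q (0, 0, 1) (0, 0, 1) = 0 := by
    intro q
    have e1 := key q 1
    have e0 := key q 0
    simp at e1 e0
    linarith
  have hB12 : ∀ q, fderiv ℝ (fderiv ℝ B) q (0, 0, 1) (0, 0, Complex.I) = 0 := by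
    intro q
    have e1 := key q Complex.I
    have e0 := key q 0
    simp at e1 e0
    linarith
  have Gu : ∀ q (u : ℂ), fderiv ℝ G q (0, 0, u) = 0 := by
    intro q u
    rw [base_split_u, map_add, map_smul, map_smul, dG, dG, hB11,
      fderiv_fderiv_comm hB q (0, 0, Complex.I), hB12]
    simp
  -- At `u = 0` the nonlinearity vanishes, and `key` says that `G = B_{u₁}` is constant in `x`; it
  -- is already known not to depend on `u`.
  have Gx : ∀ t x (s : ℝ), fderiv ℝ G (t, x, 0) (0, s, 0) = 0 := by
    intro t x s
    have := key (t, x, 0) 0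
    have s : ((0, s, 0) : Base) = s • (0, 1, 0) := by simp
    rw [s, map_smul, dG]
    simp [nonlin_zero] at this
    simp [this]
  have hGt : ∀ q, G q = G (q.1, 0, 0) := by
    intro ⟨t, x, u⟩
    have e1 := eq_of_fderiv_line_eq_zero hG.smooth_differentiable (t, x, 0) (0, 0, u)
      (fun r => Gu _ _)
    have e2 := eq_of_fderiv_line_eq_zero hG.smooth_differentiable (t, 0, 0) (0, x, 0)
      (fun r => by simpa using Gx t (r * x) x)
    simp at e1 e2
    rw [e1, e2]
  refine ⟨fun t => G (t, 0, 0), hG.comp (by fun_prop), fun ⟨t, x, u⟩ => ?_, fun t u => ?_⟩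
  · have hd : ∀ r : ℝ, HasDerivAt
        (fun r : ℝ => B (((t, x, u.im * Complex.I) : Base) + r • (0, 0, (u.re : ℂ))))
        (G (t, 0, 0) * u.re + 0 * r + 0 * r ^ 2) r := fun r => by
      refine (hasDerivAt_line hB.smooth_differentiable _ _ r).congr_deriv ?_
      have s : ((0, 0, (u.re : ℂ)) : Base) = u.re • (0, 0, 1) := by simp
      rw [s, map_smul, ← hGdef, hGt]
      simp
      ring
    have := eq_cubic_of_hasDerivAt hd 1
    simp [hB0] at this
    rw [← this, add_comm, Complex.re_add_im]
  · have hx : fderiv ℝ G (t, 0, u) (0, 1, 0) = 0 := by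
      apply fderiv_eq_of_hasDerivAt_line hG.smooth_differentiable
      refine (hasDerivAt_const 0 (G (t, 0, 0))).congr_of_eventuallyEq
        (Filter.Eventually.of_forall fun r => ?_)
      dsimp only
      rw [hGt]
      simp
    have := key (t, 0, u) 0
    rw [← dG, hx] at this
    simpa using this

theorem nonlinDiff_smul (α β u v : ℂ) (r : ℝ) :
    nonlinDiff α β u (r • v) = r ^ 2 • nonlinDiff α β u v := by
  simp [nonlinDiff]; ring

/-- The mixed derivative of a function of `t, x, u` in `x` and in `u` in the direction `v`. -/
noncomputable def mixedDx (C : Base → ℝ) (v : ℂ) : Base → ℝ :=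
  fun q => fderiv ℝ (fderiv ℝ C) q (0, 1, 0) (0, 0, v)

theorem contDiff_mixedDx {C : Base → ℝ} (hC : ContDiff ℝ ∞ C) (v : ℂ) :
    ContDiff ℝ ∞ (mixedDx C v) :=
  (hC.smooth_fderiv.smooth_fderiv.clm_apply contDiff_const).clm_apply contDiff_const

theorem mixedDx_smul (C : Base → ℝ) (v : ℂ) (r : ℝ) (q : Base) :
    mixedDx C (r • v) q = r * mixedDx C v q := by
  have s : ((0, 0, r • v) : Base) = r • (0, 0, v) := by simp
  rw [mixedDx, s, map_smul]
  rfl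

/-- The system of differential equations satisfied by the part of a normalized density that does
not depend on `u_x`. -/
theorem constant_part_of_isFlux {a₁ a₂ a₃ b : ℝ → ℝ} {C : Base → ℝ} (h₁ : ContDiff ℝ ∞ a₁)
    (h₂ : ContDiff ℝ ∞ a₂) (h₃ : ContDiff ℝ ∞ a₃) (hb : ContDiff ℝ ∞ b) (hC : ContDiff ℝ ∞ C)
    {α β : ℂ} {X : ((Base × ℂ) × ℂ) × ℂ → ℝ} (hX : ContDiff ℝ ∞ X)
    (h : IsFlux α β (quadDensity a₁ a₂ a₃ (fun q => b q.1 * q.2.2.re) C) X)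
    (hsymm : ∀ (t : ℝ) (u : ℂ), a₂ t * (nonlin α β u 1).re + 2 * a₃ t * (nonlin α β u 1).im -
        2 * a₁ t * (nonlin α β u Complex.I).re - a₂ t * (nonlin α β u Complex.I).im = 0) :
    ∃ K : Base → ℝ, ContDiff ℝ ∞ K ∧ ∀ (q : Base) (v : ℂ),
      (fderiv ℝ K q (0, 1, 0) = -fderiv ℝ C q (1, 0, 0)) ∧
      (fderiv ℝ K q (0, 0, v) = fderiv ℝ C q (0, 0, nonlin α β q.2.2 v) +
        fderiv ℝ (mixedDx C v) q (0, 1, 0) - deriv b q.1 * q.2.2.re * v.im) ∧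
      (3 / 2 * fderiv ℝ (mixedDx C v) q (0, 0, v) =
        deriv a₁ q.1 * v.re ^ 2 + deriv a₂ q.1 * (v.re * v.im) + deriv a₃ q.1 * v.im ^ 2 -
        b q.1 * ((nonlin α β q.2.2 v).re * v.im - (nonlin α β q.2.2 v).im * v.re)) ∧
      (fderiv ℝ (fderiv ℝ (fderiv ℝ C)) q (0, 0, v) (0, 0, v) (0, 0, v) =
        -(2 * a₁ q.1 * v.re * (nonlinDiff α β q.2.2 v).re +
          a₂ q.1 * (v.re * (nonlinDiff α β q.2.2 v).im + v.im * (nonlinDiff α β q.2.2 v).re) +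
          2 * a₃ q.1 * v.im * (nonlinDiff α β q.2.2 v).im)) := by
  have hC1 := hC.smooth_fderiv
  have hC2 := hC1.smooth_fderiv
  have hB : ContDiff ℝ ∞ fun q : Base => b q.1 * q.2.2.re :=
    (hb.comp contDiff_fst).mul (Complex.reCLM.contDiff.comp contDiff_snd.snd)
  have dB : ∀ q d : Base, fderiv ℝ (fun q : Base => b q.1 * q.2.2.re) q d =
      deriv b q.1 * d.1 * q.2.2.re + b q.1 * d.2.2.re := by
    intro q d
    apply fderiv_eq_of_hasDerivAt_line hB.smooth_differentiable
    have h1 : HasDerivAt (fun r : ℝ => q.1 + r * d.1) d.1 0 := by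
      simpa using ((hasDerivAt_id (0:ℝ)).mul_const d.1).const_add q.1
    have h2 : HasDerivAt b (deriv b q.1) (q.1 + 0 * d.1) := by
      simpa using (hb.smooth_differentiable q.1).hasDerivAt
    have h3 : HasDerivAt (fun r : ℝ => q.2.2.re + r * d.2.2.re) d.2.2.re 0 := by
      simpa using ((hasDerivAt_id (0:ℝ)).mul_const d.2.2.re).const_add q.2.2.re
    refine (((h2.comp (0:ℝ) h1).mul h3).congr_deriv ?_).congr_of_eventuallyEq
      (Filter.Eventually.of_forall fun r => ?_)
    · simp
    · simp
  have dB2 : ∀ (q d e : Base), d.1 = 0 → e.1 = 0 →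
      fderiv ℝ (fderiv ℝ (fun q : Base => b q.1 * q.2.2.re)) q d e = 0 := by
    intro q d e hd he
    rw [← fderiv_fderiv_apply hB]
    apply fderiv_eq_of_hasDerivAt_line
      (hB.smooth_fderiv.clm_apply contDiff_const).smooth_differentiable
    refine (hasDerivAt_const 0 (b q.1 * e.2.2.re)).congr_of_eventuallyEq
      (Filter.Eventually.of_forall fun r => ?_)
    simp [dB, hd, he]
  obtain ⟨Z, hZ, e⟩ := h.exists_remainder_quadDensity h₁ h₂ h₃ hB hC hX
  obtain ⟨K, hK, hKdef⟩ : ∃ K : Base → ℝ, ContDiff ℝ ∞ K ∧ ∀ q, K q = Z (q, 0) :=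
    ⟨fun q => Z (q, 0), hZ.comp (by fun_prop), fun _ => rfl⟩
  -- With `A` the polar form of the quadratic part, `hsymm` says that `(v, w) ↦ A(v, M_u w)` is
  -- symmetric. A real bilinear form on `ℂ` has only the pair `1, i` to check.
  have symm : ∀ (t : ℝ) (u v w : ℂ),
      2 * a₁ t * v.re * (nonlin α β u w).re +
        a₂ t * (v.re * (nonlin α β u w).im + v.im * (nonlin α β u w).re) +
        2 * a₃ t * v.im * (nonlin α β u w).im =
      2 * a₁ t * w.re * (nonlin α β u v).re +
        a₂ t * (w.re * (nonlin α β u v).im + w.im * (nonlin α β u v).re) +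
        2 * a₃ t * w.im * (nonlin α β u v).im := by
    intro t u v w
    have split : ∀ v, nonlin α β u v = v.re • nonlin α β u 1 + v.im • nonlin α β u Complex.I := by
      intro v
      apply Complex.ext <;> simp [nonlin, pow_two] <;> ring
    rw [split v, split w]
    simp only [Complex.add_re, Complex.add_im, Complex.real_smul, Complex.re_ofReal_mul,
      Complex.im_ofReal_mul]
    linear_combination (v.im * w.re - v.re * w.im) * hsymm t u
  -- By this symmetry the derivative of `Z` along `v` is affine on the line through `v`, and it is
  -- integrated from `v = 0`.
  have eZ : ∀ (q : Base) (v : ℂ), Z (q, v) = K q +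
      (1 / 2 * (2 * a₁ q.1 * v.re * (nonlin α β q.2.2 v).re +
        a₂ q.1 * (v.re * (nonlin α β q.2.2 v).im + v.im * (nonlin α β q.2.2 v).re) +
        2 * a₃ q.1 * v.im * (nonlin α β q.2.2 v).im) +
        b q.1 * q.2.2.re * (nonlin α β q.2.2 v).im -
        fderiv ℝ (fderiv ℝ C) q (0, 1, 0) (0, 0, v) -
        1 / 2 * fderiv ℝ (fderiv ℝ C) q (0, 0, v) (0, 0, v)) := by
    intro q v
    have hd : ∀ r : ℝ, HasDerivAt (fun r : ℝ => Z ((q, (0:ℂ)) + r • (0, v)))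
        ((b q.1 * q.2.2.re * (nonlin α β q.2.2 v).im -
            fderiv ℝ (fderiv ℝ C) q (0, 1, 0) (0, 0, v)) +
          ((2 * a₁ q.1 * v.re * (nonlin α β q.2.2 v).re +
            a₂ q.1 * (v.re * (nonlin α β q.2.2 v).im + v.im * (nonlin α β q.2.2 v).re) +
            2 * a₃ q.1 * v.im * (nonlin α β q.2.2 v).im) -
            fderiv ℝ (fderiv ℝ C) q (0, 0, v) (0, 0, v)) * r + 0 * r ^ 2) r := fun r => by
      refine (hasDerivAt_line hZ.smooth_differentiable _ _ r).congr_deriv ?_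
      have := (e q (r • v)).2 v
      have s : ((0, 1, r • v) : Base) = (0, 1, 0) + r • (0, 0, v) := by simp
      rw [dB2 _ _ _ rfl rfl, dB2 _ _ _ rfl rfl, s] at this
      simp only [map_add, map_smul, add_apply, smul_apply, smul_eq_mul, Complex.real_smul,
        Complex.re_ofReal_mul, Complex.im_ofReal_mul] at this
      simp only [Prod.smul_mk, Prod.mk_add_mk, smul_zero, add_zero, zero_add, Complex.real_smul]
      rw [this]
      ring
    have := eq_cubic_of_hasDerivAt hd 1
    simp only [Prod.mk_add_mk, add_zero, zero_add, one_smul, zero_smul, ← hKdef] at this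
    rw [this]
    ring
  have dZ : ∀ (q : Base) (v : ℂ), fderiv ℝ Z (q, v) ((0, 1, v), 0) = fderiv ℝ K q (0, 1, v) +
      (1 / 2 * (2 * a₁ q.1 * v.re * (nonlinDiff α β q.2.2 v).re +
        a₂ q.1 * (v.re * (nonlinDiff α β q.2.2 v).im + v.im * (nonlinDiff α β q.2.2 v).re) +
        2 * a₃ q.1 * v.im * (nonlinDiff α β q.2.2 v).im) +
        b q.1 * (v.re * (nonlin α β q.2.2 v).im + q.2.2.re * (nonlinDiff α β q.2.2 v).im) -
        fderiv ℝ (mixedDx C v) q (0, 1, v) -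
        1 / 2 * fderiv ℝ (fderiv ℝ (fderiv ℝ C)) q (0, 1, v) (0, 0, v) (0, 0, v)) := by
    intro q v
    apply fderiv_eq_of_hasDerivAt_line hZ.smooth_differentiable
    have lK := hasDerivAt_line hK.smooth_differentiable q (0, 1, v) 0
    have lx := hasDerivAt_line (contDiff_mixedDx hC v).smooth_differentiable q (0, 1, v) 0
    have lC := ((hasDerivAt_line hC2.smooth_differentiable q (0, 1, v) 0).clm_apply
      (hasDerivAt_const 0 ((0, 0, v) : Base))).clm_apply (hasDerivAt_const 0 ((0, 0, v) : Base))
    have ln : HasDerivAt (fun r : ℝ => nonlin α β (q.2.2 + r • v) v)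
      (nonlinDiff α β q.2.2 v) 0 := by
      simpa [nonlin_smul, nonlin] using hasDerivAt_nonlin α β q.2.2 v 0
    have lre := Complex.reCLM.hasFDerivAt.comp_hasDerivAt (0:ℝ) ln
    have lim := Complex.imCLM.hasFDerivAt.comp_hasDerivAt (0:ℝ) ln
    have lu : HasDerivAt (fun r : ℝ => q.2.2.re + r * v.re) v.re 0 := by
      simpa using ((hasDerivAt_id (0:ℝ)).mul_const v.re).const_add q.2.2.re
    have := lK.add (((((((lre.const_mul (2 * a₁ q.1 * v.re)).add
      (((lim.const_mul v.re).add (lre.const_mul v.im)).const_mul (a₂ q.1))).add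
      (lim.const_mul (2 * a₃ q.1 * v.im))).const_mul (1 / 2)).add
      ((lu.const_mul (b q.1)).mul lim)).sub lx).sub (lC.const_mul (1 / 2)))
    refine (this.congr_deriv ?_).congr_of_eventuallyEq (Filter.Eventually.of_forall fun r => ?_)
    · simp
      ring
    · simp [eZ, mixedDx]
  refine ⟨K, hK, fun q v => ?_⟩
  have swap : fderiv ℝ (fderiv ℝ (fderiv ℝ C)) q (0, 1, 0) (0, 0, v) (0, 0, v) =
      fderiv ℝ (mixedDx C v) q (0, 0, v) := by
    rw [fderiv_fderiv_comm hC1 q (0, 1, 0) (0, 0, v)]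
    symm
    apply fderiv_eq_of_hasDerivAt_line (contDiff_mixedDx hC v).smooth_differentiable
    have := ((hasDerivAt_line hC2.smooth_differentiable q (0, 0, v) 0).clm_apply
      (hasDerivAt_const 0 ((0, 1, 0) : Base))).clm_apply (hasDerivAt_const 0 ((0, 0, v) : Base))
    simpa [mixedDx] using this
  -- Replacing `v` by `r v` in the remaining equation of order one makes it a cubic in `r`; `swap`
  -- lets its two contributions from `C_{xuu}` be combined.
  have key := cubic_coeff_eq_zero
    (c₀ := fderiv ℝ K q (0, 1, 0) + fderiv ℝ C q (1, 0, 0))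
    (c₁ := fderiv ℝ K q (0, 0, v) - (fderiv ℝ C q (0, 0, nonlin α β q.2.2 v) +
        fderiv ℝ (mixedDx C v) q (0, 1, 0) - deriv b q.1 * q.2.2.re * v.im))
    (c₂ := deriv a₁ q.1 * v.re ^ 2 + deriv a₂ q.1 * (v.re * v.im) + deriv a₃ q.1 * v.im ^ 2 -
        b q.1 * ((nonlin α β q.2.2 v).re * v.im - (nonlin α β q.2.2 v).im * v.re) -
        3 / 2 * fderiv ℝ (mixedDx C v) q (0, 0, v))
    (c₃ := -(1 / 2) * (2 * a₁ q.1 * v.re * (nonlinDiff α β q.2.2 v).re +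
          a₂ q.1 * (v.re * (nonlinDiff α β q.2.2 v).im + v.im * (nonlinDiff α β q.2.2 v).re) +
          2 * a₃ q.1 * v.im * (nonlinDiff α β q.2.2 v).im) -
        1 / 2 * fderiv ℝ (fderiv ℝ (fderiv ℝ C)) q (0, 0, v) (0, 0, v) (0, 0, v)) (fun r => by
      have h1 := (e q (r • v)).1
      have s1 : ((0, 1, r • v) : Base) = (0, 1, 0) + r • (0, 0, v) := by simp
      have s2 : ((1, 0, -(r • nonlin α β q.2.2 v)) : Base) =
        (1, 0, 0) - r • (0, 0, nonlin α β q.2.2 v) := by simp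
      have s3 : ((0, 0, r • v) : Base) = r • (0, 0, v) := by simp
      have s4 : fderiv ℝ (mixedDx C (r • v)) q = r • fderiv ℝ (mixedDx C v) q := by
        rw [funext (mixedDx_smul C v r)]
        exact fderiv_const_mul ((contDiff_mixedDx hC v).smooth_differentiable q) r
      rw [dZ, dB, nonlin_smul, nonlinDiff_smul, s4, s1, s2, s3] at h1
      simp only [map_add, map_sub, map_smul, add_apply, smul_apply, smul_eq_mul,
        Complex.real_smul, Complex.re_ofReal_mul, Complex.im_ofReal_mul, swap] at h1
      simp only [Prod.fst_sub, Prod.snd_sub, Prod.smul_mk, Complex.sub_re, Complex.zero_re,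
        Complex.real_smul] at h1
      simp only [Complex.re_ofReal_mul] at h1
      linear_combination h1)
  obtain ⟨k0, k1, k2, k3⟩ := key
  exact ⟨by linarith, by linarith, by linarith, by linarith⟩

/-! ### The quadratic part of a normalized density -/

/-- The polar form of `a₁ v₁² + a₂ v₁ v₂ + a₃ v₂²` at `v` and `nonlinDiff α β u v`. -/
noncomputable def quarticForm (α β : ℂ) (a₁ a₂ a₃ : ℝ) (u v : ℂ) : ℝ :=
  2 * a₁ * v.re * (nonlinDiff α β u v).re +
    a₂ * (v.re * (nonlinDiff α β u v).im + v.im * (nonlinDiff α β u v).re) +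
    2 * a₃ * v.im * (nonlinDiff α β u v).im

theorem quarticForm_add_smul (α β : ℂ) (a₁ a₂ a₃ : ℝ) (u w v : ℂ) (r : ℝ) :
    quarticForm α β a₁ a₂ a₃ (u + r • w) v =
      quarticForm α β a₁ a₂ a₃ u v + quarticForm α β a₁ a₂ a₃ w v * r := by
  have : nonlinDiff α β (u + r • w) v = nonlinDiff α β u v + r • nonlinDiff α β w v := by
    simp [nonlinDiff]; ring
  rw [quarticForm, this]
  simp only [quarticForm, Complex.add_re, Complex.add_im, Complex.real_smul,
    Complex.re_ofReal_mul, Complex.im_ofReal_mul]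
  ring

theorem quarticForm_zero (α β : ℂ) (a₁ a₂ a₃ : ℝ) (v : ℂ) :
    quarticForm α β a₁ a₂ a₃ 0 v = 0 := by
  simp [quarticForm, nonlinDiff]

section

variable {α β : ℂ} {a₁ a₂ a₃ : ℝ → ℝ} {C : Base → ℝ}

/-- The prescribed third derivative is linear in the base point `u`, so Taylor's formula stops at
order four. -/
theorem taylor_of_quarticForm (hC : ContDiff ℝ ∞ C)
    (h3 : ∀ (q : Base) (v : ℂ), fderiv ℝ (fderiv ℝ (fderiv ℝ C)) q (0, 0, v) (0, 0, v) (0, 0, v) =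
      -quarticForm α β (a₁ q.1) (a₂ q.1) (a₃ q.1) q.2.2 v) (t x : ℝ) (u v : ℂ) :
    C (t, x, u + v) = C (t, x, u) + fderiv ℝ C (t, x, u) (0, 0, v) +
      1 / 2 * fderiv ℝ (fderiv ℝ C) (t, x, u) (0, 0, v) (0, 0, v) -
      quarticForm α β (a₁ t) (a₂ t) (a₃ t) u v / 6 -
      quarticForm α β (a₁ t) (a₂ t) (a₃ t) v v / 24 := by
  have := taylor_of_third_fderiv_eq hC (t, x, u) (0, 0, v)
    (c := -quarticForm α β (a₁ t) (a₂ t) (a₃ t) u v)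
    (d := -quarticForm α β (a₁ t) (a₂ t) (a₃ t) v v) (fun r => by
      rw [h3]
      simp only [Prod.smul_mk, Prod.mk_add_mk, smul_zero, add_zero]
      rw [quarticForm_add_smul]
      ring)
  simp only [Prod.mk_add_mk, add_zero] at this
  linarith

theorem exists_polynomial_of_quarticForm (hC : ContDiff ℝ ∞ C) (hC0 : ∀ t x : ℝ, C (t, x, 0) = 0)
    (h3 : ∀ (q : Base) (v : ℂ), fderiv ℝ (fderiv ℝ (fderiv ℝ C)) q (0, 0, v) (0, 0, v) (0, 0, v) =
      -quarticForm α β (a₁ q.1) (a₂ q.1) (a₃ q.1) q.2.2 v) :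
    ∃ l₁ l₂ Q₁ Q₂ Q₃ : ℝ × ℝ → ℝ, ContDiff ℝ ∞ l₁ ∧ ContDiff ℝ ∞ l₂ ∧ ContDiff ℝ ∞ Q₁ ∧
      ContDiff ℝ ∞ Q₂ ∧ ContDiff ℝ ∞ Q₃ ∧ ∀ (t x : ℝ) (u : ℂ), C (t, x, u) =
        l₁ (t, x) * u.re + l₂ (t, x) * u.im + Q₁ (t, x) * u.re ^ 2 + Q₂ (t, x) * (u.re * u.im) +
          Q₃ (t, x) * u.im ^ 2 - quarticForm α β (a₁ t) (a₂ t) (a₃ t) u u / 24 := by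
  have hC1 := hC.smooth_fderiv
  have hC2 := hC1.smooth_fderiv
  have c : ContDiff ℝ ∞ fun z : ℝ × ℝ => ((z.1, z.2, 0) : Base) := by fun_prop
  have s1 : ∀ h : Base, ContDiff ℝ ∞ fun z : ℝ × ℝ => fderiv ℝ C (z.1, z.2, 0) h := fun h =>
    (hC1.comp c).clm_apply contDiff_const
  have s2 : ∀ h k : Base, ContDiff ℝ ∞ fun z : ℝ × ℝ =>
      fderiv ℝ (fderiv ℝ C) (z.1, z.2, 0) h k := fun h k =>
    ((hC2.comp c).clm_apply contDiff_const).clm_apply contDiff_const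
  refine ⟨_, _, _, _, _, s1 (0, 0, 1), s1 (0, 0, Complex.I),
    contDiff_const.mul (s2 (0, 0, 1) (0, 0, 1)) (f := fun _ => 1 / 2), s2 (0, 0, 1)
      (0, 0, Complex.I),
    contDiff_const.mul (s2 (0, 0, Complex.I) (0, 0, Complex.I)) (f := fun _ => 1 / 2),
    fun t x u => ?_⟩
  have := taylor_of_quarticForm hC h3 t x 0 u
  have y := fderiv_fderiv_comm hC (t, x, 0) (0, 0, Complex.I) (0, 0, 1)
  rw [zero_add, hC0, quarticForm_zero, base_split_u] at this
  simp only [map_add, map_smul, add_apply, smul_apply, smul_eq_mul, y] at this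
  rw [this]
  ring

/-- The third difference with nodes `-1, 0, 1, 2` annihilates quadratic polynomials. It is evaluated
once on the explicit quartic and once by the expansion at `u`; equality is the integrability
condition that the prescribed third derivative come from an actual function. -/
theorem quarticForm_third_difference (hC : ContDiff ℝ ∞ C) (hC0 : ∀ t x : ℝ, C (t, x, 0) = 0)
    (h3 : ∀ (q : Base) (v : ℂ), fderiv ℝ (fderiv ℝ (fderiv ℝ C)) q (0, 0, v) (0, 0, v) (0, 0, v) =
      -quarticForm α β (a₁ q.1) (a₂ q.1) (a₃ q.1) q.2.2 v) (t : ℝ) (u v : ℂ) :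
    quarticForm α β (a₁ t) (a₂ t) (a₃ t) (u + (2:ℝ) • v) (u + (2:ℝ) • v) -
      3 * quarticForm α β (a₁ t) (a₂ t) (a₃ t) (u + v) (u + v) +
      3 * quarticForm α β (a₁ t) (a₂ t) (a₃ t) u u -
      quarticForm α β (a₁ t) (a₂ t) (a₃ t) (u - v) (u - v) =
    4 * (quarticForm α β (a₁ t) (a₂ t) (a₃ t) u ((2:ℝ) • v) -
      3 * quarticForm α β (a₁ t) (a₂ t) (a₃ t) u v -
      quarticForm α β (a₁ t) (a₂ t) (a₃ t) u (-v)) +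
    (quarticForm α β (a₁ t) (a₂ t) (a₃ t) ((2:ℝ) • v) ((2:ℝ) • v) -
      3 * quarticForm α β (a₁ t) (a₂ t) (a₃ t) v v -
      quarticForm α β (a₁ t) (a₂ t) (a₃ t) (-v) (-v)) := by
  obtain ⟨l₁, l₂, Q₁, Q₂, Q₃, -, -, -, -, -, e⟩ := exists_polynomial_of_quarticForm hC hC0 h3
  have t1 := taylor_of_quarticForm hC h3 t 0 u v
  have t2 := taylor_of_quarticForm hC h3 t 0 u ((2:ℝ) • v)
  have t3 := taylor_of_quarticForm hC h3 t 0 u (-v)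
  have s2 : ((0, 0, (2:ℝ) • v) : Base) = (2:ℝ) • (0, 0, v) := by simp
  have s3 : ((0, 0, -v) : Base) = -(0, 0, v) := by simp
  rw [s2] at t2
  rw [s3, ← sub_eq_add_neg] at t3
  simp only [e, map_neg, map_smul, neg_apply, smul_apply, smul_eq_mul] at t1 t2 t3
  simp only [Complex.add_re, Complex.add_im, Complex.sub_re, Complex.sub_im, Complex.smul_re,
    Complex.smul_im, smul_eq_mul] at t1 t2 t3
  linear_combination (-24) * t2 + 72 * t1 + 24 * t3

end

/-- This is the only way in which `(α, β) ≠ (0, 0)` enters the classification. -/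
theorem eq_zero_of_mul_coeffs {α β γ : ℂ} (h : ¬(α = 0 ∧ β = 0)) (hα : γ * α = 0)
    (hβ : γ * β = 0) : γ = 0 := by
  by_contra hγ
  exact h ⟨(mul_eq_zero.1 hα).resolve_left hγ, (mul_eq_zero.1 hβ).resolve_left hγ⟩

/-- The quadratic part of a normalized density is a multiple of `|u_x|²`, and vanishes unless the
coefficients of the equation are real. -/
theorem quadratic_part_algebra {α β : ℂ} {a₁ a₂ a₃ : ℝ} (h : ¬(α = 0 ∧ β = 0))
    (hsymm : ∀ u : ℂ, a₂ * (nonlin α β u 1).re + 2 * a₃ * (nonlin α β u 1).im -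
        2 * a₁ * (nonlin α β u Complex.I).re - a₂ * (nonlin α β u Complex.I).im = 0)
    (hdiff : ∀ u v : ℂ, quarticForm α β a₁ a₂ a₃ (u + (2:ℝ) • v) (u + (2:ℝ) • v) -
      3 * quarticForm α β a₁ a₂ a₃ (u + v) (u + v) +
      3 * quarticForm α β a₁ a₂ a₃ u u - quarticForm α β a₁ a₂ a₃ (u - v) (u - v) =
    4 * (quarticForm α β a₁ a₂ a₃ u ((2:ℝ) • v) -
      3 * quarticForm α β a₁ a₂ a₃ u v - quarticForm α β a₁ a₂ a₃ u (-v)) +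
    (quarticForm α β a₁ a₂ a₃ ((2:ℝ) • v) ((2:ℝ) • v) -
      3 * quarticForm α β a₁ a₂ a₃ v v - quarticForm α β a₁ a₂ a₃ (-v) (-v))) :
    a₂ = 0 ∧ a₃ = a₁ ∧ a₁ * α.im = 0 ∧ a₁ * β.im = 0 := by
  have s1 := hsymm 1
  have s2 := hsymm Complex.I
  have s3 := hsymm (1 + Complex.I)
  have d1 := hdiff Complex.I 1
  have d2 := hdiff (-1) Complex.I
  have d3 := hdiff (-1 + Complex.I) (1 + Complex.I)
  simp [nonlin, pow_two] at s1 s2 s3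
  simp [quarticForm, nonlinDiff] at d1 d2 d3
  ring_nf at s1 s2 s3 d1 d2 d3
  -- The quadratic form is `(a₁ + a₃)/2 · |v|² + Re(γ v²)/2`, with `γ` this complex number. The
  -- sampled identities contain `γ α = 0` and `γ β = 0`.
  have γ : (⟨a₁ - a₃, -a₂⟩ : ℂ) = 0 := by
    apply eq_zero_of_mul_coeffs h <;> apply Complex.ext <;> simp <;> linarith
  have γ1 := congrArg Complex.re γ
  have γ2 := congrArg Complex.im γ
  simp at γ1 γ2
  obtain rfl : a₃ = a₁ := by linarith
  subst γ2
  refine ⟨rfl, rfl, ?_, ?_⟩ <;> linarith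

/-! ### Polynomial densities of order zero -/

/-- A polynomial in `u, ū` with coefficients that are functions of `t, x`. -/
def polyDensity (l₀ l₁ l₂ Q₁ Q₂ Q₃ : ℝ × ℝ → ℝ) (p : ℝ → ℝ) : Base → ℝ := fun q =>
  l₀ (q.1, q.2.1) + l₁ (q.1, q.2.1) * q.2.2.re + l₂ (q.1, q.2.1) * q.2.2.im +
    Q₁ (q.1, q.2.1) * q.2.2.re ^ 2 + Q₂ (q.1, q.2.1) * (q.2.2.re * q.2.2.im) +
    Q₃ (q.1, q.2.1) * q.2.2.im ^ 2 + p q.1 * (q.2.2.re ^ 2 + q.2.2.im ^ 2) ^ 2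

section PolyDensity

variable {l₀ l₁ l₂ Q₁ Q₂ Q₃ : ℝ × ℝ → ℝ} {p : ℝ → ℝ}

theorem contDiff_polyDensity (h₀ : ContDiff ℝ ∞ l₀) (h₁ : ContDiff ℝ ∞ l₁)
    (h₂ : ContDiff ℝ ∞ l₂) (H₁ : ContDiff ℝ ∞ Q₁) (H₂ : ContDiff ℝ ∞ Q₂) (H₃ : ContDiff ℝ ∞ Q₃)
    (hp : ContDiff ℝ ∞ p) : ContDiff ℝ ∞ (polyDensity l₀ l₁ l₂ Q₁ Q₂ Q₃ p) := by
  have c : ContDiff ℝ ∞ fun q : Base => (q.1, q.2.1) := by fun_prop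
  have hre : ContDiff ℝ ∞ fun q : Base => q.2.2.re := Complex.reCLM.contDiff.comp contDiff_snd.snd
  have him : ContDiff ℝ ∞ fun q : Base => q.2.2.im := Complex.imCLM.contDiff.comp contDiff_snd.snd
  exact (((((((h₀.comp c)).add ((h₁.comp c).mul hre)).add ((h₂.comp c).mul him)).add
    ((H₁.comp c).mul (hre.pow 2))).add ((H₂.comp c).mul (hre.mul him))).add
    ((H₃.comp c).mul (him.pow 2))).add
    ((hp.comp contDiff_fst).mul (((hre.pow 2).add (him.pow 2)).pow 2))

theorem fderiv_polyDensity (h₀ : ContDiff ℝ ∞ l₀) (h₁ : ContDiff ℝ ∞ l₁)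
    (h₂ : ContDiff ℝ ∞ l₂) (H₁ : ContDiff ℝ ∞ Q₁) (H₂ : ContDiff ℝ ∞ Q₂) (H₃ : ContDiff ℝ ∞ Q₃)
    (hp : ContDiff ℝ ∞ p) (t x τ ξ : ℝ) (u k : ℂ) :
    fderiv ℝ (polyDensity l₀ l₁ l₂ Q₁ Q₂ Q₃ p) (t, x, u) (τ, ξ, k) =
      polyDensity (fun z => fderiv ℝ l₀ z (τ, ξ)) (fun z => fderiv ℝ l₁ z (τ, ξ))
        (fun z => fderiv ℝ l₂ z (τ, ξ)) (fun z => fderiv ℝ Q₁ z (τ, ξ))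
        (fun z => fderiv ℝ Q₂ z (τ, ξ)) (fun z => fderiv ℝ Q₃ z (τ, ξ))
        (fun t => τ * deriv p t) (t, x, u) +
      (l₁ (t, x) * k.re + l₂ (t, x) * k.im + 2 * Q₁ (t, x) * (u.re * k.re) +
        Q₂ (t, x) * (u.re * k.im + u.im * k.re) + 2 * Q₃ (t, x) * (u.im * k.im) +
        4 * p t * (u.re ^ 2 + u.im ^ 2) * (u.re * k.re + u.im * k.im)) := by
  apply fderiv_eq_of_hasDerivAt_line
    (contDiff_polyDensity h₀ h₁ h₂ H₁ H₂ H₃ hp).smooth_differentiable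
  have la : ∀ {l : ℝ × ℝ → ℝ}, ContDiff ℝ ∞ l → HasDerivAt
      (fun r : ℝ => l (t + r * τ, x + r * ξ)) (fderiv ℝ l (t, x) (τ, ξ)) 0 := by
    intro l hl
    simpa using hasDerivAt_line hl.smooth_differentiable (t, x) (τ, ξ) 0
  have lp : HasDerivAt (fun r : ℝ => p (t + r * τ)) (deriv p t * τ) 0 := by
    have h1 : HasDerivAt (fun r : ℝ => t + r * τ) τ 0 := by
      simpa using ((hasDerivAt_id (0:ℝ)).mul_const τ).const_add t
    have h2 : HasDerivAt p (deriv p t) (t + 0 * τ) := by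
      simpa using (hp.smooth_differentiable t).hasDerivAt
    exact h2.comp (0:ℝ) h1
  have lre : HasDerivAt (fun r : ℝ => u.re + r * k.re) k.re 0 := by
    simpa using ((hasDerivAt_id (0:ℝ)).mul_const k.re).const_add u.re
  have lim : HasDerivAt (fun r : ℝ => u.im + r * k.im) k.im 0 := by
    simpa using ((hasDerivAt_id (0:ℝ)).mul_const k.im).const_add u.im
  have := ((((((la h₀).add ((la h₁).mul lre)).add ((la h₂).mul lim)).add
    ((la H₁).mul (lre.pow 2))).add ((la H₂).mul (lre.mul lim))).add
    ((la H₃).mul (lim.pow 2))).add (lp.mul (((lre.pow 2).add (lim.pow 2)).pow 2))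
  refine (this.congr_deriv ?_).congr_of_eventuallyEq (Filter.Eventually.of_forall fun r => ?_)
  · simp [polyDensity]
    ring
  · simp [polyDensity]

theorem smooth_fderiv_apply {V : Type*} [NormedAddCommGroup V] [NormedSpace ℝ V] {f : V → ℝ}
    (hf : ContDiff ℝ ∞ f) (h : V) : ContDiff ℝ ∞ fun z => fderiv ℝ f z h :=
  hf.smooth_fderiv.clm_apply contDiff_const

theorem fderiv_fderiv_polyDensity (h₀ : ContDiff ℝ ∞ l₀) (h₁ : ContDiff ℝ ∞ l₁)
    (h₂ : ContDiff ℝ ∞ l₂) (H₁ : ContDiff ℝ ∞ Q₁) (H₂ : ContDiff ℝ ∞ Q₂) (H₃ : ContDiff ℝ ∞ Q₃)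
    (hp : ContDiff ℝ ∞ p) (t x τ ξ : ℝ) (u k : ℂ) :
    fderiv ℝ (fderiv ℝ (polyDensity l₀ l₁ l₂ Q₁ Q₂ Q₃ p)) (t, x, u) (τ, ξ, 0) (0, 0, k) =
      fderiv ℝ l₁ (t, x) (τ, ξ) * k.re + fderiv ℝ l₂ (t, x) (τ, ξ) * k.im +
        2 * fderiv ℝ Q₁ (t, x) (τ, ξ) * (u.re * k.re) +
        fderiv ℝ Q₂ (t, x) (τ, ξ) * (u.re * k.im + u.im * k.re) +
        2 * fderiv ℝ Q₃ (t, x) (τ, ξ) * (u.im * k.im) +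
        4 * (τ * deriv p t) * (u.re ^ 2 + u.im ^ 2) * (u.re * k.re + u.im * k.im) := by
  have hC := contDiff_polyDensity h₀ h₁ h₂ H₁ H₂ H₃ hp
  rw [fderiv_fderiv_comm hC, ← fderiv_fderiv_apply hC]
  -- Differentiation in `t` and `x` acts on the coefficients only and stays within the polynomial
  -- densities, so the first-order formula applies a second time.
  have e : (fun q => fderiv ℝ (polyDensity l₀ l₁ l₂ Q₁ Q₂ Q₃ p) q (τ, ξ, 0)) =
      polyDensity (fun z => fderiv ℝ l₀ z (τ, ξ)) (fun z => fderiv ℝ l₁ z (τ, ξ))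
        (fun z => fderiv ℝ l₂ z (τ, ξ)) (fun z => fderiv ℝ Q₁ z (τ, ξ))
        (fun z => fderiv ℝ Q₂ z (τ, ξ)) (fun z => fderiv ℝ Q₃ z (τ, ξ))
        (fun t => τ * deriv p t) := by
    funext ⟨t, x, u⟩
    rw [fderiv_polyDensity h₀ h₁ h₂ H₁ H₂ H₃ hp]
    simp
  have hp' : ContDiff ℝ ∞ (deriv p) := (contDiff_infty_iff_deriv.1 hp).2
  rw [e, fderiv_polyDensity (smooth_fderiv_apply h₀ _) (smooth_fderiv_apply h₁ _)
    (smooth_fderiv_apply h₂ _) (smooth_fderiv_apply H₁ _) (smooth_fderiv_apply H₂ _)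
    (smooth_fderiv_apply H₃ _) (contDiff_const.mul hp')]
  have z : ((0, 0) : ℝ × ℝ) = 0 := rfl
  simp [polyDensity, z]

end PolyDensity

theorem eq_add_mul_of_fderiv {f : ℝ × ℝ → ℝ} (hf : ContDiff ℝ ∞ f) {s : ℝ}
    (ht : ∀ z, fderiv ℝ f z (1, 0) = 0) (hx : ∀ z, fderiv ℝ f z (0, 1) = s) (z : ℝ × ℝ) :
    f z = f 0 + s * z.2 := by
  have hd : ∀ r : ℝ, HasDerivAt (fun r : ℝ => f (0 + r • z)) (s * z.2 + 0 * r + 0 * r ^ 2) r :=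
    fun r => by
    refine (hasDerivAt_line hf.smooth_differentiable 0 z r).congr_deriv ?_
    have sz : z = z.1 • (1, 0) + z.2 • (0, 1) := by ext <;> simp
    conv_lhs => rw [sz]
    rw [map_add, map_smul, map_smul, ht, hx]
    simp
    ring
  have := eq_cubic_of_hasDerivAt hd 1
  simpa using this

/-- If the `x`-derivative depends only on `t` and the `t`-derivative vanishes, the function is
affine in `x`. -/
theorem deriv_const_of_fderiv {f : ℝ × ℝ → ℝ} (hf : ContDiff ℝ ∞ f) {g : ℝ → ℝ}
    (ht : ∀ z, fderiv ℝ f z (1, 0) = 0) (hx : ∀ z, fderiv ℝ f z (0, 1) = g z.1) (t : ℝ) :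
    g t = g 0 := by
  -- Since `f` does not depend on `t`, neither does its `x`-derivative `g`.
  have h1 : ∀ x, f (t, x) = f (0, x) := by
    intro x
    have := eq_of_fderiv_line_eq_zero hf.smooth_differentiable (0, x) (t, 0) (fun r => by
      have s : ((t, 0) : ℝ × ℝ) = t • (1, 0) := by simp
      conv_lhs => rw [s]
      rw [map_smul, ht]
      simp)
    simpa using this
  rw [← hx (t, 0), ← hx (0, 0)]
  apply fderiv_eq_of_hasDerivAt_line hf.smooth_differentiable
  have := hasDerivAt_line hf.smooth_differentiable (0, 0) (0, 1) 0
  simpa [h1] using this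

/-! ### Constraints on the coefficients, sorted by degree in `u` -/

section Coefficients

variable {α β : ℂ}

/-- The algebraic consequences of `∂_x K_v = ∂_v K_x`. -/
theorem linear_coeff_algebra (h : ¬(α = 0 ∧ β = 0))
    {Lt₁ Lt₂ Qt₁ Qt₂ Qt₃ p Lx₁ Lx₂ a : ℝ} {W : ℂ → ℝ}
    (e : ∀ u v : ℂ, -(Lt₁ * v.re + Lt₂ * v.im + 2 * Qt₁ * (u.re * v.re) +
        Qt₂ * (u.re * v.im + u.im * v.re) + 2 * Qt₃ * (u.im * v.im) +
        4 * p * (u.re ^ 2 + u.im ^ 2) * (u.re * v.re + u.im * v.im)) =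
      Lx₁ * (nonlin α β u v).re + Lx₂ * (nonlin α β u v).im +
        a * (u.re * (nonlin α β u v).re + u.im * (nonlin α β u v).im) + W v) :
    Lx₁ = 0 ∧ Lx₂ = 0 ∧ Qt₁ = 0 ∧ Qt₂ = 0 ∧ Qt₃ = 0 ∧ ∀ v, Lt₁ * v.re + Lt₂ * v.im = -W v := by
  have e0 := e 0
  have f1 := e 1 1
  have f2 := e (-1) 1
  have f3 := e Complex.I 1
  have f4 := e (-Complex.I) 1
  have f5 := e 1 Complex.I
  have f6 := e (-1) Complex.I
  have f7 := e Complex.I Complex.I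
  have f8 := e (-Complex.I) Complex.I
  have f9 := e 2 1
  have f10 := e (2 * Complex.I) 1
  have f11 := e (2 * Complex.I) Complex.I
  have z1 := e0 1
  have z2 := e0 Complex.I
  simp [nonlin, pow_two] at f1 f2 f3 f4 f5 f6 f7 f8 f9 f10 f11 z1 z2
  ring_nf at f1 f2 f3 f4 f5 f6 f7 f8 f9 f10 f11 z1 z2
  -- The hypothesis `e` is polynomial in `u`. The term with `Lx` is its only part of degree two and
  -- equals `Re(γ M_u v)`; the terms with `Qt` are its only part of degree one. The values of `u`
  -- sampled above separate these degrees.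
  have γ : (⟨Lx₁, -Lx₂⟩ : ℂ) = 0 := by
    apply eq_zero_of_mul_coeffs h <;> apply Complex.ext <;> simp <;> linarith
  have γ1 := congrArg Complex.re γ
  have γ2 := congrArg Complex.im γ
  simp at γ1 γ2
  subst γ1 γ2
  refine ⟨rfl, rfl, by linarith, by linarith, by linarith, fun v => ?_⟩
  have := e0 v
  simp [nonlin] at this
  linarith

/-- The derivative of `nonlin α β u w` in `u` in the direction `k`. -/
theorem hasDerivAt_nonlin_left (α β u k w : ℂ) :
    HasDerivAt (fun r : ℝ => nonlin α β (u + r • k) w)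
      (α * (k * conj u + u * conj k) * w + 2 * β * u * k * conj w) 0 := by
  have hu : ∀ u v : ℂ, HasDerivAt (fun r : ℝ => u + r • v) v 0 := fun u v => by
    simpa using ((hasDerivAt_id (0:ℝ)).smul_const v).const_add u
  have hc : HasDerivAt (fun r : ℝ => conj (u + r • k)) (conj k) 0 := by
    simpa using hu (conj u) (conj k)
  refine (((((hu u k).mul hc).const_mul α).mul_const w).add
    ((((hu u k).pow 2).const_mul β).mul_const (conj w))).congr_deriv ?_
  simp
  left
  ring

theorem hasDerivAt_polyGradient (l₁ l₂ κ₁ κ₂ κ₃ p : ℝ) (u k w : ℂ) {n m : ℂ}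
    (hn : nonlin α β u w = n)
    (hm : α * (k * conj u + u * conj k) * w + 2 * β * u * k * conj w = m) :
    HasDerivAt (fun r : ℝ => l₁ * (nonlin α β (u + r • k) w).re +
        l₂ * (nonlin α β (u + r • k) w).im +
        2 * κ₁ * ((u.re + r * k.re) * (nonlin α β (u + r • k) w).re) +
        κ₂ * ((u.re + r * k.re) * (nonlin α β (u + r • k) w).im +
          (u.im + r * k.im) * (nonlin α β (u + r • k) w).re) +
        2 * κ₃ * ((u.im + r * k.im) * (nonlin α β (u + r • k) w).im) +
        4 * p * ((u.re + r * k.re) ^ 2 + (u.im + r * k.im) ^ 2) *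
          ((u.re + r * k.re) * (nonlin α β (u + r • k) w).re +
            (u.im + r * k.im) * (nonlin α β (u + r • k) w).im))
      (l₁ * m.re + l₂ * m.im + 2 * κ₁ * (k.re * n.re + u.re * m.re) +
        κ₂ * (k.re * n.im + u.re * m.im + k.im * n.re + u.im * m.re) +
        2 * κ₃ * (k.im * n.im + u.im * m.im) +
        4 * p * (2 * (u.re * k.re + u.im * k.im) * (u.re * n.re + u.im * n.im) +
          (u.re ^ 2 + u.im ^ 2) * (k.re * n.re + u.re * m.re + k.im * n.im + u.im * m.im))) 0 := by
  have ln := hasDerivAt_nonlin_left α β u k w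
  rw [hm] at ln
  have n1 := Complex.reCLM.hasFDerivAt.comp_hasDerivAt (0:ℝ) ln
  have n2 := Complex.imCLM.hasFDerivAt.comp_hasDerivAt (0:ℝ) ln
  have lre : HasDerivAt (fun r : ℝ => u.re + r * k.re) k.re 0 := by
    simpa using ((hasDerivAt_id (0:ℝ)).mul_const k.re).const_add u.re
  have lim : HasDerivAt (fun r : ℝ => u.im + r * k.im) k.im 0 := by
    simpa using ((hasDerivAt_id (0:ℝ)).mul_const k.im).const_add u.im
  have := (((((n1.const_mul l₁).add (n2.const_mul l₂)).add
    ((lre.mul n1).const_mul (2 * κ₁))).add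
    (((lre.mul n2).add (lim.mul n1)).const_mul κ₂)).add ((lim.mul n2).const_mul (2 * κ₃))).add
    ((((lre.pow 2).add (lim.pow 2)).const_mul (4 * p)).mul ((lre.mul n1).add (lim.mul n2)))
  refine this.congr_deriv ?_
  simp [hn]
  ring

/-- The algebraic consequences of the closedness of `v ↦ K_v`. -/
theorem conditions_algebra {l₁ l₂ κ₁ κ₂ κ₃ p b : ℝ} (hα : p * α.im = 0) (hβ : p * β.im = 0)
    (e : ∀ u n₁ m₁ n₂ m₂ : ℂ, nonlin α β u 1 = n₁ →
      α * (Complex.I * conj u + u * conj Complex.I) * 1 + 2 * β * u * Complex.I * conj 1 = m₁ →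
      nonlin α β u Complex.I = n₂ →
      α * (1 * conj u + u * conj 1) * Complex.I + 2 * β * u * 1 * conj Complex.I = m₂ →
      l₁ * m₁.re + l₂ * m₁.im + 2 * κ₁ * (u.re * m₁.re) +
        κ₂ * (u.re * m₁.im + n₁.re + u.im * m₁.re) + 2 * κ₃ * (n₁.im + u.im * m₁.im) +
        4 * p * (2 * u.im * (u.re * n₁.re + u.im * n₁.im) +
          (u.re ^ 2 + u.im ^ 2) * (u.re * m₁.re + n₁.im + u.im * m₁.im)) =
      l₁ * m₂.re + l₂ * m₂.im + 2 * κ₁ * (n₂.re + u.re * m₂.re) +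
        κ₂ * (n₂.im + u.re * m₂.im + u.im * m₂.re) + 2 * κ₃ * (u.im * m₂.im) +
        4 * p * (2 * u.re * (u.re * n₂.re + u.im * n₂.im) +
          (u.re ^ 2 + u.im ^ 2) * (n₂.re + u.re * m₂.re + u.im * m₂.im)) - b) :
    b = 0 ∧ (⟨l₁, -l₂⟩ : ℂ) * (α - 2 * β) = 0 ∧ (⟨κ₁ - κ₃, -κ₂⟩ : ℂ) * (α - 3 * β) = 0 ∧
      (κ₁ + κ₃) * (α.im - β.im) = 0 := by
  -- In `u`, the terms with `b`, `l`, `κ`, `p` have degrees zero, one, two and four. Opposite points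
  -- separate odd from even degrees, and `hα`, `hβ` remove the quartic terms.
  have e0 := e 0 _ _ _ _ rfl rfl rfl rfl
  have e1 := e 1 _ _ _ _ rfl rfl rfl rfl
  have e2 := e (-1) _ _ _ _ rfl rfl rfl rfl
  have e3 := e Complex.I _ _ _ _ rfl rfl rfl rfl
  have e4 := e (-Complex.I) _ _ _ _ rfl rfl rfl rfl
  have e5 := e (1 + Complex.I) _ _ _ _ rfl rfl rfl rfl
  have e6 := e (-(1 + Complex.I)) _ _ _ _ rfl rfl rfl rfl
  simp [nonlin, pow_two] at e0 e1 e2 e3 e4 e5 e6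
  ring_nf at e1 e2 e3 e4 e5 e6
  refine ⟨e0, ?_, ?_, ?_⟩
  · apply Complex.ext <;> simp <;> linarith
  · apply Complex.ext <;> simp <;> linarith
  · linarith

end Coefficients

/-! ### The classification of densities -/

theorem quarticForm_self (α β : ℂ) (a : ℝ) (u : ℂ) :
    quarticForm α β a 0 a u u = 4 * a * (α.re + β.re) * (u.re ^ 2 + u.im ^ 2) ^ 2 := by
  simp [quarticForm, nonlinDiff]
  ring

/-- The bracket is `-Im(v̄ M_u v) = -Im(α |u|² |v|² + β u² v̄²)`; varying the phase of `v` separates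
`α` from `β`. -/
theorem twist_algebra {α β : ℂ} {b : ℝ} (h : ∀ u v : ℂ,
    b * ((nonlin α β u v).re * v.im - (nonlin α β u v).im * v.re) = 0) :
    b * α.im = 0 ∧ b * β.re = 0 ∧ b * β.im = 0 := by
  have e1 := h 1 1
  have e2 := h 1 Complex.I
  have e3 := h 1 (1 + Complex.I)
  simp only [nonlin, map_one, map_add, Complex.conj_I] at e1 e2 e3
  simp [-mul_eq_zero] at e1 e2 e3
  ring_nf at e1 e2 e3
  refine ⟨?_, ?_, ?_⟩ <;> linarith

/-- The constants parametrize the possible normal forms: `s₀, s₁` for energy and Galilean energy,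
`b` for the twist, `l` for the mass densities, and `κ` for the densities quadratic in `u`. -/
theorem IsFlux.classification {α β : ℂ} (h0 : ¬(α = 0 ∧ β = 0)) {T : Base × ℂ → ℝ}
    {X : ((Base × ℂ) × ℂ) × ℂ → ℝ} (hT : ContDiff ℝ ∞ T) (hX : ContDiff ℝ ∞ X)
    (h : IsFlux α β T X) :
    ∃ (Υ : Base → ℝ) (s₀ s₁ b l₁ l₂ κ₁ κ₂ κ₃ : ℝ), ContDiff ℝ ∞ Υ ∧
      (s₀ * α.im = 0 ∧ s₀ * β.im = 0 ∧ s₁ * α.im = 0 ∧ s₁ * β.im = 0) ∧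
      (b * α.im = 0 ∧ b * β.re = 0 ∧ b * β.im = 0) ∧
      ((⟨l₁, -l₂⟩ : ℂ) * (α - 2 * β) = 0 ∧ (⟨κ₁ - κ₃, -κ₂⟩ : ℂ) * (α - 3 * β) = 0 ∧
        (κ₁ + κ₃) * (α.im - β.im) = 0) ∧
      ∀ (t x : ℝ) (u v : ℂ), T ((t, x, u), v) - baseDx Υ ((t, x, u), v) =
        (s₀ + s₁ * t) * (v.re ^ 2 + v.im ^ 2) + b * (u.re * v.im) + l₁ * u.re + l₂ * u.im +
        (κ₁ + s₁ / 3 * x) * u.re ^ 2 + κ₂ * (u.re * u.im) + (κ₃ + s₁ / 3 * x) * u.im ^ 2 -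
        (s₀ + s₁ * t) * (α.re + β.re) / 6 * (u.re ^ 2 + u.im ^ 2) ^ 2 := by
  obtain ⟨Υ, a₁, a₂, a₃, B, C, X', hΥ, h₁, h₂, h₃, hB, hC, hX', hTe, hf, hB0, hC0⟩ :=
    h.exists_normal_form hT hX
  obtain ⟨b, hb, hBb, hsymm⟩ := linear_part_of_isFlux h₁ h₂ h₃ hB hC hX' hf hB0
  obtain rfl : B = fun q => b q.1 * q.2.2.re := funext hBb
  obtain ⟨K, hK, e⟩ := constant_part_of_isFlux h₁ h₂ h₃ hb hC hX' hf hsymm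
  have h3 : ∀ (q : Base) (v : ℂ), fderiv ℝ (fderiv ℝ (fderiv ℝ C)) q (0, 0, v) (0, 0, v) (0, 0, v) =
      -quarticForm α β (a₁ q.1) (a₂ q.1) (a₃ q.1) q.2.2 v := fun q v => (e q v).2.2.2
  have alg := fun t => quadratic_part_algebra h0 (hsymm t)
    (quarticForm_third_difference hC hC0 h3 t)
  obtain rfl : a₂ = fun _ => 0 := funext fun t => (alg t).1
  obtain rfl : a₃ = a₁ := funext fun t => (alg t).2.1
  obtain ⟨l₁, l₂, Q₁, Q₂, Q₃, s₁, s₂, S₁, S₂, S₃, eC⟩ :=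
    exists_polynomial_of_quarticForm (a₁ := a₃) (a₂ := fun _ => 0) (a₃ := a₃) hC hC0 h3
  obtain ⟨p, hp, hpe⟩ : ∃ p : ℝ → ℝ, ContDiff ℝ ∞ p ∧ ∀ t, p t = -(a₃ t * (α.re + β.re) / 6) :=
    ⟨fun t => -(a₃ t * (α.re + β.re) / 6), ((h₁.mul contDiff_const).div_const 6).neg,
      fun _ => rfl⟩
  have s₀ : ContDiff ℝ ∞ fun _ : ℝ × ℝ => (0:ℝ) := contDiff_const
  obtain rfl : C = polyDensity (fun _ => 0) l₁ l₂ Q₁ Q₂ Q₃ p := by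
    funext ⟨t, x, u⟩
    rw [eC, quarticForm_self, polyDensity, hpe]
    ring
  have z : ((0, 0) : ℝ × ℝ) = 0 := rfl
  have mx : ∀ (t x : ℝ) (u v : ℂ), mixedDx (polyDensity (fun _ => 0) l₁ l₂ Q₁ Q₂ Q₃ p) v (t, x, u) =
      fderiv ℝ l₁ (t, x) (0, 1) * v.re + fderiv ℝ l₂ (t, x) (0, 1) * v.im +
        2 * fderiv ℝ Q₁ (t, x) (0, 1) * (u.re * v.re) +
        fderiv ℝ Q₂ (t, x) (0, 1) * (u.re * v.im + u.im * v.re) +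
        2 * fderiv ℝ Q₃ (t, x) (0, 1) * (u.im * v.im) := by
    intro t x u v
    rw [mixedDx, fderiv_fderiv_polyDensity s₀ s₁ s₂ S₁ S₂ S₃ hp]
    ring
  have mxv : ∀ (t x : ℝ) (u v : ℂ), fderiv ℝ (mixedDx (polyDensity (fun _ => 0) l₁ l₂ Q₁ Q₂ Q₃ p) v)
      (t, x, u) (0, 0, v) = 2 * fderiv ℝ Q₁ (t, x) (0, 1) * (v.re * v.re) +
        fderiv ℝ Q₂ (t, x) (0, 1) * (v.re * v.im + v.im * v.re) +
        2 * fderiv ℝ Q₃ (t, x) (0, 1) * (v.im * v.im) := by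
    intro t x u v
    apply fderiv_eq_of_hasDerivAt_line (contDiff_mixedDx hC v).smooth_differentiable
    refine (hasDerivAt_quadratic (mixedDx (polyDensity (fun _ => 0) l₁ l₂ Q₁ Q₂ Q₃ p) v (t, x, u))
      (2 * fderiv ℝ Q₁ (t, x) (0, 1) * (v.re * v.re) +
        fderiv ℝ Q₂ (t, x) (0, 1) * (v.re * v.im + v.im * v.re) +
        2 * fderiv ℝ Q₃ (t, x) (0, 1) * (v.im * v.im)) 0).congr_of_eventuallyEq
      (Filter.Eventually.of_forall fun r => ?_)
    simp [mx]
    ring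
  -- the coefficients of `u²`, `uū`, `ū²` are affine in `x`
  have q0 : ∀ (t x : ℝ) (v : ℂ), 3 * (fderiv ℝ Q₁ (t, x) (0, 1) * v.re ^ 2 +
      fderiv ℝ Q₂ (t, x) (0, 1) * (v.re * v.im) + fderiv ℝ Q₃ (t, x) (0, 1) * v.im ^ 2) =
      deriv a₃ t * (v.re ^ 2 + v.im ^ 2) := by
    intro t x v
    have := (e (t, x, 0) v).2.2.1
    rw [mxv] at this
    simp [nonlin_zero] at this
    linarith
  have qx : ∀ t x : ℝ, fderiv ℝ Q₁ (t, x) (0, 1) = deriv a₃ t / 3 ∧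
      fderiv ℝ Q₂ (t, x) (0, 1) = 0 ∧ fderiv ℝ Q₃ (t, x) (0, 1) = deriv a₃ t / 3 := by
    intro t x
    have e1 := q0 t x 1
    have e2 := q0 t x Complex.I
    have e3 := q0 t x (1 + Complex.I)
    simp at e1 e2 e3
    refine ⟨?_, ?_, ?_⟩ <;> linarith
  -- The formulas `qx` for the `x`-derivatives of the `Q`s, read off at `u = 0`, cancel the terms
  -- with `a'` at every `u`; only the term with `b` is left.
  have hbt := fun t => twist_algebra (b := b t) (α := α) (β := β) (fun u v => by
    have := (e (t, 0, u) v).2.2.1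
    rw [mxv, (qx t 0).1, (qx t 0).2.1, (qx t 0).2.2] at this
    simp only [deriv_const] at this
    linarith)
  -- the `x`-dependence of `K`
  have mx' : ∀ v : ℂ, mixedDx (polyDensity (fun _ => 0) l₁ l₂ Q₁ Q₂ Q₃ p) v = fun q =>
      (fderiv ℝ l₁ (q.1, q.2.1) (0, 1) * v.re + fderiv ℝ l₂ (q.1, q.2.1) (0, 1) * v.im) +
        2 * deriv a₃ q.1 / 3 * (q.2.2.re * v.re + q.2.2.im * v.im) := by
    intro v
    funext ⟨t, x, u⟩
    rw [mx, (qx t x).1, (qx t x).2.1, (qx t x).2.2]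
    ring
  -- In `mixedDx`, the only part depending on `u` has coefficient `2a'(t)/3`, which is free of `x`.
  -- Hence `C_{xxu}` is a function of `t` and `x` alone.
  have W : ∀ v : ℂ, ∃ w : ℝ × ℝ → ℝ, ContDiff ℝ ∞ w ∧ ∀ (t x : ℝ) (u : ℂ),
      fderiv ℝ (mixedDx (polyDensity (fun _ => 0) l₁ l₂ Q₁ Q₂ Q₃ p) v) (t, x, u) (0, 1, 0) =
        w (t, x) := by
    intro v
    refine ⟨fun z => fderiv ℝ (mixedDx (polyDensity (fun _ => 0) l₁ l₂ Q₁ Q₂ Q₃ p) v)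
      (z.1, z.2, 0) (0, 1, 0), (smooth_fderiv_apply (contDiff_mixedDx hC v) _).comp
        (by fun_prop : ContDiff ℝ ∞ fun z : ℝ × ℝ => ((z.1, z.2, 0) : Base)), fun t x u => ?_⟩
    apply fderiv_eq_of_hasDerivAt_line (contDiff_mixedDx hC v).smooth_differentiable
    have := (hasDerivAt_line (contDiff_mixedDx hC v).smooth_differentiable (t, x, 0)
      (0, 1, 0) 0).add_const (2 * deriv a₃ t / 3 * (u.re * v.re + u.im * v.im))
    refine (this.congr_deriv ?_).congr_of_eventuallyEq (Filter.Eventually.of_forall fun r => ?_)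
    · simp
    · simp [mx']
  choose w hw hwe using W
  -- Equality of the mixed derivatives of `K` in `x` and in `u` along `v`, with `K_x = -C_t`
  -- inserted.
  have Kxv : ∀ (t x : ℝ) (u v : ℂ),
      -(fderiv ℝ l₁ (t, x) (1, 0) * v.re + fderiv ℝ l₂ (t, x) (1, 0) * v.im +
        2 * fderiv ℝ Q₁ (t, x) (1, 0) * (u.re * v.re) +
        fderiv ℝ Q₂ (t, x) (1, 0) * (u.re * v.im + u.im * v.re) +
        2 * fderiv ℝ Q₃ (t, x) (1, 0) * (u.im * v.im) +
        4 * deriv p t * (u.re ^ 2 + u.im ^ 2) * (u.re * v.re + u.im * v.im)) =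
      fderiv ℝ l₁ (t, x) (0, 1) * (nonlin α β u v).re +
        fderiv ℝ l₂ (t, x) (0, 1) * (nonlin α β u v).im + 2 * deriv a₃ t / 3 *
          (u.re * (nonlin α β u v).re + u.im * (nonlin α β u v).im) +
        fderiv ℝ (w v) (t, x) (0, 1) := by
    intro t x u v
    have f1 := hasDerivAt_line hC.smooth_fderiv.smooth_differentiable (t, x, u) (0, 0, v) 0
    have f2 := hasDerivAt_line hC.smooth_fderiv.smooth_differentiable (t, x, u) (0, 1, 0) 0
    have f3 := hasDerivAt_line (hw v).smooth_differentiable (t, x) (0, 1) 0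
    have := mixed_fderiv_eq hK (t, x, u) (0, 1, 0) (0, 0, v)
      (fun r => (e _ 0).1) (fun r => (e _ v).2.1)
      (f1.clm_apply (hasDerivAt_const 0 ((1, 0, 0) : Base))).neg
      ((((f2.clm_apply (hasDerivAt_const 0 ((0, 0, nonlin α β u v) : Base))).add f3).sub_const
        (deriv b t * u.re * v.im)).congr_of_eventuallyEq
        (Filter.Eventually.of_forall fun r => by simp [hwe]))
    have t1 := fderiv_fderiv_comm hC (t, x, u) (1, 0, 0) (0, 0, v)
    have t2 := mx' (nonlin α β u v)
    have t3 := congrFun t2 (t, x, u)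
    rw [mixedDx] at t3
    rw [fderiv_fderiv_polyDensity s₀ s₁ s₂ S₁ S₂ S₃ hp] at t1
    simp [t3, ← t1] at this
    linarith
  have alg2 := fun t x => linear_coeff_algebra h0 (Kxv t x)
  have lt : ∀ t x : ℝ, ∀ v : ℂ, fderiv ℝ l₁ (t, x) (1, 0) * v.re +
      fderiv ℝ l₂ (t, x) (1, 0) * v.im = 0 := by
    intro t x v
    rw [(alg2 t x).2.2.2.2.2]
    -- `l₁` and `l₂` have zero `x`-derivative everywhere, so `C_{xxu}` vanishes, and with it the
    -- source of their `t`-derivative.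
    have hw0 : w v = fun _ => 0 := by
      funext ⟨t, x⟩
      rw [← hwe v t x 0]
      apply fderiv_eq_of_hasDerivAt_line (contDiff_mixedDx hC v).smooth_differentiable
      refine (hasDerivAt_const 0 0).congr_of_eventuallyEq (Filter.Eventually.of_forall fun r => ?_)
      simp [mx', (alg2 _ _).1, (alg2 _ _).2.1]
    simp [hw0]
  have cl₁ : ∀ z, l₁ z = l₁ 0 := fun z => by
    have := eq_add_mul_of_fderiv s₁ (s := 0) (fun z => by simpa using lt z.1 z.2 1)
      (fun z => (alg2 z.1 z.2).1) z
    linarith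
  have cl₂ : ∀ z, l₂ z = l₂ 0 := fun z => by
    have := eq_add_mul_of_fderiv s₂ (s := 0) (fun z => by simpa using lt z.1 z.2 Complex.I)
      (fun z => (alg2 z.1 z.2).2.1) z
    linarith
  -- `Q₁` has zero `t`-derivative and `x`-derivative `a'/3`; so `a'` is constant, and `a` is affine
  -- in `t`.
  have ca' : ∀ t, deriv a₃ t / 3 = deriv a₃ 0 / 3 := deriv_const_of_fderiv S₁
    (g := fun t => deriv a₃ t / 3) (fun z => (alg2 z.1 z.2).2.2.1) (fun z => (qx z.1 z.2).1)
  have cQ₁ := eq_add_mul_of_fderiv S₁ (s := deriv a₃ 0 / 3) (fun z => (alg2 z.1 z.2).2.2.1)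
    (fun z => by rw [← ca' z.1]; exact (qx z.1 z.2).1)
  have cQ₂ := eq_add_mul_of_fderiv S₂ (s := 0) (fun z => (alg2 z.1 z.2).2.2.2.1)
    (fun z => (qx z.1 z.2).2.1)
  have cQ₃ := eq_add_mul_of_fderiv S₃ (s := deriv a₃ 0 / 3) (fun z => (alg2 z.1 z.2).2.2.2.2.1)
    (fun z => by rw [← ca' z.1]; exact (qx z.1 z.2).2.2)
  have ca : ∀ t, a₃ t = a₃ 0 + deriv a₃ 0 * t := by
    intro t
    have := eq_cubic_of_hasDerivAt (f := a₃) (c₀ := deriv a₃ 0) (c₁ := 0) (c₂ := 0) (fun r => by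
      refine (h₁.smooth_differentiable r).hasDerivAt.congr_deriv ?_
      linarith [ca' r]) t
    linarith
  -- the dependence of `K` on `u`
  have hw0 : ∀ (t x : ℝ) (u v : ℂ), fderiv ℝ (mixedDx (polyDensity (fun _ => 0) l₁ l₂ Q₁ Q₂ Q₃ p) v)
      (t, x, u) (0, 1, 0) = 0 := by
    intro t x u v
    apply fderiv_eq_of_hasDerivAt_line (contDiff_mixedDx hC v).smooth_differentiable
    refine (hasDerivAt_const 0 (2 * deriv a₃ t / 3 *
      (u.re * v.re + u.im * v.im))).congr_of_eventuallyEq (Filter.Eventually.of_forall fun r => ?_)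
    simp [mx', (alg2 _ _).1, (alg2 _ _).2.1]
  have Kv : ∀ (t : ℝ) (u v : ℂ), fderiv ℝ K (t, 0, u) (0, 0, v) =
      l₁ 0 * (nonlin α β u v).re + l₂ 0 * (nonlin α β u v).im +
        2 * Q₁ 0 * (u.re * (nonlin α β u v).re) +
        Q₂ 0 * (u.re * (nonlin α β u v).im + u.im * (nonlin α β u v).re) +
        2 * Q₃ 0 * (u.im * (nonlin α β u v).im) +
        4 * p t * (u.re ^ 2 + u.im ^ 2) *
          (u.re * (nonlin α β u v).re + u.im * (nonlin α β u v).im) - deriv b t * u.re * v.im := by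
    intro t u v
    rw [(e _ v).2.1, hw0, fderiv_polyDensity s₀ s₁ s₂ S₁ S₂ S₃ hp, cl₁, cl₂, cQ₁, cQ₂, cQ₃]
    simp [polyDensity, z]
  -- Symmetry of the second derivatives of `K` in the directions `1` and `i` of `u`. The slice `x =
  -- 0` suffices, and there the `Q`s take their values at the origin.
  have alg3 : ∀ t, _ := fun t => conditions_algebra (α := α) (β := β) (l₁ := l₁ 0) (l₂ := l₂ 0)
    (κ₁ := Q₁ 0) (κ₂ := Q₂ 0) (κ₃ := Q₃ 0) (p := p t) (b := deriv b t)
    (by rw [hpe]; linear_combination -(α.re + β.re) / 6 * (alg t).2.2.1)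
    (by rw [hpe]; linear_combination -(α.re + β.re) / 6 * (alg t).2.2.2)
    (fun u n₁ m₁ n₂ m₂ hn₁ hm₁ hn₂ hm₂ => by
      have g₁ := hasDerivAt_polyGradient (l₁ 0) (l₂ 0) (Q₁ 0) (Q₂ 0) (Q₃ 0) (p t) u
        Complex.I 1 hn₁ hm₁
      have g₂ := hasDerivAt_polyGradient (l₁ 0) (l₂ 0) (Q₁ 0) (Q₂ 0) (Q₃ 0) (p t) u
        1 Complex.I hn₂ hm₂
      have g₃ : HasDerivAt (fun r : ℝ => deriv b t * (u.re + r)) (deriv b t) 0 := by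
        simpa using ((hasDerivAt_id (0:ℝ)).const_add u.re).const_mul (deriv b t)
      have := mixed_fderiv_eq hK (t, 0, u) (0, 0, 1) (0, 0, Complex.I)
        (fun r => rfl) (fun r => rfl)
        (g₁.congr_of_eventuallyEq (Filter.Eventually.of_forall fun r => by
          have hr : ((t, 0, u) + r • (0, 0, Complex.I) : Base) = (t, 0, u + r • Complex.I) := by
            simp
          dsimp only
          rw [hr, Kv]
          simp))
        ((g₂.sub g₃).congr_of_eventuallyEq (Filter.Eventually.of_forall fun r => by
          have hr : ((t, 0, u) + r • (0, 0, 1) : Base) = (t, 0, u + r • 1) := by simp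
          dsimp only
          rw [hr, Kv]
          simp))
      simp only [Complex.one_re, Complex.one_im, Complex.I_re, Complex.I_im] at this
      linear_combination this)
  have cb : ∀ t, b t = b 0 := fun t =>
    is_const_of_deriv_eq_zero hb.smooth_differentiable (fun t => (alg3 t).1) t 0
  refine ⟨Υ, a₃ 0, deriv a₃ 0, b 0, l₁ 0, l₂ 0, Q₁ 0, Q₂ 0, Q₃ 0, hΥ, ?_, hbt 0, (alg3 0).2,
    fun t x u v => ?_⟩
  · have r1 := alg 0
    have r2 := alg 1
    rw [ca 1] at r2
    refine ⟨r1.2.2.1, r1.2.2.2, ?_, ?_⟩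
    · linear_combination r2.2.2.1 - r1.2.2.1
    · linear_combination r2.2.2.2 - r1.2.2.2
  · rw [hTe, quadDensity, polyDensity, hpe, cl₁, cl₂, cQ₁, cQ₂, cQ₃]
    simp only
    rw [ca t, cb t]
    ring

/-! ### Jets -/

/-- The projection that forgets the higher derivatives. -/
noncomputable def jetProj {m n : ℕ} (h : m ≤ n) : JetSpace n →L[ℝ] JetSpace m :=
  (ContinuousLinearMap.fst ℝ ℝ (ℝ × (Fin (n + 1) → ℂ))).prod
    (((ContinuousLinearMap.fst ℝ ℝ (Fin (n + 1) → ℂ)).comp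
      (ContinuousLinearMap.snd ℝ ℝ (ℝ × (Fin (n + 1) → ℂ)))).prod
    (ContinuousLinearMap.pi fun k : Fin (m + 1) =>
      (ContinuousLinearMap.proj (R := ℝ) (φ := fun _ : Fin (n + 1) => ℂ)
        (Fin.castLE (Nat.succ_le_succ h) k)).comp
      ((ContinuousLinearMap.snd ℝ ℝ (Fin (n + 1) → ℂ)).comp
      (ContinuousLinearMap.snd ℝ ℝ (ℝ × (Fin (n + 1) → ℂ))))))

theorem jetProj_apply {m n : ℕ} (h : m ≤ n) (j : JetSpace n) :
    jetProj h j = (j.1, j.2.1, fun k => j.2.2 (Fin.castLE (Nat.succ_le_succ h) k)) := rfl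

theorem jetProj_jet {m n : ℕ} (h : m ≤ n) (t x : ℝ) (w : ℕ → ℂ) :
    jetProj h (jet n t x w) = jet m t x w := rfl

theorem totalDx_jet {E : Type*} [NormedAddCommGroup E] [NormedSpace ℝ E] {n : ℕ}
    (f : JetSpace n → E) (t x : ℝ) (w : ℕ → ℂ) :
    totalDx f (jet (n + 1) t x w) = fderiv ℝ f (jet n t x w) (0, 1, fun k => w (k + 1)) := by
  simp [totalDx, jet]

theorem totalDx_comp_jetProj {m n : ℕ} (h : m ≤ n) {X : JetSpace m → ℝ}
    (hX : Differentiable ℝ X) (t x : ℝ) (w : ℕ → ℂ) :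
    totalDx (fun j => X (jetProj h j)) (jet (n + 1) t x w) = totalDx X (jet (m + 1) t x w) := by
  rw [totalDx_jet, totalDx_jet, fderiv_comp_clm hX, jetProj_jet]
  rfl

theorem exists_jet_eq {n : ℕ} (j : JetSpace n) : ∃ w : ℕ → ℂ, j = jet n j.1 j.2.1 w := by
  refine ⟨fun k => if h : k < n + 1 then j.2.2 ⟨k, h⟩ else 0, ?_⟩
  ext k
  · simp [jet]
  · simp [jet]
  · have := k.2
    simp only [jet]
    rw [dif_pos this]

/-- If the total `x`-derivative of a function does not involve the highest derivative, then the
function has lower order. -/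
theorem exists_lower_order {m : ℕ} {X : JetSpace (m + 1) → ℝ} (hX : ContDiff ℝ ∞ X)
    {F : ℝ → ℝ → (ℕ → ℂ) → ℝ}
    (hF : ∀ t x w w', (∀ i ≤ m + 1, w i = w' i) → F t x w = F t x w')
    (h : ∀ t x w, F t x w + totalDx X (jet (m + 1 + 1) t x w) = 0) :
    ∃ X' : JetSpace m → ℝ, ContDiff ℝ ∞ X' ∧
      ∀ t x w, F t x w + totalDx X' (jet (m + 1) t x w) = 0 := by
  have top : ∀ (j : JetSpace (m + 1)) (c : ℂ),
      fderiv ℝ X j (0, 0, Pi.single (Fin.last (m + 1)) c) = 0 := by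
    intro j c
    obtain ⟨w, hw⟩ := exists_jet_eq j
    have h1 := h j.1 j.2.1 w
    -- The coordinate of index `m + 2` enters only linearly through `D_x X`, multiplied by the top
    -- derivative of `X`; shifting it by `c` isolates that derivative.
    have h2 := h j.1 j.2.1 (Function.update w (m + 2) (w (m + 2) + c))
    have hFF : F j.1 j.2.1 (Function.update w (m + 2) (w (m + 2) + c)) = F j.1 j.2.1 w :=
      hF _ _ _ _ fun i hi => Function.update_of_ne (by omega) _ _
    have hj : jet (m + 1) j.1 j.2.1 (Function.update w (m + 2) (w (m + 2) + c)) = j := by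
      conv_rhs => rw [hw]
      simp only [jet]
      congr 2
      funext k
      exact Function.update_of_ne (by omega) _ _
    rw [totalDx_jet, hj, hFF] at h2
    rw [totalDx_jet, ← hw] at h1
    have hs : ((0, 1, fun k : Fin (m + 1 + 1) =>
        Function.update w (m + 2) (w (m + 2) + c) (k + 1)) : JetSpace (m + 1)) =
        ((0, 1, fun k : Fin (m + 1 + 1) => w (k + 1)) : JetSpace (m + 1)) +
          (0, 0, Pi.single (Fin.last (m + 1)) c) := by
      ext k
      · simp
      · simp
      · refine Fin.lastCases ?_ (fun i => ?_) k
        · simp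
        · have : (i : ℕ) + 1 ≠ m + 2 := by omega
          simp [Function.update_of_ne this]
    rw [hs, map_add] at h2
    linarith
  let L : JetSpace m → JetSpace (m + 1) := fun j => (j.1, j.2.1, Fin.snoc j.2.2 0)
  have hL : ContDiff ℝ ∞ L := by
    refine contDiff_fst.prodMk (contDiff_snd.fst.prodMk (contDiff_pi.2 fun k => ?_))
    refine Fin.lastCases ?_ (fun i => ?_) k
    · simpa using contDiff_const
    · simp only [Fin.snoc_castSucc]
      fun_prop
  have hX' : ContDiff ℝ ∞ fun j => X (L j) := hX.comp hL
  have e : X = fun j => X (L (jetProj (Nat.le_succ m) j)) := by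
    funext j
    have := eq_of_fderiv_line_eq_zero hX.smooth_differentiable (L (jetProj (Nat.le_succ m) j))
      (0, 0, Pi.single (Fin.last (m + 1)) (j.2.2 (Fin.last (m + 1)))) (fun r => top _ _)
    rw [← this]
    congr 1
    ext k
    · simp [L, jetProj_apply]
    · simp [L, jetProj_apply]
    · refine Fin.lastCases ?_ (fun i => ?_) k
      · simp [L]
      · simp [L, jetProj_apply]
        rfl
  refine ⟨fun j => X (L j), hX', fun t x w => ?_⟩
  rw [← h t x w]
  congr 1
  conv_rhs => rw [e]
  exact (totalDx_comp_jetProj (Nat.le_succ m) hX'.smooth_differentiable t x w).symm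

/-- If the identity involves no coordinate above `N + 1` outside `D_x X`, the superfluous orders of
`X` can be removed one at a time. -/
theorem exists_order_eq (N : ℕ) {F : ℝ → ℝ → (ℕ → ℂ) → ℝ}
    (hF : ∀ t x w w', (∀ i ≤ N + 1, w i = w' i) → F t x w = F t x w') {m : ℕ}
    {X : JetSpace m → ℝ} (hX : ContDiff ℝ ∞ X)
    (h : ∀ t x w, F t x w + totalDx X (jet (m + 1) t x w) = 0) :
    ∃ X' : JetSpace N → ℝ, ContDiff ℝ ∞ X' ∧
      ∀ t x w, F t x w + totalDx X' (jet (N + 1) t x w) = 0 := by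
  have down : ∀ (d : ℕ) (X : JetSpace (N + d) → ℝ), ContDiff ℝ ∞ X →
      (∀ t x w, F t x w + totalDx X (jet (N + d + 1) t x w) = 0) →
      ∃ X' : JetSpace N → ℝ, ContDiff ℝ ∞ X' ∧
        ∀ t x w, F t x w + totalDx X' (jet (N + 1) t x w) = 0 := by
    intro d
    induction d with
    | zero => exact fun X hX h => ⟨X, hX, h⟩
    | succ d ih =>
      intro X hX h
      obtain ⟨X', hX', h'⟩ := exists_lower_order (m := N + d) hX
        (fun t x w w' hw => hF t x w w' fun i hi => hw i (by omega)) h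
      exact ih X' hX' h'
  -- `X` is first regarded as a function of order `N + m`, which also covers `m < N`.
  refine down m (fun j => X (jetProj (Nat.le_add_left m N) j))
    (hX.comp (jetProj (Nat.le_add_left m N)).contDiff) fun t x w => ?_
  rw [totalDx_comp_jetProj (Nat.le_add_left m N) hX.smooth_differentiable]
  exact h t x w

/-- The point of `JetSpace 1` with coordinates `t, x, u, u_x`. -/
noncomputable def jetOne : Base × ℂ →L[ℝ] JetSpace 1 :=
  LinearMap.toContinuousLinearMap
    { toFun := fun p => (p.1.1, p.1.2.1, ![p.1.2.2, p.2])
      map_add' := fun p q => by ext k <;> [skip; skip; fin_cases k] <;> simp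
      map_smul' := fun r p => by ext k <;> [skip; skip; fin_cases k] <;> simp }

/-- The point of `JetSpace 3` with coordinates `t, x, u, u_x, u_xx, u_xxx`. -/
noncomputable def jetThree : ((Base × ℂ) × ℂ) × ℂ →L[ℝ] JetSpace 3 :=
  LinearMap.toContinuousLinearMap
    { toFun := fun p => (p.1.1.1.1, p.1.1.1.2.1, ![p.1.1.1.2.2, p.1.1.2, p.1.2, p.2])
      map_add' := fun p q => by ext k <;> [skip; skip; fin_cases k] <;> simp
      map_smul' := fun r p => by ext k <;> [skip; skip; fin_cases k] <;> simp }

theorem jetOne_apply (p : Base × ℂ) : jetOne p = (p.1.1, p.1.2.1, ![p.1.2.2, p.2]) := rfl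

theorem jetThree_apply (p : ((Base × ℂ) × ℂ) × ℂ) : jetThree p =
    (p.1.1.1.1, p.1.1.1.2.1, ![p.1.1.1.2.2, p.1.1.2, p.1.2, p.2]) := rfl

theorem jet_one_eq (t x : ℝ) (w : ℕ → ℂ) : jet 1 t x w = jetOne ((t, x, w 0), w 1) := by
  rw [jetOne_apply]
  ext k
  · rfl
  · rfl
  · fin_cases k <;> rfl

theorem jet_three_eq (t x : ℝ) (w : ℕ → ℂ) :
    jet 3 t x w = jetThree ((((t, x, w 0), w 1), w 2), w 3) := by
  rw [jetThree_apply]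
  ext k
  · rfl
  · rfl
  · fin_cases k <;> rfl

theorem evolution_jet (α β : ℂ) (t x : ℝ) (w : ℕ → ℂ) :
    evolution α β (jet 3 t x w) = -(nonlin α β (w 0) (w 1) + w 3) := by
  simp only [evolution, jet, nonlin]
  change -(α * conj (w 0) * w 0 * w 1 + β * w 0 ^ 2 * conj (w 1) + w 3) = _
  ring

theorem contDiff_evolution (α β : ℂ) : ContDiff ℝ ∞ (evolution α β) := by
  have e : evolution α β = fun j => -(nonlin α β (j.2.2 0) (j.2.2 1) + j.2.2 3) := by
    funext j
    simp only [evolution, nonlin]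
    ring
  rw [e]
  exact ((contDiff_nonlin α β (by fun_prop) (by fun_prop)).add (by fun_prop)).neg

theorem totalDx_evolution (α β : ℂ) (t x : ℝ) (w : ℕ → ℂ) :
    totalDx (evolution α β) (jet 4 t x w) =
      -(nonlinDiff α β (w 0) (w 1) + nonlin α β (w 0) (w 2) + w 4) := by
  rw [totalDx_jet]
  apply fderiv_eq_of_hasDerivAt_line (contDiff_evolution α β).smooth_differentiable
  have l3 : HasDerivAt (fun r : ℝ => w 3 + r • w 4) (w 4) 0 := by
    simpa using ((hasDerivAt_id (0:ℝ)).smul_const (w 4)).const_add (w 3)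
  refine (((hasDerivAt_nonlin α β (w 0) (w 1) (w 2)).add l3).neg).congr_of_eventuallyEq
    (Filter.Eventually.of_forall fun r => ?_)
  simp only [evolution, jet, nonlin]
  change -(α * conj (w 0 + r • w 1) * (w 0 + r • w 1) * (w 1 + r • w 2) +
    β * (w 0 + r • w 1) ^ 2 * conj (w 1 + r • w 2) + (w 3 + r • w 4)) = _
  simp only [Pi.add_apply, Pi.neg_apply]
  ring

theorem totalDt_eq (α β : ℂ) {T : JetSpace 1 → ℝ} (hT : Differentiable ℝ T) (t x : ℝ)
    (w : ℕ → ℂ) : totalDt α β T t x w = fderiv ℝ (fun p => T (jetOne p)) ((t, x, w 0), w 1)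
      ((1, 0, -(nonlin α β (w 0) (w 1) + w 3)),
        -(nonlinDiff α β (w 0) (w 1) + nonlin α β (w 0) (w 2) + w 4)) := by
  rw [fderiv_comp_clm hT, totalDt, ← jet_one_eq, ← totalDx_evolution α β t x,
    ← evolution_jet α β t x, jetOne_apply]
  congr 3
  funext k
  fin_cases k <;> rfl

theorem totalDx_eq {X : JetSpace 3 → ℝ} (hX : Differentiable ℝ X) (t x : ℝ) (w : ℕ → ℂ) :
    totalDx X (jet 4 t x w) = fderiv ℝ (fun p => X (jetThree p)) ((((t, x, w 0), w 1), w 2), w 3)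
      ((((0, 1, w 1), w 2), w 3), w 4) := by
  rw [fderiv_comp_clm hX, totalDx_jet, ← jet_three_eq, jetThree_apply]
  congr 3
  funext k
  fin_cases k <;> rfl

/-- For `T` of order one, `D_t T` depends on coordinates up to index four, whence the order `N = 3`
of the flux. -/
theorem IsConservedDensity.exists_isFlux {α β : ℂ} {T : JetSpace 1 → ℝ}
    (h : IsConservedDensity α β T) : ContDiff ℝ ∞ (fun p => T (jetOne p)) ∧
      ∃ X : ((Base × ℂ) × ℂ) × ℂ → ℝ, ContDiff ℝ ∞ X ∧ IsFlux α β (fun p => T (jetOne p)) X := by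
  obtain ⟨hT, m, X, hX, e⟩ := h
  obtain ⟨X', hX', e'⟩ := exists_order_eq 3 (F := totalDt α β T) (fun t x w w' hw => by
    rw [totalDt_eq α β hT.smooth_differentiable, totalDt_eq α β hT.smooth_differentiable,
      hw 0 (by norm_num), hw 1 (by norm_num), hw 2 (by norm_num), hw 3 (by norm_num),
      hw 4 (by norm_num)]) hX e
  refine ⟨hT.comp jetOne.contDiff, fun p => X' (jetThree p), hX'.comp jetThree.contDiff,
    fun q v k l m => ?_⟩
  have := e' q.1 q.2.1 (fun i => if i = 0 then q.2.2 else if i = 1 then v else if i = 2 then k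
    else if i = 3 then l else m)
  rw [totalDt_eq α β hT.smooth_differentiable, totalDx_eq hX'.smooth_differentiable] at this
  simpa using this

theorem isConservedDensity_of_isFlux {α β : ℂ} {T : JetSpace 1 → ℝ} (hT : ContDiff ℝ ∞ T)
    {X : ((Base × ℂ) × ℂ) × ℂ → ℝ} (hX : ContDiff ℝ ∞ X)
    (h : IsFlux α β (fun p => T (jetOne p)) X) : IsConservedDensity α β T := by
  have hL : ContDiff ℝ ∞ fun j : JetSpace 3 =>
      (((((j.1, j.2.1, j.2.2 0), j.2.2 1), j.2.2 2), j.2.2 3) : ((Base × ℂ) × ℂ) × ℂ) := by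
    fun_prop
  have hX' := hX.comp hL
  refine ⟨hT, 3, _, hX', fun t x w => ?_⟩
  rw [totalDt_eq α β hT.smooth_differentiable, totalDx_eq hX'.smooth_differentiable]
  exact h (t, x, w 0) (w 1) (w 2) (w 3) (w 4)

/-! ### The fluxes of the eight densities -/

@[fun_prop]
theorem contDiff_complex_re {V : Type*} [NormedAddCommGroup V] [NormedSpace ℝ V] {f : V → ℂ}
    (hf : ContDiff ℝ ∞ f) : ContDiff ℝ ∞ fun p => (f p).re :=
  Complex.reCLM.contDiff.comp hf

@[fun_prop]
theorem contDiff_complex_im {V : Type*} [NormedAddCommGroup V] [NormedSpace ℝ V] {f : V → ℂ}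
    (hf : ContDiff ℝ ∞ f) : ContDiff ℝ ∞ fun p => (f p).im :=
  Complex.imCLM.contDiff.comp hf

/-- The densities in real coordinates. -/
theorem density_eq (α β : ℂ) (j : JetSpace 1) :
    density α β 0 j = (j.2.2 0).re ^ 2 + (j.2.2 0).im ^ 2 ∧
    density α β 1 j = -3 * ((j.2.2 1).re ^ 2 + (j.2.2 1).im ^ 2) +
      1 / 2 * (α.re + β.re) * ((j.2.2 0).re ^ 2 + (j.2.2 0).im ^ 2) ^ 2 ∧
    density α β 2 j = j.1 * (-3 * ((j.2.2 1).re ^ 2 + (j.2.2 1).im ^ 2) +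
      1 / 2 * (α.re + β.re) * ((j.2.2 0).re ^ 2 + (j.2.2 0).im ^ 2) ^ 2) -
      j.2.1 * ((j.2.2 0).re ^ 2 + (j.2.2 0).im ^ 2) ∧
    density α β 3 j = 2 * (j.2.2 0).re ∧
    density α β 4 j = 2 * (j.2.2 0).im ∧
    density α β 5 j = (j.2.2 0).re ^ 2 - (j.2.2 0).im ^ 2 ∧
    density α β 6 j = 2 * ((j.2.2 0).re * (j.2.2 0).im) ∧
    density α β 7 j = -2 * ((j.2.2 1).im * (j.2.2 0).re - (j.2.2 1).re * (j.2.2 0).im) := by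
  refine ⟨?_, ?_, ?_, ?_, ?_, ?_, ?_, ?_⟩ <;>
    simp [density, complexDensity, pow_two] <;> ring

section Line

variable (u a : ℂ)

theorem hasDerivAt_line_re : HasDerivAt (fun r : ℝ => (u + r • a).re) a.re 0 := by
  simpa using ((hasDerivAt_id (0 : ℝ)).mul_const a.re).const_add u.re

theorem hasDerivAt_line_im : HasDerivAt (fun r : ℝ => (u + r • a).im) a.im 0 := by
  simpa using ((hasDerivAt_id (0 : ℝ)).mul_const a.im).const_add u.im

theorem hasDerivAt_line_real (s b : ℝ) : HasDerivAt (fun r : ℝ => s + r • b) b 0 := by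
  simpa using ((hasDerivAt_id (0 : ℝ)).mul_const b).const_add s

theorem hasDerivAt_line_normSq : HasDerivAt
    (fun r : ℝ => (u + r • a).re ^ 2 + (u + r • a).im ^ 2) (2 * (u.re * a.re + u.im * a.im)) 0 := by
  refine (((hasDerivAt_line_re u a).pow 2).add ((hasDerivAt_line_im u a).pow 2)).congr_deriv ?_
  simp
  ring

/-- The derivative of `Re (ū v)`. -/
theorem hasDerivAt_line_inner (v b : ℂ) : HasDerivAt
    (fun r : ℝ => (u + r • a).re * (v + r • b).re + (u + r • a).im * (v + r • b).im)
    (a.re * v.re + u.re * b.re + (a.im * v.im + u.im * b.im)) 0 := by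
  refine (((hasDerivAt_line_re u a).mul (hasDerivAt_line_re v b)).add
    ((hasDerivAt_line_im u a).mul (hasDerivAt_line_im v b))).congr_deriv ?_
  simp

/-- The derivative of `Im (ū v)`. -/
theorem hasDerivAt_line_cross (v b : ℂ) : HasDerivAt
    (fun r : ℝ => (v + r • b).im * (u + r • a).re - (v + r • b).re * (u + r • a).im)
    (b.im * u.re + v.im * a.re - (b.re * u.im + v.re * a.im)) 0 := by
  refine (((hasDerivAt_line_im v b).mul (hasDerivAt_line_re u a)).sub
    ((hasDerivAt_line_re v b).mul (hasDerivAt_line_im u a))).congr_deriv ?_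
  simp

/-- The derivative of `Re (u v)`. -/
theorem hasDerivAt_line_mul_re (v b : ℂ) : HasDerivAt
    (fun r : ℝ => (u + r • a).re * (v + r • b).re - (u + r • a).im * (v + r • b).im)
    (a.re * v.re + u.re * b.re - (a.im * v.im + u.im * b.im)) 0 := by
  refine (((hasDerivAt_line_re u a).mul (hasDerivAt_line_re v b)).sub
    ((hasDerivAt_line_im u a).mul (hasDerivAt_line_im v b))).congr_deriv ?_
  simp

/-- The derivative of `Im (u v)`. -/
theorem hasDerivAt_line_mul_im (v b : ℂ) : HasDerivAt
    (fun r : ℝ => (u + r • a).re * (v + r • b).im + (u + r • a).im * (v + r • b).re)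
    (a.re * v.im + u.re * b.im + (a.im * v.re + u.im * b.re)) 0 := by
  refine (((hasDerivAt_line_re u a).mul (hasDerivAt_line_im v b)).add
    ((hasDerivAt_line_im u a).mul (hasDerivAt_line_re v b))).congr_deriv ?_
  simp

end Line

theorem isFlux_mass (α β : ℂ) (h : α.im = β.im) :
    IsFlux α β (fun p => p.1.2.2.re ^ 2 + p.1.2.2.im ^ 2)
      (fun p => 2 * (p.1.1.1.2.2.re * p.1.2.re + p.1.1.1.2.2.im * p.1.2.im) -
        (p.1.1.2.re ^ 2 + p.1.1.2.im ^ 2) +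
        (α.re + β.re) / 2 * (p.1.1.1.2.2.re ^ 2 + p.1.1.1.2.2.im ^ 2) ^ 2) := by
  rintro ⟨t, x, u⟩ v k l m
  rw [fderiv_eq_of_hasDerivAt_line (ContDiff.smooth_differentiable (by fun_prop))
      (hasDerivAt_line_normSq u _),
    fderiv_eq_of_hasDerivAt_line (ContDiff.smooth_differentiable (by fun_prop))
      ((((hasDerivAt_line_inner u v k l).const_mul 2).sub (hasDerivAt_line_normSq v k)).add
        (((hasDerivAt_line_normSq u v).pow 2).const_mul ((α.re + β.re) / 2)))]
  simp [nonlin, pow_two, h]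
  ring

theorem isFlux_energy (α β : ℂ) (hα : α.im = 0) (hβ : β.im = 0) :
    IsFlux α β (fun p => -3 * (p.2.re ^ 2 + p.2.im ^ 2) + 1 / 2 * (α.re + β.re) * (p.1.2.2.re ^ 2 +
      p.1.2.2.im ^ 2) ^ 2)
      (fun p => -6 * (p.1.1.2.re * p.2.re + p.1.1.2.im * p.2.im) + 3 * (p.1.2.re ^ 2 +
        p.1.2.im ^ 2) + 2 * (α.re + β.re) * ((p.1.1.1.2.2.re ^ 2 +
        p.1.1.1.2.2.im ^ 2) * (p.1.1.1.2.2.re * p.1.2.re + p.1.1.1.2.2.im * p.1.2.im)) + (α.re +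
        β.re) ^ 2 / 3 * (p.1.1.1.2.2.re ^ 2 + p.1.1.1.2.2.im ^ 2) ^ 3 + (-4 * α.re +
        2 * β.re) * ((p.1.1.1.2.2.re ^ 2 + p.1.1.1.2.2.im ^ 2) * (p.1.1.2.re ^ 2 +
        p.1.1.2.im ^ 2)) + (-2 * α.re - 8 * β.re) * (p.1.1.1.2.2.re * p.1.1.2.re +
        p.1.1.1.2.2.im * p.1.1.2.im) ^ 2) := by
  rintro ⟨t, x, u⟩ v k l m
  rw [fderiv_eq_of_hasDerivAt_line (ContDiff.smooth_differentiable (by fun_prop))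
      (((hasDerivAt_line_normSq v _).const_mul (-3)).add
        (((hasDerivAt_line_normSq u _).pow 2).const_mul (1 / 2 * (α.re + β.re)))),
    fderiv_eq_of_hasDerivAt_line (ContDiff.smooth_differentiable (by fun_prop))
      ((((((((hasDerivAt_line_inner v k l m).const_mul (-6)).add
        ((hasDerivAt_line_normSq k l).const_mul 3)).add
        (((hasDerivAt_line_normSq u v).mul (hasDerivAt_line_inner u v k l)).const_mul (2 * (α.re +
          β.re)))).add
        (((hasDerivAt_line_normSq u v).pow 3).const_mul ((α.re + β.re) ^ 2 / 3))).add
        (((hasDerivAt_line_normSq u v).mul (hasDerivAt_line_normSq v k)).const_mul (-4 * α.re +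
          2 * β.re))).add
        (((hasDerivAt_line_inner u v v k).pow 2).const_mul (-2 * α.re - 8 * β.re))))]
  simp [nonlin, nonlinDiff, pow_two, hα, hβ]
  ring

/-- With mass `M = |u|²`, energy `E` and fluxes `X_M`, `X_E`, the combination `t X_E - x X_M` leaves
the defect `E - X_M`. It equals `-D_x(2 Re(ū u_x))`, whence the last term of the flux. -/
theorem isFlux_galilean (α β : ℂ) (hα : α.im = 0) (hβ : β.im = 0) :
    IsFlux α β (fun p => p.1.1 * (-3 * (p.2.re ^ 2 + p.2.im ^ 2) + 1 / 2 * (α.re +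
      β.re) * (p.1.2.2.re ^ 2 + p.1.2.2.im ^ 2) ^ 2) - p.1.2.1 * (p.1.2.2.re ^ 2 + p.1.2.2.im ^ 2))
      (fun p => p.1.1.1.1 * (-6 * (p.1.1.2.re * p.2.re + p.1.1.2.im * p.2.im) + 3 * (p.1.2.re ^ 2 +
        p.1.2.im ^ 2) + 2 * (α.re + β.re) * ((p.1.1.1.2.2.re ^ 2 +
        p.1.1.1.2.2.im ^ 2) * (p.1.1.1.2.2.re * p.1.2.re + p.1.1.1.2.2.im * p.1.2.im)) + (α.re +
        β.re) ^ 2 / 3 * (p.1.1.1.2.2.re ^ 2 + p.1.1.1.2.2.im ^ 2) ^ 3 + (-4 * α.re +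
        2 * β.re) * ((p.1.1.1.2.2.re ^ 2 + p.1.1.1.2.2.im ^ 2) * (p.1.1.2.re ^ 2 +
        p.1.1.2.im ^ 2)) + (-2 * α.re - 8 * β.re) * (p.1.1.1.2.2.re * p.1.1.2.re +
        p.1.1.1.2.2.im * p.1.1.2.im) ^ 2) - p.1.1.1.2.1 * (2 * (p.1.1.1.2.2.re * p.1.2.re +
        p.1.1.1.2.2.im * p.1.2.im) - (p.1.1.2.re ^ 2 + p.1.1.2.im ^ 2) + (α.re +
        β.re) / 2 * (p.1.1.1.2.2.re ^ 2 + p.1.1.1.2.2.im ^ 2) ^ 2) +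
        2 * (p.1.1.1.2.2.re * p.1.1.2.re + p.1.1.1.2.2.im * p.1.1.2.im)) := by
  rintro ⟨t, x, u⟩ v k l m
  rw [fderiv_eq_of_hasDerivAt_line (ContDiff.smooth_differentiable (by fun_prop))
      (((hasDerivAt_line_real t _).mul (((hasDerivAt_line_normSq v _).const_mul (-3)).add
        (((hasDerivAt_line_normSq u _).pow 2).const_mul (1 / 2 * (α.re + β.re))))).sub
        ((hasDerivAt_line_real x _).mul (hasDerivAt_line_normSq u _))),
    fderiv_eq_of_hasDerivAt_line (ContDiff.smooth_differentiable (by fun_prop))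
      ((((hasDerivAt_line_real t _).mul ((((((((hasDerivAt_line_inner v k l m).const_mul (-6)).add
        ((hasDerivAt_line_normSq k l).const_mul 3)).add
        (((hasDerivAt_line_normSq u v).mul (hasDerivAt_line_inner u v k l)).const_mul (2 * (α.re +
          β.re)))).add
        (((hasDerivAt_line_normSq u v).pow 3).const_mul ((α.re + β.re) ^ 2 / 3))).add
        (((hasDerivAt_line_normSq u v).mul (hasDerivAt_line_normSq v k)).const_mul (-4 * α.re +
          2 * β.re))).add
        (((hasDerivAt_line_inner u v v k).pow 2).const_mul (-2 * α.re - 8 * β.re))))).sub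
          ((hasDerivAt_line_real x _).mul ((((hasDerivAt_line_inner u v k l).const_mul 2).sub
          (hasDerivAt_line_normSq v k)).add ((hasDerivAt_line_normSq u v).pow 2 |>.const_mul
          ((α.re + β.re) / 2))))).add ((hasDerivAt_line_inner u v v k).const_mul 2))]
  simp [nonlin, nonlinDiff, pow_two, hα, hβ]
  ring

/-- For `α = 2β` the equation is itself a conservation law, since the nonlinearity is `D_x(β u² ū)`.
-/
theorem isFlux_re (α β : ℂ) (h : α = 2 * β) :
    IsFlux α β (fun p => 2 * p.1.2.2.re)
      (fun p => 2 * (p.1.2.re + (p.1.1.1.2.2.re ^ 2 + p.1.1.1.2.2.im ^ 2) * (β.re * p.1.1.1.2.2.re -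
        β.im * p.1.1.1.2.2.im))) := by
  rintro ⟨t, x, u⟩ v k l m
  rw [fderiv_eq_of_hasDerivAt_line (ContDiff.smooth_differentiable (by fun_prop))
      ((hasDerivAt_line_re u _).const_mul 2),
    fderiv_eq_of_hasDerivAt_line (ContDiff.smooth_differentiable (by fun_prop))
      (((hasDerivAt_line_re k l).add ((hasDerivAt_line_normSq u v).mul
        (((hasDerivAt_line_re u v).const_mul β.re).sub
        ((hasDerivAt_line_im u v).const_mul β.im)))).const_mul 2)]
  simp [nonlin, pow_two, h]
  ring

theorem isFlux_im (α β : ℂ) (h : α = 2 * β) :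
    IsFlux α β (fun p => 2 * p.1.2.2.im)
      (fun p => 2 * (p.1.2.im + (p.1.1.1.2.2.re ^ 2 + p.1.1.1.2.2.im ^ 2) * (β.re * p.1.1.1.2.2.im +
        β.im * p.1.1.1.2.2.re))) := by
  rintro ⟨t, x, u⟩ v k l m
  rw [fderiv_eq_of_hasDerivAt_line (ContDiff.smooth_differentiable (by fun_prop))
      ((hasDerivAt_line_im u _).const_mul 2),
    fderiv_eq_of_hasDerivAt_line (ContDiff.smooth_differentiable (by fun_prop))
      (((hasDerivAt_line_im k l).add ((hasDerivAt_line_normSq u v).mul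
        (((hasDerivAt_line_im u v).const_mul β.re).add
        ((hasDerivAt_line_re u v).const_mul β.im)))).const_mul 2)]
  simp [nonlin, pow_two, h]
  ring

/-- For `α = 3β`, the nonlinearity multiplied by `u` is `D_x(β u³ ū)`. -/
theorem isFlux_sq_re (α β : ℂ) (h : α = 3 * β) :
    IsFlux α β (fun p => p.1.2.2.re ^ 2 - p.1.2.2.im ^ 2)
      (fun p => 2 * (p.1.1.1.2.2.re * p.1.2.re - p.1.1.1.2.2.im * p.1.2.im) - (p.1.1.2.re ^ 2 -
        p.1.1.2.im ^ 2) + 2 * ((p.1.1.1.2.2.re ^ 2 +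
        p.1.1.1.2.2.im ^ 2) * (β.re * (p.1.1.1.2.2.re * p.1.1.1.2.2.re -
        p.1.1.1.2.2.im * p.1.1.1.2.2.im) - β.im * (p.1.1.1.2.2.re * p.1.1.1.2.2.im +
        p.1.1.1.2.2.im * p.1.1.1.2.2.re)))) := by
  rintro ⟨t, x, u⟩ v k l m
  rw [fderiv_eq_of_hasDerivAt_line (ContDiff.smooth_differentiable (by fun_prop))
      (((hasDerivAt_line_re u _).pow 2).sub ((hasDerivAt_line_im u _).pow 2)),
    fderiv_eq_of_hasDerivAt_line (ContDiff.smooth_differentiable (by fun_prop))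
      ((((hasDerivAt_line_mul_re u v k l).const_mul 2).sub (((hasDerivAt_line_re v k).pow 2).sub
        ((hasDerivAt_line_im v k).pow 2))).add (((hasDerivAt_line_normSq u v).mul
        (((hasDerivAt_line_mul_re u v u v).const_mul β.re).sub
        ((hasDerivAt_line_mul_im u v u v).const_mul β.im))).const_mul 2))]
  simp [nonlin, pow_two, h]
  ring

theorem isFlux_sq_im (α β : ℂ) (h : α = 3 * β) :
    IsFlux α β (fun p => 2 * (p.1.2.2.re * p.1.2.2.im))
      (fun p => 2 * (p.1.1.1.2.2.re * p.1.2.im + p.1.1.1.2.2.im * p.1.2.re) -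
        2 * (p.1.1.2.re * p.1.1.2.im) + 2 * ((p.1.1.1.2.2.re ^ 2 +
        p.1.1.1.2.2.im ^ 2) * (β.re * (p.1.1.1.2.2.re * p.1.1.1.2.2.im +
        p.1.1.1.2.2.im * p.1.1.1.2.2.re) + β.im * (p.1.1.1.2.2.re * p.1.1.1.2.2.re -
        p.1.1.1.2.2.im * p.1.1.1.2.2.im)))) := by
  rintro ⟨t, x, u⟩ v k l m
  rw [fderiv_eq_of_hasDerivAt_line (ContDiff.smooth_differentiable (by fun_prop))
      (((hasDerivAt_line_re u _).mul (hasDerivAt_line_im u _)).const_mul 2),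
    fderiv_eq_of_hasDerivAt_line (ContDiff.smooth_differentiable (by fun_prop))
      ((((hasDerivAt_line_mul_im u v k l).const_mul 2).sub (((hasDerivAt_line_re v k).mul
        (hasDerivAt_line_im v k)).const_mul 2)).add (((hasDerivAt_line_normSq u v).mul
        (((hasDerivAt_line_mul_im u v u v).const_mul β.re).add
        ((hasDerivAt_line_mul_re u v u v).const_mul β.im))).const_mul 2))]
  simp [nonlin, pow_two, h]
  ring

theorem isFlux_twist (α β : ℂ) (hα : α.im = 0) (hβ : β = 0) :
    IsFlux α β (fun p => -2 * (p.2.im * p.1.2.2.re - p.2.re * p.1.2.2.im))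
      (fun p => -2 * ((p.2.im * p.1.1.1.2.2.re - p.2.re * p.1.1.1.2.2.im) -
        2 * (p.1.2.im * p.1.1.2.re - p.1.2.re * p.1.1.2.im) + α.re * ((p.1.1.1.2.2.re ^ 2 +
        p.1.1.1.2.2.im ^ 2) * (p.1.1.2.im * p.1.1.1.2.2.re - p.1.1.2.re * p.1.1.1.2.2.im)))) := by
  rintro ⟨t, x, u⟩ v k l m
  rw [fderiv_eq_of_hasDerivAt_line (ContDiff.smooth_differentiable (by fun_prop))
      ((hasDerivAt_line_cross u _ v _).const_mul (-2)),
    fderiv_eq_of_hasDerivAt_line (ContDiff.smooth_differentiable (by fun_prop))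
      ((((hasDerivAt_line_cross u v l m).sub ((hasDerivAt_line_cross v k k l).const_mul 2)).add
        (((hasDerivAt_line_normSq u v).mul
        (hasDerivAt_line_cross u v v k)).const_mul α.re)).const_mul (-2))]
  simp [nonlin, nonlinDiff, pow_two, hα, hβ]
  ring

theorem contDiff_density (α β : ℂ) (i : Fin 8) : ContDiff ℝ ∞ (density α β i) := by
  have h := density_eq α β
  have e : ∀ {i : Fin 8} {f : JetSpace 1 → ℝ}, ContDiff ℝ ∞ f →
      (∀ j, density α β i j = f j) → ContDiff ℝ ∞ (density α β i) := fun hf hi => by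
    rwa [funext hi]
  fin_cases i
  · exact e (by fun_prop) fun j => (h j).1
  · exact e (by fun_prop) fun j => (h j).2.1
  · exact e (by fun_prop) fun j => (h j).2.2.1
  · exact e (by fun_prop) fun j => (h j).2.2.2.1
  · exact e (by fun_prop) fun j => (h j).2.2.2.2.1
  · exact e (by fun_prop) fun j => (h j).2.2.2.2.2.1
  · exact e (by fun_prop) fun j => (h j).2.2.2.2.2.2.1
  · exact e (by fun_prop) fun j => (h j).2.2.2.2.2.2.2

theorem isConservedDensity_density (α β : ℂ) (i : Fin 8) (hi : Admitted α β i) :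
    IsConservedDensity α β (density α β i) := by
  have h := density_eq α β
  have e : ∀ {i : Fin 8} {T : Base × ℂ → ℝ} {X : ((Base × ℂ) × ℂ) × ℂ → ℝ}, IsFlux α β T X →
      ContDiff ℝ ∞ X → (∀ p, density α β i (jetOne p) = T p) →
      IsConservedDensity α β (density α β i) := fun hf hX hT =>
    isConservedDensity_of_isFlux (contDiff_density α β _) hX (by rwa [funext hT])
  fin_cases i
  · exact e (isFlux_mass α β hi) (by fun_prop) fun p => (h _).1
  · exact e (isFlux_energy α β hi.1 hi.2) (by fun_prop) fun p => (h _).2.1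
  · exact e (isFlux_galilean α β hi.1 hi.2) (by fun_prop) fun p => (h _).2.2.1
  · exact e (isFlux_re α β hi) (by fun_prop) fun p => (h _).2.2.2.1
  · exact e (isFlux_im α β hi) (by fun_prop) fun p => (h _).2.2.2.2.1
  · exact e (isFlux_sq_re α β hi) (by fun_prop) fun p => (h _).2.2.2.2.2.1
  · exact e (isFlux_sq_im α β hi) (by fun_prop) fun p => (h _).2.2.2.2.2.2.1
  · exact e (isFlux_twist α β hi.1 hi.2) (by fun_prop) fun p => (h _).2.2.2.2.2.2.2

/-! ### Independence and completeness -/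

/-- The total `x`-derivative of a function of order zero, as a function of `t, x, u`. -/
theorem totalDx_jet_zero {Υ : JetSpace 0 → ℝ} (hΥ : Differentiable ℝ Υ) (t x : ℝ) (w : ℕ → ℂ) :
    totalDx Υ (jet 1 t x w) =
      fderiv ℝ (fun q : Base => Υ (q.1, q.2.1, fun _ => q.2.2)) (t, x, w 0) (0, 1, w 1) := by
  symm
  apply fderiv_eq_of_hasDerivAt_line
  · fun_prop
  · rw [totalDx_jet]
    refine ((hasDerivAt_line hΥ (jet 0 t x w) (0, 1, fun k => w (k + 1)) 0).congr_deriv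
      (by simp)).congr_of_eventuallyEq (Filter.Eventually.of_forall fun r => ?_)
    simp only [jet]
    congr 1
    ext k
    · simp
    · simp
    · obtain rfl : k = 0 := Subsingleton.elim (α := Fin 1) _ _
      simp

/-- The right side is affine in `v` and is `df` evaluated on `(0, 1, v)`, so degree in `v` and
symmetry of the second derivatives of `f` are all that is needed; the admission conditions play no
role. -/
theorem eq_zero_of_sum_density_eq_baseDx {α β : ℂ} {c : Fin 8 → ℝ} {f : Base → ℝ}
    (hf : ContDiff ℝ ∞ f)
    (h : ∀ q v, ∑ k, c k * density α β k (jetOne (q, v)) = fderiv ℝ f q (0, 1, v)) :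
    ∀ k, c k = 0 := by
  have G : ∀ (t x : ℝ) (u v : ℂ), fderiv ℝ f (t, x, u) (0, 1, v) =
      c 0 * (u.re ^ 2 + u.im ^ 2) + (c 1 + c 2 * t) * (-3 * (v.re ^ 2 + v.im ^ 2) +
      1 / 2 * (α.re + β.re) * (u.re ^ 2 + u.im ^ 2) ^ 2) - c 2 * x * (u.re ^ 2 + u.im ^ 2) +
      2 * c 3 * u.re + 2 * c 4 * u.im + c 5 * (u.re ^ 2 - u.im ^ 2) + 2 * c 6 * (u.re * u.im) -
      2 * c 7 * (v.im * u.re - v.re * u.im) := fun t x u v => by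
    obtain ⟨d0, d1, d2, d3, d4, d5, d6, d7⟩ := density_eq α β (jetOne ((t, x, u), v))
    rw [← h, Fin.sum_univ_eight, d0, d1, d2, d3, d4, d5, d6, d7]
    simp only [jetOne_apply, Matrix.cons_val_zero, Matrix.cons_val_one]
    ring
  have split : ∀ (q : Base) (v : ℂ), fderiv ℝ f q (0, 0, v) =
      fderiv ℝ f q (0, 1, v) - fderiv ℝ f q (0, 1, 0) := fun q v => by
    rw [← map_sub]
    simp
  -- At `x = 0` and `u = 0`, comparing `v = 1` with `v = -1` isolates the coefficient of `|v|²`.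
  have even : ∀ t : ℝ, c 1 + c 2 * t = 0 := fun t => by
    have h1 := split (t, 0, 0) 1
    have h2 := split (t, 0, 0) (-1)
    have h3 : fderiv ℝ f (t, 0, 0) (0, 0, -1) = -fderiv ℝ f (t, 0, 0) (0, 0, 1) := by
      rw [← map_neg]
      simp
    rw [h3, h1, G, G, G] at h2
    simp at h2
    linarith
  have c1 : c 1 = 0 := by simpa using even 0
  have c2 : c 2 = 0 := by simpa [c1] using even 1
  have vert : ∀ (t x : ℝ) (u v : ℂ), fderiv ℝ f (t, x, u) (0, 0, v) =
      -(2 * c 7 * (v.im * u.re - v.re * u.im)) := fun t x u v => by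
    rw [split, G, G, c1, c2]
    simp
  have lin : ∀ a : ℝ, HasDerivAt (fun r : ℝ => a * r) a 0 := fun a => by
    simpa using (hasDerivAt_id (0 : ℝ)).const_mul a
  -- The twist form `u₁ dv₂ - u₂ dv₁`-type pairing is not closed: the mixed derivatives of `f` in
  -- `Re u` and `Im u` would differ by `4 c₇`.
  have c7 : c 7 = 0 := by
    have m := mixed_fderiv_eq hf (0, 0, 0) (0, 0, 1) (0, 0, Complex.I)
      (fun r => (vert _ _ _ _).trans (by simp : _ = 2 * c 7 * r))
      (fun r => (vert _ _ _ _).trans (by simp : _ = -(2 * c 7) * r)) (lin _) (lin _)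
    linarith
  -- Now `f` is independent of `u`, so `f_x` is as well; differentiating `f_x` in `u` along `a`
  -- gives zero.
  have horiz : ∀ u a : ℂ, c 0 * (2 * (u.re * a.re + u.im * a.im)) + 2 * c 3 * a.re +
      2 * c 4 * a.im + c 5 * (a.re * u.re + u.re * a.re - (a.im * u.im + u.im * a.im)) +
      c 6 * (a.re * u.im + u.re * a.im + (a.im * u.re + u.im * a.re)) = 0 := fun u a =>
    mixed_fderiv_eq hf (0, 0, u) (0, 1, 0) (0, 0, a)
      (P := fun r => c 0 * ((u + r • a).re ^ 2 + (u + r • a).im ^ 2) + 2 * c 3 * (u + r • a).re +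
        2 * c 4 * (u + r • a).im +
        c 5 * ((u + r • a).re * (u + r • a).re - (u + r • a).im * (u + r • a).im) +
        c 6 * ((u + r • a).re * (u + r • a).im + (u + r • a).im * (u + r • a).re))
      (fun r => (G _ _ _ _).trans (by
        rw [c1, c2]
        simp
        ring))
      (fun r => (vert _ _ _ _).trans (by simp [c7] : _ = (0 : ℝ)))
      ((((((hasDerivAt_line_normSq u a).const_mul (c 0)).add
        ((hasDerivAt_line_re u a).const_mul (2 * c 3))).add
        ((hasDerivAt_line_im u a).const_mul (2 * c 4))).add
        ((hasDerivAt_line_mul_re u a u a).const_mul (c 5))).add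
        ((hasDerivAt_line_mul_im u a u a).const_mul (c 6)))
      (hasDerivAt_const _ _)
  have z1 := horiz 0 1
  have z2 := horiz 0 Complex.I
  have z3 := horiz 1 1
  have z4 := horiz Complex.I Complex.I
  have z5 := horiz 1 Complex.I
  simp at z1 z2 z3 z4 z5
  intro k
  fin_cases k <;> simp <;> linarith

theorem linearIndependent_density {α β : ℂ} {c : Fin 8 → ℝ}
    (h : EquivModDx (fun j => ∑ k, c k * density α β k j) (fun _ => 0)) : ∀ k, c k = 0 := by
  obtain ⟨m, Υ, hΥ, e⟩ := h
  obtain ⟨Υ', hΥ', e'⟩ := exists_order_eq 0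
    (F := fun t x w => -∑ k, c k * density α β k (jet 1 t x w))
    (fun t x w w' hw => by
      simp only [jet_one_eq, hw 0 (by norm_num), hw 1 (by norm_num)]) hΥ
    (fun t x w => by
      rw [← e t x w]
      ring)
  have hf : ContDiff ℝ ∞ fun q : Base => Υ' (q.1, q.2.1, fun _ => q.2.2) :=
    hΥ'.comp (by fun_prop)
  refine eq_zero_of_sum_density_eq_baseDx (α := α) (β := β) hf fun q v => ?_
  have := e' q.1 q.2.1 fun i => if i = 0 then q.2.2 else v
  rw [totalDx_jet_zero hΥ'.smooth_differentiable, jet_one_eq] at this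
  simp at this
  linarith

theorem IsConservedDensity.exists_equivModDx {α β : ℂ} (h0 : ¬(α = 0 ∧ β = 0))
    {T : JetSpace 1 → ℝ} (hT : IsConservedDensity α β T) :
    ∃ c : Fin 8 → ℝ, (∀ k, c k ≠ 0 → Admitted α β k) ∧
      EquivModDx T (fun j => ∑ k, c k * density α β k j) := by
  obtain ⟨hT', X, hX, hF⟩ := hT.exists_isFlux
  obtain ⟨Υ, s₀, s₁, b, l₁, l₂, κ₁, κ₂, κ₃, hΥ, ⟨a1, a2, a3, a4⟩, ⟨b1, b2, b3⟩, ⟨d1, d2, d3⟩, e⟩ :=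
    hF.classification h0 hT' hX
  -- The extra term antisymmetrizes the twist: with `u = u₁ + i u₂` and `v = v₁ + i v₂`, `u₁ v₂ =
  -- (u₁ v₂ - u₂ v₁)/2 + D_x(u₁ u₂)/2`.
  have hf : ContDiff ℝ ∞ fun q : Base => Υ q + b / 2 * (q.2.2.re * q.2.2.im) :=
    hΥ.add (by fun_prop)
  set f : Base → ℝ := fun q => Υ q + b / 2 * (q.2.2.re * q.2.2.im)
  have hf' : ContDiff ℝ ∞ fun j : JetSpace 0 => f (j.1, j.2.1, j.2.2 0) := hf.comp (by fun_prop)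
  -- The factors `-1/3` and `-1/4` undo the normalizations `-3|u_x|²` and `-2(u₁ v₂ - u₂ v₁)`; `κ₁
  -- u₁² + κ₃ u₂²` is split into multiples of `|u|²` and `Re u²`.
  refine ⟨![(κ₁ + κ₃) / 2, -s₀ / 3, -s₁ / 3, l₁ / 2, l₂ / 2, (κ₁ - κ₃) / 2, κ₂ / 2, -b / 4],
    ?_, 0, _, hf', fun t x w => ?_⟩
  · have z2 : (⟨l₁, -l₂⟩ : ℂ) ≠ 0 → α = 2 * β := fun hz =>
      sub_eq_zero.1 ((mul_eq_zero.1 d1).resolve_left hz)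
    have z3 : (⟨κ₁ - κ₃, -κ₂⟩ : ℂ) ≠ 0 → α = 3 * β := fun hz =>
      sub_eq_zero.1 ((mul_eq_zero.1 d2).resolve_left hz)
    intro k hk
    fin_cases k <;> simp at hk <;> simp only [Admitted]
    · exact sub_eq_zero.1 ((mul_eq_zero.1 d3).resolve_left hk)
    · exact ⟨(mul_eq_zero.1 a1).resolve_left hk, (mul_eq_zero.1 a2).resolve_left hk⟩
    · exact ⟨(mul_eq_zero.1 a3).resolve_left hk, (mul_eq_zero.1 a4).resolve_left hk⟩
    · exact z2 fun hz => hk (by simpa using congrArg Complex.re hz)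
    · exact z2 fun hz => hk (by simpa using congrArg Complex.im hz)
    · exact z3 fun hz => hk (by simpa using congrArg Complex.re hz)
    · exact z3 fun hz => hk (by simpa using congrArg Complex.im hz)
    · exact ⟨(mul_eq_zero.1 b1).resolve_left hk, Complex.ext ((mul_eq_zero.1 b2).resolve_left hk)
        ((mul_eq_zero.1 b3).resolve_left hk)⟩
  · have hd : fderiv ℝ f (t, x, w 0) (0, 1, w 1) = baseDx Υ ((t, x, w 0), w 1) +
        b / 2 * ((w 1).re * (w 0).im + (w 0).re * (w 1).im) := by
      refine fderiv_eq_of_hasDerivAt_line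
        hf.smooth_differentiable
        (((hasDerivAt_line hΥ.smooth_differentiable (t, x, w 0) (0, 1, w 1) 0).add
        (((hasDerivAt_line_re (w 0) (w 1)).mul (hasDerivAt_line_im (w 0) (w 1))).const_mul
          (b / 2))).congr_deriv ?_)
      simp [baseDx]
    refine Eq.trans ?_ ((totalDx_jet_zero hf'.smooth_differentiable t x w).trans hd).symm
    obtain ⟨d0, d1, d2, d3, d4, d5, d6, d7⟩ := density_eq α β (jetOne ((t, x, w 0), w 1))
    have e := e t x (w 0) (w 1)
    rw [jet_one_eq]
    beta_reduce
    rw [Fin.sum_univ_eight, d0, d1, d2, d3, d4, d5, d6, d7]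
    simp [jetOne_apply] at e ⊢
    linear_combination e

end ComplexMKdV

theorem theorem7 (α β : ℂ) :
    -- each of the listed densities is a conserved density in its case
    (∀ k : Fin 8, Admitted α β k → IsConservedDensity α β (density α β k)) ∧
    -- the admitted densities are linearly independent modulo total x-derivatives
    (∀ c : Fin 8 → ℝ, (∀ k, c k ≠ 0 → Admitted α β k) →
      EquivModDx (fun j => ∑ k, c k * density α β k j) (fun _ => 0) → ∀ k, c k = 0) ∧
    -- there are no others: they span all conserved densities modulo total x-derivatives
    (¬(α = 0 ∧ β = 0) → ∀ T : JetSpace 1 → ℝ, IsConservedDensity α β T →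
      ∃ c : Fin 8 → ℝ, (∀ k, c k ≠ 0 → Admitted α β k) ∧
        EquivModDx T (fun j => ∑ k, c k * density α β k j)) :=
  ⟨isConservedDensity_density α β, fun _ _ h => linearIndependent_density h,
    fun h0 _ hT => hT.exists_equivModDx h0⟩
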